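/- Let $m>0$, let $N\ge 0$ and $X_1<X_2<\dots<X_N$ be real numbers, and for $1\le J\le N$ let $F_J:\mathbb C\to\mathbb C$ be of the form $$F_J(\psi)=-\nabla U_J(\psi),\qquad U_J(\psi)=u_J(|\psi|^2),\qquad u_J\in C^2(\mathbb R;\mathbb R),\qquad \psi\in\mathbb C,$$ where $\nabla$ is the gradient with respect to $(\mathrm{Re}\,\psi,\mathrm{Im}\,\psi)$ and $\mathbb R^2$ is identified with $\mathbb C$. Assume that there are $A_J\in\mathbb R$ and $B_J\ge 0$ such that $$U_J(\psi)\ge A_J-B_J|\psi|^2\quad(\psi\in\mathbb C,\ 1\le J\le N),\qquad \sum_J B_J<m.$$ Let $\mathscr E=H^1(\mathbb R)\oplus L^2(\mathbb R)$ be the space of complex-valued states $\Psi=(\psi,\pi)$ with the norm $\|\Psi\|_{\mathscr E}^2=\|\pi\|_{L^2}^2+\|\psi'\|_{L^2}^2+m^2\|\psi\|_{L^2}^2$. Consider, for $\Psi(t)=(\psi(\cdot,t),\pi(\cdot,t))$, the Cauchy problem $$\dot\psi=\pi,\qquad \dot\pi=\psi''-m^2\psi+\sum_J\delta(x-X_J)F_J(\psi(X_J,t)),\qquad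 (x,t)\in\mathbb R^2,\qquad \Psi|_{t=0}=\Psi_0,$$ where the equations are understood in the sense of distributions on $\mathbb R^2$ and $\psi(X_J,t)$ is the value of the continuous representative of $\psi(\cdot,t)\in H^1(\mathbb R)$. Then: 1. For every $\Psi_0\in\mathscr E$ the Cauchy problem has a unique solution $\Psi\in C(\mathbb R,\mathscr E)$. 2. For each $t\in\mathbb R$ the map $W(t):\Psi_0\mapsto\Psi(t)$ is continuous in $\mathscr E$. 3. The energy and the charge $$\mathcal H(\Psi)=\frac12\int_{\mathbb R}\left(|\pi|^2+|\psi'|^2+m^2|\psi|^2\right)dx+\sum_J U_J(\psi(X_J)),\qquad \mathcal Q(\Psi)=\frac i2\int_{\mathbb R}\left(\overline\psi\,\pi-\overline\pi\,\psi\right)dx$$ are conserved: $\mathcal H(\Psi(t))=\mathcal H(\Psi_0)$ and $\mathcal Q(\Psi(t))=\mathcal Q(\Psi_0)$ for all $t\in\mathbb R$. 4. There is a constant $C(\Psi_0)$, independent of $t$, such that $\|\Psi(t)\|_{\mathscr E}\le C(\Psi_0)$ for all $t\in\mathbb R$. -/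

import Mathlib

open MeasureTheory Set Filter Topology
open scoped ENNReal ContDiff Gradient ComplexConjugate

noncomputable section

namespace KGOsc

/-! ### The Sobolev space on the line -/

/-- The complex Hilbert space of square integrable functions on the real line. -/
abbrev L2 : Type := Lp ℂ 2 (volume : Measure ℝ)

/-- `g` is the derivative of `f` in the sense of distributions on the line: for every
test function `φ`, one has `∫ φ' f = - ∫ φ g`. -/
def HasWeakDeriv (f g : ℝ → ℂ) : Prop :=
  ∀ φ : ℝ → ℝ, ContDiff ℝ ∞ φ → HasCompactSupport φ →
    ∫ x, deriv φ x • f x = -(∫ x, φ x • g x)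

lemma L2.locallyIntegrable (f : L2) : LocallyIntegrable f volume :=
  (Lp.memLp f).locallyIntegrable (by norm_num)

lemma integrable_test_smul {φ : ℝ → ℝ} (hφ : Continuous φ) (hc : HasCompactSupport φ) (f : L2) :
    Integrable (fun x => φ x • f x) :=
  (L2.locallyIntegrable f).integrable_smul_left_of_hasCompactSupport hφ hc

/-- The Sobolev space `H¹(ℝ) = {ψ ∈ L² : ψ' ∈ L²}`, with `ψ'` the distributional derivative.
An element is recorded as the pair `(ψ, ψ')`; the second component is determined by the first.
The topology is the one of `L² × L²`, that is, the usual topology of `H¹`. -/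
def H1 : Submodule ℂ (L2 × L2) where
  carrier := {p | HasWeakDeriv p.1 p.2}
  add_mem' := by
    intro p q hp hq φ hφ hc
    have hφ' : Continuous (deriv φ) := hφ.continuous_deriv (by simp)
    have h1 : ∫ x, deriv φ x • ((p + q).1 : L2) x
        = ∫ x, (deriv φ x • p.1 x + deriv φ x • q.1 x) := by
      refine integral_congr_ae ?_
      filter_upwards [Lp.coeFn_add p.1 q.1] with x hx
      rw [Prod.fst_add, hx, Pi.add_apply, smul_add]
    have h2 : ∫ x, φ x • ((p + q).2 : L2) x = ∫ x, (φ x • p.2 x + φ x • q.2 x) := by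
      refine integral_congr_ae ?_
      filter_upwards [Lp.coeFn_add p.2 q.2] with x hx
      rw [Prod.snd_add, hx, Pi.add_apply, smul_add]
    rw [h1, h2, integral_add (integrable_test_smul hφ' hc.deriv _)
      (integrable_test_smul hφ' hc.deriv _), integral_add
      (integrable_test_smul hφ.continuous hc _) (integrable_test_smul hφ.continuous hc _),
      hp φ hφ hc, hq φ hφ hc, neg_add]
  zero_mem' := by
    intro φ hφ hc
    have h1 : ∫ x, deriv φ x • ((0 : L2 × L2).1 : L2) x = ∫ _x : ℝ, (0 : ℂ) := by
      refine integral_congr_ae ?_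
      filter_upwards [Lp.coeFn_zero ℂ 2 (volume : Measure ℝ)] with x hx
      rw [Prod.fst_zero, hx, Pi.zero_apply, smul_zero]
    have h2 : ∫ x, φ x • ((0 : L2 × L2).2 : L2) x = ∫ _x : ℝ, (0 : ℂ) := by
      refine integral_congr_ae ?_
      filter_upwards [Lp.coeFn_zero ℂ 2 (volume : Measure ℝ)] with x hx
      rw [Prod.snd_zero, hx, Pi.zero_apply, smul_zero]
    rw [h1, h2]; simp
  smul_mem' := by
    intro c p hp φ hφ hc
    have h1 : ∫ x, deriv φ x • ((c • p).1 : L2) x = ∫ x, c • (deriv φ x • p.1 x) := by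
      refine integral_congr_ae ?_
      filter_upwards [Lp.coeFn_smul c p.1] with x hx
      rw [Prod.smul_fst, hx, Pi.smul_apply, smul_comm]
    have h2 : ∫ x, φ x • ((c • p).2 : L2) x = ∫ x, c • (φ x • p.2 x) := by
      refine integral_congr_ae ?_
      filter_upwards [Lp.coeFn_smul c p.2] with x hx
      rw [Prod.smul_snd, hx, Pi.smul_apply, smul_comm]
    rw [h1, h2, integral_smul, integral_smul, hp φ hφ hc, smul_neg]

/-! ### Continuous representatives of Sobolev functions -/

lemma integral_eq_interval_of_support {h : ℝ → ℝ} {R : ℝ} (hR : 0 < R)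
    (hs : ∀ x, R ≤ |x| → h x = 0) : ∫ x, h x = ∫ x in (-R)..R, h x := by
  rw [intervalIntegral.integral_of_le (by linarith), setIntegral_eq_integral_of_forall_compl_eq_zero]
  intro x hx
  refine hs x ?_
  by_contra hlt
  rw [not_le, abs_lt] at hlt
  exact hx ⟨hlt.1, hlt.2.le⟩

lemma exists_radius {φ : ℝ → ℝ} (hc : HasCompactSupport φ) :
    ∃ R, 0 < R ∧ ∀ x, R ≤ |x| → x ∉ tsupport φ := by
  obtain ⟨R, hR⟩ := (Metric.isBounded_iff_subset_closedBall (0 : ℝ)).1 hc.isCompact.isBounded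
  refine ⟨|R| + 1, by positivity, fun x hx hmem => ?_⟩
  have := hR hmem
  rw [Metric.mem_closedBall, dist_zero_right, Real.norm_eq_abs] at this
  linarith [le_abs_self R]

/-- Integration by parts of a primitive against a test function. -/
lemma integral_deriv_mul_primitive {g : ℝ → ℝ} (hg : LocallyIntegrable g volume) {φ : ℝ → ℝ}
    (hφ : ContDiff ℝ ∞ φ) (hc : HasCompactSupport φ) :
    ∫ x, deriv φ x * (∫ y in (0 : ℝ)..x, g y) = -∫ x, φ x * g x := by
  obtain ⟨R, hR, hsupp⟩ := exists_radius hc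
  have h0 : ∀ x, R ≤ |x| → φ x = 0 := fun x hx => image_eq_zero_of_notMem_tsupport (hsupp x hx)
  have h0' : ∀ x, R ≤ |x| → deriv φ x = 0 := fun x hx => by
    by_contra hne
    exact hsupp x hx (support_deriv_subset hne)
  have hgi : IntervalIntegrable g volume (-R) R := (hg.integrableOn_isCompact isCompact_uIcc).intervalIntegrable
  have hG : AbsolutelyContinuousOnInterval (fun x => ∫ y in (0 : ℝ)..x, g y) (-R) R :=
    hgi.absolutelyContinuousOnInterval_intervalIntegral
      (by rw [uIcc_of_le (by linarith)]; constructor <;> linarith)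
  have hΦ : AbsolutelyContinuousOnInterval φ (-R) R :=
    ((hφ.of_le (by exact_mod_cast le_top)).contDiffOn).absolutelyContinuousOnInterval
  rw [integral_eq_interval_of_support hR (fun x hx => by rw [h0' x hx, zero_mul]),
    integral_eq_interval_of_support hR (fun x hx => by rw [h0 x hx, zero_mul])]
  have key := AbsolutelyContinuousOnInterval.integral_mul_deriv_eq_deriv_mul hΦ hG
  rw [h0 R (le_abs_self R), h0 (-R) (by rw [abs_neg]; exact le_abs_self R), zero_mul, zero_mul,
    sub_zero, zero_sub] at key
  have hae : ∫ x in (-R)..R, φ x * deriv (fun x => ∫ y in (0 : ℝ)..x, g y) x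
      = ∫ x in (-R)..R, φ x * g x := by
    refine intervalIntegral.integral_congr_ae ?_
    filter_upwards [LocallyIntegrable.ae_hasDerivAt_integral hg] with x hx _
    rw [(hx 0).deriv]
  rw [← hae, key, neg_neg]

/-- A test function of zero mean is the derivative of a test function. -/
lemma exists_primitive {χ : ℝ → ℝ} (hχ : ContDiff ℝ ∞ χ) (hc : HasCompactSupport χ)
    (hint : ∫ x, χ x = 0) :
    ∃ Φ : ℝ → ℝ, ContDiff ℝ ∞ Φ ∧ HasCompactSupport Φ ∧ deriv Φ = χ := by
  obtain ⟨R, hR, hsupp⟩ := exists_radius hc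
  have h0 : ∀ x, R ≤ |x| → χ x = 0 := fun x hx => image_eq_zero_of_notMem_tsupport (hsupp x hx)
  have hd : ∀ x, HasDerivAt (fun x => ∫ y in (-R)..x, χ y) (χ x) x := fun x =>
    intervalIntegral.integral_hasDerivAt_right (hχ.continuous.intervalIntegrable _ _)
      (hχ.continuous.stronglyMeasurableAtFilter _ _) hχ.continuous.continuousAt
  have hderiv : deriv (fun x => ∫ y in (-R)..x, χ y) = χ := funext fun x => (hd x).deriv
  refine ⟨fun x => ∫ y in (-R)..x, χ y, ?_, ?_, hderiv⟩
  · rw [contDiff_infty_iff_deriv]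
    exact ⟨fun x => (hd x).differentiableAt, by rwa [hderiv]⟩
  · refine HasCompactSupport.intro (isCompact_Icc (a := -R) (b := R)) fun x hx => ?_
    have hout : R < |x| := by
      by_contra hle
      exact hx (abs_le.1 (not_lt.1 hle))
    rcases lt_abs.1 hout with h | h
    · have h1 := intervalIntegral.integral_add_adjacent_intervals
        (hχ.continuous.intervalIntegrable (μ := volume) (-R) R)
        (hχ.continuous.intervalIntegrable R x)
      have h2 : ∫ y in R..x, χ y = 0 := by
        rw [← intervalIntegral.integral_zero (a := R) (b := x) (μ := volume)]
        refine intervalIntegral.integral_congr fun y hy => ?_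
        rw [uIcc_of_le h.le] at hy
        exact h0 y (hy.1.trans (le_abs_self y))
      rw [← integral_eq_interval_of_support hR h0, hint, h2, add_zero] at h1
      exact h1.symm
    · rw [← intervalIntegral.integral_zero (a := -R) (b := x) (μ := volume)]
      refine intervalIntegral.integral_congr fun y hy => ?_
      rw [uIcc_of_ge (by linarith)] at hy
      exact h0 y (le_trans (by linarith [hy.2]) (neg_le_abs y))

lemma exists_continuous_ae_eq_real {f g : ℝ → ℝ} (hf : LocallyIntegrable f volume)
    (hg : LocallyIntegrable g volume)
    (h : ∀ φ : ℝ → ℝ, ContDiff ℝ ∞ φ → HasCompactSupport φ →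
      ∫ x, deriv φ x * f x = -∫ x, φ x * g x) :
    ∃ k : ℝ → ℝ, Continuous k ∧ f =ᵐ[volume] k := by
  set G : ℝ → ℝ := fun x => ∫ y in (0 : ℝ)..x, g y with hGdef
  have hGc : Continuous G :=
    intervalIntegral.continuous_primitive (fun a b => (hg.integrableOn_isCompact isCompact_uIcc).intervalIntegrable) 0
  have hfG : LocallyIntegrable (fun x => f x - G x) volume := hf.sub hGc.locallyIntegrable
  have hi : ∀ {u φ : ℝ → ℝ}, LocallyIntegrable u volume → Continuous φ → HasCompactSupport φ →
      Integrable (fun x => φ x * u x) := fun hu hφ hc =>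
    hu.integrable_smul_left_of_hasCompactSupport hφ hc
  have hzero : ∀ φ : ℝ → ℝ, ContDiff ℝ ∞ φ → HasCompactSupport φ →
      ∫ x, deriv φ x * (f x - G x) = 0 := by
    intro φ hφ hc
    have hφ' : Continuous (deriv φ) := hφ.continuous_deriv (by simp)
    simp_rw [mul_sub]
    rw [integral_sub (hi hf hφ' hc.deriv) (hi hGc.locallyIntegrable hφ' hc.deriv),
      h φ hφ hc, integral_deriv_mul_primitive hg hφ hc, sub_self]
  let b : ContDiffBump (0 : ℝ) := ⟨1, 2, one_pos, one_lt_two⟩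
  set η : ℝ → ℝ := b.normed volume with hη
  have hηs : ContDiff ℝ ∞ η := b.contDiff_normed
  have hηc : HasCompactSupport η := b.hasCompactSupport_normed
  have hηi : ∫ x, η x = 1 := b.integral_normed
  set c : ℝ := ∫ x, η x * (f x - G x) with hcdef
  refine ⟨fun x => c + G x, by fun_prop, ?_⟩
  have hae : ∀ᵐ x ∂volume, f x - G x = c := by
    refine ae_eq_of_integral_contDiff_smul_eq hfG (locallyIntegrable_const c) fun φ hφ hc => ?_
    set a : ℝ := ∫ x, φ x with ha
    have hφi : Integrable φ := hφ.continuous.integrable_of_hasCompactSupport hc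
    have hηi' : Integrable η := hηs.continuous.integrable_of_hasCompactSupport hηc
    obtain ⟨Φ, hΦ, hΦc, hΦd⟩ := exists_primitive (χ := fun x => φ x - a * η x)
      (hφ.sub (contDiff_const.mul hηs)) (hc.sub (hηc.mul_left (f := fun _ => a)))
      (by rw [integral_sub hφi (hηi'.const_mul a), integral_const_mul, hηi, mul_one, sub_self])
    have hz := hzero Φ hΦ hΦc
    rw [hΦd] at hz
    have hsplit : ∀ x, (φ x - a * η x) * (f x - G x)
        = φ x * (f x - G x) - a * (η x * (f x - G x)) := fun x => by ring
    simp_rw [hsplit] at hz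
    rw [integral_sub (hi hfG hφ.continuous hc) ((hi hfG hηs.continuous hηc).const_mul a),
      integral_const_mul, sub_eq_zero] at hz
    simp only [smul_eq_mul]
    rw [hz, integral_mul_const]
  filter_upwards [hae] with x hx
  linarith

/-- Every element of `H¹(ℝ)` has a continuous representative. -/
lemma H1.exists_continuous_rep (ψ : H1) :
    ∃ k : ℝ → ℂ, Continuous k ∧ (ψ.1.1 : ℝ → ℂ) =ᵐ[volume] k := by
  have hf := L2.locallyIntegrable ψ.1.1
  have hg := L2.locallyIntegrable ψ.1.2
  have hw : HasWeakDeriv ψ.1.1 ψ.1.2 := ψ.2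
  have hcomp : ∀ L : ℂ →L[ℝ] ℝ, ∃ k : ℝ → ℝ, Continuous k ∧
      (fun x => L (ψ.1.1 x)) =ᵐ[volume] k := by
    intro L
    have hL : ∀ u : ℝ → ℂ, LocallyIntegrable u volume →
        LocallyIntegrable (fun x => L (u x)) volume := by
      intro u hu x
      obtain ⟨s, hs, hi⟩ := hu x
      exact ⟨s, hs, L.integrable_comp hi⟩
    refine exists_continuous_ae_eq_real (hL _ hf) (hL _ hg) fun φ hφ hc => ?_
    have h1 := congrArg L (hw φ hφ hc)
    rw [map_neg, ← L.integral_comp_comm (integrable_test_smul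
      (hφ.continuous_deriv (by simp)) hc.deriv _),
      ← L.integral_comp_comm (integrable_test_smul hφ.continuous hc _)] at h1
    simpa only [map_smul, smul_eq_mul] using h1
  obtain ⟨k₁, hk₁, he₁⟩ := hcomp Complex.reCLM
  obtain ⟨k₂, hk₂, he₂⟩ := hcomp Complex.imCLM
  refine ⟨fun x => (k₁ x : ℂ) + (k₂ x : ℂ) * Complex.I, by fun_prop, ?_⟩
  filter_upwards [he₁, he₂] with x h1 h2
  rw [← h1, ← h2]
  exact (Complex.re_add_im _).symm

/-- The value `ψ(x)` of a function of class `H¹(ℝ)`: the value of its continuous representative. -/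
def H1.eval (ψ : H1) (x : ℝ) : ℂ := (H1.exists_continuous_rep ψ).choose x

/-! ### The phase space -/

/-- The phase space of states `Ψ = (ψ, π)` of finite energy, `H¹(ℝ) ⊕ L²(ℝ)`. -/
abbrev Phase : Type := H1 × L2

/-- The field component `ψ ∈ L²`. -/
def Phase.psi (Ψ : Phase) : L2 := Ψ.1.1.1

/-- The derivative `ψ' ∈ L²` of the field component. -/
def Phase.dpsi (Ψ : Phase) : L2 := Ψ.1.1.2

/-- The momentum component `π ∈ L²`. -/
def Phase.mom (Ψ : Phase) : L2 := Ψ.2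

/-- The value `ψ(x)` of the field component. -/
def Phase.psiAt (Ψ : Phase) (x : ℝ) : ℂ := H1.eval Ψ.1 x

/-- The energy norm, `‖Ψ‖² = ‖π‖² + ‖ψ'‖² + m² ‖ψ‖²` with norms of `L²` on the right. -/
def energyNorm (m : ℝ) (Ψ : Phase) : ℝ :=
  √(‖Ψ.mom‖ ^ 2 + ‖Ψ.dpsi‖ ^ 2 + m ^ 2 * ‖Ψ.psi‖ ^ 2)

/-- The topology of `H¹ ⊕ L²` is the topology of the energy norm. -/
lemma tendsto_iff_energyNorm {m : ℝ} (hm : 0 < m) {ι : Type*} {l : Filter ι} {f : ι → Phase}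
    {Ψ : Phase} : Tendsto f l (𝓝 Ψ) ↔ Tendsto (fun i => energyNorm m (f i - Ψ)) l (𝓝 0) := by
  have hcont : Continuous (energyNorm m) := by
    unfold energyNorm Phase.mom Phase.dpsi Phase.psi
    fun_prop
  constructor
  · intro h
    have h1 : Tendsto (fun i => f i - Ψ) l (𝓝 0) := by simpa using h.sub_const Ψ
    have h2 := (hcont.tendsto 0).comp h1
    have h3 : energyNorm m 0 = 0 := by
      simp [energyNorm, Phase.mom, Phase.dpsi, Phase.psi]
    rwa [h3] at h2
  · intro h
    rw [tendsto_iff_norm_sub_tendsto_zero]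
    have hbd : ∀ Φ : Phase, ‖Φ‖ ≤ (1 + m⁻¹) * energyNorm m Φ := by
      intro Φ
      have hmi : 0 < m⁻¹ := inv_pos.2 hm
      have e0 : 0 ≤ energyNorm m Φ := Real.sqrt_nonneg _
      have e1 : ‖Φ.mom‖ ≤ energyNorm m Φ :=
        Real.le_sqrt_of_sq_le (by nlinarith [sq_nonneg ‖Φ.dpsi‖, sq_nonneg (m * ‖Φ.psi‖)])
      have e2 : ‖Φ.dpsi‖ ≤ energyNorm m Φ :=
        Real.le_sqrt_of_sq_le (by nlinarith [sq_nonneg ‖Φ.mom‖, sq_nonneg (m * ‖Φ.psi‖)])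
      have e3 : m * ‖Φ.psi‖ ≤ energyNorm m Φ :=
        Real.le_sqrt_of_sq_le (by nlinarith [sq_nonneg ‖Φ.mom‖, sq_nonneg ‖Φ.dpsi‖])
      have e3' : ‖Φ.psi‖ ≤ m⁻¹ * energyNorm m Φ := by
        rw [← div_eq_inv_mul, le_div_iff₀ hm]; linarith
      have e4 : 0 ≤ m⁻¹ * energyNorm m Φ := by positivity
      have hn : ‖Φ‖ = max (max ‖Φ.psi‖ ‖Φ.dpsi‖) ‖Φ.mom‖ := rfl
      rw [hn, add_mul, one_mul]
      exact max_le (max_le (by linarith) (by linarith)) (by linarith)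
    refine squeeze_zero (fun _ => norm_nonneg _) (fun i => hbd (f i - Ψ)) ?_
    simpa using h.const_mul (1 + m⁻¹)

/-! ### The Klein–Gordon field coupled to oscillators -/

/-- The Hamilton functional
`½ ∫ (|π|² + |ψ'|² + m² |ψ|²) dx + ∑_J U_J(ψ(X_J))`. -/
def hamiltonian {N : ℕ} (m : ℝ) (X : Fin N → ℝ) (U : Fin N → ℂ → ℝ) (Ψ : Phase) : ℝ :=
  1 / 2 * (∫ x, (‖Ψ.mom x‖ ^ 2 + ‖Ψ.dpsi x‖ ^ 2 + m ^ 2 * ‖Ψ.psi x‖ ^ 2))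
    + ∑ J, U J (Ψ.psiAt (X J))

/-- The charge functional `(i/2) ∫ (ψ̄ π - π̄ ψ) dx`. -/
def charge (Ψ : Phase) : ℂ :=
  Complex.I / 2 * ∫ x, (conj (Ψ.psi x) * Ψ.mom x - conj (Ψ.mom x) * Ψ.psi x)

/-- The partial derivative in `x` of a function of `(x, t)`. -/
def dx (φ : ℝ × ℝ → ℝ) (p : ℝ × ℝ) : ℝ := deriv (fun x => φ (x, p.2)) p.1

/-- The partial derivative in `t` of a function of `(x, t)`. -/
def dt (φ : ℝ × ℝ → ℝ) (p : ℝ × ℝ) : ℝ := deriv (fun t => φ (p.1, t)) p.2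

/-- The system
`ψ̇ = π`, `π̇ = ψ'' - m² ψ + ∑_J δ(x - X_J) F_J(ψ(X_J, t))`
holds in the sense of distributions on the plane of `(x, t)`, that is, when paired with
every test function `φ`. -/
def SolvesSystem {N : ℕ} (m : ℝ) (X : Fin N → ℝ) (F : Fin N → ℂ → ℂ) (Ψ : ℝ → Phase) : Prop :=
  ∀ φ : ℝ × ℝ → ℝ, ContDiff ℝ ∞ φ → HasCompactSupport φ →
    (-(∫ t, ∫ x, dt φ (x, t) • (Ψ t).psi x) = ∫ t, ∫ x, φ (x, t) • (Ψ t).mom x) ∧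
    (-(∫ t, ∫ x, dt φ (x, t) • (Ψ t).mom x) =
      (∫ t, ∫ x, (dx (dx φ) (x, t) - m ^ 2 * φ (x, t)) • (Ψ t).psi x)
        + ∑ J, ∫ t, φ (X J, t) • F J ((Ψ t).psiAt (X J)))

/-- `Ψ` is a solution of class `C(ℝ, H¹ ⊕ L²)` of the Cauchy problem with initial
state `Ψ₀`. -/
structure IsSolution {N : ℕ} (m : ℝ) (X : Fin N → ℝ) (F : Fin N → ℂ → ℂ) (Ψ₀ : Phase)
    (Ψ : ℝ → Phase) : Prop where
  continuous : Continuous Ψ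
  solves : SolvesSystem m X F Ψ
  initial : Ψ 0 = Ψ₀

end KGOsc

end

noncomputable section

namespace KGOsc

local notation "⟪" u ", " v "⟫" => inner ℂ u v

/-! ### Weak derivatives of continuous functions -/

/-! The linear part is diagonal in the characteristic variables `π ± ψ'`, each of which is carried
at unit speed. In the moving coordinate `y = x + εt`, with `ε = ±1`, such a variable changes only by
the force accumulated so far. A force `f` acting at `X` contributes `∫ f(r) δ_{X+εr} dr`, and this
is the `L²` function `y ↦ f(ε(y - X))` cut off to the time window (`inner_src`). Delta sources
therefore do not lead out of the energy space, and the problem has a Duhamel form inside `H¹ ⊕ L²`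
(`travel`, `IsMild`). The two formulations agree: `IsMildSol.solvesSystem` pairs mild solutions with
time slices of test functions, and `SolvesSystem.isMildSol` recovers Duhamel's formula from test
functions `η(x + εt)θ(t)`.

For globally Lipschitz forces vanishing at the origin, the Duhamel map contracts in the norm `sup
e^{-μ|t|}‖Ψ(t)‖`: the mass term gains `1/μ` and the point forces gain `1/√(2μ)` (`IsMild.norm_le`,
`exists_rate`). The same estimate, applied to the difference of two solutions, gives stability.

Energy conservation is the delicate point, because `π(·, t)` is only in `L²` and has no value at
`X_J`. The solution is averaged over `[t, t + δ]`. The energy of the average then has a derivative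
given by the commutator `avg(F(ψ(X_J))) - F(avg ψ(X_J))` times the difference quotient of the trace.
The commutator tends to zero uniformly on compact time intervals, while the difference quotient is
dominated by that of a fixed continuous function, because traces have locally bounded variation in
time (`exists_variation_bound`). Charge conservation is simpler: the equation for `π` may be tested
against `ψ(t) ∈ H¹`, and `conj z * F z` is real by rotation invariance.

The Sobolev inequality `|ψ(x)|² ≤ (‖ψ'‖² + m²‖ψ‖²)/(2m)` and `∑ B_J < m` make the energy coercive,
so an energy level bounds all traces by some `R`. The force is cut off at `R` to make it globally
Lipschitz. Along a solution of the cut-off problem, the times at which all traces at the `X_J` are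
below `R` form a set that is open, closed and nonempty (`norm_psiAt_lt_of_cutoff`). The cut-off is
therefore never felt, which gives global existence. Any solution of the original problem in the
energy level also solves the cut-off one, so uniqueness and continuous dependence follow from
Lipschitz stability. -/

lemma sub_eq_intervalIntegral_of_weakDeriv_real {k g : ℝ → ℝ} (hk : Continuous k)
    (hg : LocallyIntegrable g volume)
    (h : ∀ φ : ℝ → ℝ, ContDiff ℝ ∞ φ → HasCompactSupport φ →
      ∫ x, deriv φ x * k x = -∫ x, φ x * g x) (x y : ℝ) :
    k x - k y = ∫ s in y..x, g s := by
  have hgi : ∀ a b, IntervalIntegrable g volume a b := fun a b =>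
    (hg.integrableOn_isCompact isCompact_uIcc).intervalIntegrable
  set G : ℝ → ℝ := fun x => ∫ y in (0 : ℝ)..x, g y with hGdef
  have hGc : Continuous G := intervalIntegral.continuous_primitive hgi 0
  have hw : Continuous fun x => k x - G x := hk.sub hGc
  have hi : ∀ {u φ : ℝ → ℝ}, Continuous u → Continuous φ → HasCompactSupport φ →
      Integrable (fun x => φ x * u x) := fun hu hφ hc =>
    (hφ.mul hu).integrable_of_hasCompactSupport hc.mul_right
  -- `k - G` has zero weak derivative, so it remains to see that it is constant.
  have hzero : ∀ φ : ℝ → ℝ, ContDiff ℝ ∞ φ → HasCompactSupport φ →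
      ∫ x, deriv φ x * (k x - G x) = 0 := by
    intro φ hφ hc
    have hφ' : Continuous (deriv φ) := hφ.continuous_deriv (by simp)
    simp_rw [mul_sub]
    rw [integral_sub (hi hk hφ' hc.deriv) (hi hGc hφ' hc.deriv),
      h φ hφ hc, integral_deriv_mul_primitive hg hφ hc, sub_self]
  let b : ContDiffBump (0 : ℝ) := ⟨1, 2, one_pos, one_lt_two⟩
  set η : ℝ → ℝ := b.normed volume with hη
  have hηs : ContDiff ℝ ∞ η := b.contDiff_normed
  have hηc : HasCompactSupport η := b.hasCompactSupport_normed
  have hηi : ∫ x, η x = 1 := b.integral_normed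
  set c : ℝ := ∫ x, η x * (k x - G x) with hcdef
  have hae : ∀ᵐ x ∂volume, k x - G x = c := by
    refine ae_eq_of_integral_contDiff_smul_eq hw.locallyIntegrable (locallyIntegrable_const c)
      fun φ hφ hc => ?_
    set a : ℝ := ∫ x, φ x with ha
    have hφi : Integrable φ := hφ.continuous.integrable_of_hasCompactSupport hc
    have hηi' : Integrable η := hηs.continuous.integrable_of_hasCompactSupport hηc
    -- Subtracting the multiple of `η` with the same mean makes the test function a derivative,
    -- which `k - G` annihilates.
    obtain ⟨Φ, hΦ, hΦc, hΦd⟩ := exists_primitive (χ := fun x => φ x - a * η x)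
      (hφ.sub (contDiff_const.mul hηs)) (hc.sub (hηc.mul_left (f := fun _ => a)))
      (by rw [integral_sub hφi (hηi'.const_mul a), integral_const_mul, hηi, mul_one, sub_self])
    have hz := hzero Φ hΦ hΦc
    rw [hΦd] at hz
    have hsplit : ∀ x, (φ x - a * η x) * (k x - G x)
        = φ x * (k x - G x) - a * (η x * (k x - G x)) := fun x => by ring
    simp_rw [hsplit] at hz
    rw [integral_sub (hi hw hφ.continuous hc) ((hi hw hηs.continuous hηc).const_mul a),
      integral_const_mul, sub_eq_zero] at hz
    simp only [smul_eq_mul]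
    rw [hz, integral_mul_const]
  have heq : (fun x => k x - G x) = fun _ => c :=
    (hw.ae_eq_iff_eq volume continuous_const).1 hae
  have h1 := congrFun heq x
  have h2 := congrFun heq y
  have h3 := intervalIntegral.integral_interval_sub_left (hgi 0 x) (hgi 0 y)
  simp only [hGdef] at h1 h2
  linarith

lemma HasWeakDeriv.comp_clm {f g : ℝ → ℂ} (h : HasWeakDeriv f g)
    (hf : LocallyIntegrable f volume) (hg : LocallyIntegrable g volume) (L : ℂ →L[ℝ] ℝ)
    (φ : ℝ → ℝ) (hφ : ContDiff ℝ ∞ φ) (hc : HasCompactSupport φ) :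
    ∫ x, deriv φ x * L (f x) = -∫ x, φ x * L (g x) := by
  have h1 := congrArg L (h φ hφ hc)
  have i1 : Integrable fun x => deriv φ x • f x :=
    hf.integrable_smul_left_of_hasCompactSupport (hφ.continuous_deriv (by simp)) hc.deriv
  have i2 : Integrable fun x => φ x • g x :=
    hg.integrable_smul_left_of_hasCompactSupport hφ.continuous hc
  rw [map_neg, ← L.integral_comp_comm i1, ← L.integral_comp_comm i2] at h1
  simpa only [map_smul, smul_eq_mul] using h1

lemma _root_.ContinuousLinearMap.locallyIntegrable_comp' (L : ℂ →L[ℝ] ℝ) {u : ℝ → ℂ}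
    (hu : LocallyIntegrable u volume) : LocallyIntegrable (fun x => L (u x)) volume := by
  intro x
  obtain ⟨s, hs, hi⟩ := hu x
  exact ⟨s, hs, L.integrable_comp hi⟩

/-- A continuous function is a primitive of its weak derivative. -/
lemma HasWeakDeriv.sub_eq_intervalIntegral {k g : ℝ → ℂ} (h : HasWeakDeriv k g)
    (hk : Continuous k) (hg : LocallyIntegrable g volume) (x y : ℝ) :
    k x - k y = ∫ s in y..x, g s := by
  have hgi : IntervalIntegrable g volume y x :=
    (hg.integrableOn_isCompact isCompact_uIcc).intervalIntegrable
  have key : ∀ L : ℂ →L[ℝ] ℝ, L (k x - k y) = L (∫ s in y..x, g s) := fun L => by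
    rw [← L.intervalIntegral_comp_comm hgi, map_sub]
    exact sub_eq_intervalIntegral_of_weakDeriv_real (L.continuous.comp hk)
      (L.locallyIntegrable_comp' hg)
      (h.comp_clm hk.locallyIntegrable hg L) x y
  exact Complex.ext (key Complex.reCLM) (key Complex.imCLM)

/-! ### Square integrable functions -/

lemma L2.integrable_norm_sq (w : L2) : Integrable fun x => ‖w x‖ ^ 2 :=
  (Lp.memLp w).integrable_norm_pow (by norm_num)

lemma L2.integral_norm_sq (w : L2) : ∫ x, ‖w x‖ ^ 2 = ‖w‖ ^ 2 := by
  have h : ⟪w, w⟫ = ((∫ x, ‖w x‖ ^ 2 : ℝ) : ℂ) := by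
    rw [L2.inner_def, ← integral_complex_ofReal]
    refine integral_congr_ae (Eventually.of_forall fun x => ?_)
    simp only [inner_self_eq_norm_sq_to_K]
    norm_cast
  rw [inner_self_eq_norm_sq_to_K] at h
  exact (Complex.ofReal_injective (by simpa using h)).symm

/-- Two square integrable functions are equal when they agree against all test functions. -/
lemma L2.ext_of_test {u v : L2} (h : ∀ φ : ℝ → ℝ, ContDiff ℝ ∞ φ → HasCompactSupport φ →
    ∫ x, φ x • u x = ∫ x, φ x • v x) : u = v :=
  Lp.ext (ae_eq_of_integral_contDiff_smul_eq (L2.locallyIntegrable u) (L2.locallyIntegrable v) h)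

/-! ### Pointwise values of Sobolev functions -/

lemma H1.continuous_eval (ψ : H1) : Continuous (H1.eval ψ) :=
  (H1.exists_continuous_rep ψ).choose_spec.1

lemma H1.ae_eq_eval (ψ : H1) : (ψ.1.1 : ℝ → ℂ) =ᵐ[volume] H1.eval ψ :=
  (H1.exists_continuous_rep ψ).choose_spec.2

lemma H1.eval_eq {ψ : H1} {k : ℝ → ℂ} (hk : Continuous k) (h : (ψ.1.1 : ℝ → ℂ) =ᵐ[volume] k) :
    H1.eval ψ = k :=
  ((H1.continuous_eval ψ).ae_eq_iff_eq volume hk).1 ((H1.ae_eq_eval ψ).symm.trans h)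

lemma H1.eval_add (ψ χ : H1) (x : ℝ) : H1.eval (ψ + χ) x = H1.eval ψ x + H1.eval χ x := by
  refine congrFun (H1.eval_eq (k := fun x => H1.eval ψ x + H1.eval χ x)
    ((H1.continuous_eval ψ).add (H1.continuous_eval χ)) ?_) x
  filter_upwards [Lp.coeFn_add ψ.1.1 χ.1.1, (H1.ae_eq_eval ψ), (H1.ae_eq_eval χ)] with y h1 h2 h3
  rw [← h2, ← h3]
  exact h1

lemma H1.eval_smul (c : ℂ) (ψ : H1) (x : ℝ) : H1.eval (c • ψ) x = c * H1.eval ψ x := by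
  refine congrFun (H1.eval_eq (k := fun x => c * H1.eval ψ x)
    ((H1.continuous_eval ψ).const_mul c) ?_) x
  filter_upwards [Lp.coeFn_smul c ψ.1.1, (H1.ae_eq_eval ψ)] with y h1 h2
  rw [← h2]
  exact h1

lemma H1.intervalIntegrable_deriv (ψ : H1) (a b : ℝ) :
    IntervalIntegrable (ψ.1.2 : ℝ → ℂ) volume a b :=
  ((L2.locallyIntegrable ψ.1.2).integrableOn_isCompact isCompact_uIcc).intervalIntegrable

lemma H1.eval_sub_eval (ψ : H1) (x y : ℝ) :
    H1.eval ψ x - H1.eval ψ y = ∫ s in y..x, ψ.1.2 s := by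
  refine HasWeakDeriv.sub_eq_intervalIntegral (fun φ hφ hc => ?_) (H1.continuous_eval ψ)
    (L2.locallyIntegrable ψ.1.2) x y
  rw [← (ψ.2 : HasWeakDeriv ψ.1.1 ψ.1.2) φ hφ hc]
  refine integral_congr_ae ?_
  filter_upwards [(H1.ae_eq_eval ψ)] with y h1
  rw [h1]

/-- Integration by parts of the absolutely continuous `u` against itself, with `u' = g` almost
everywhere. -/
lemma sq_sub_sq_le_of_primitive {u g : ℝ → ℝ} (hg : LocallyIntegrable g volume)
    (h : ∀ x y, u x - u y = ∫ s in y..x, g s) (a b : ℝ) :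
    u b ^ 2 - u a ^ 2 = ∫ s in a..b, 2 * (u s * g s) := by
  have hgi : ∀ a b, IntervalIntegrable g volume a b := fun a b =>
    (hg.integrableOn_isCompact isCompact_uIcc).intervalIntegrable
  have hu : u = fun x => (∫ s in a..x, g s) + u a := by
    ext x; rw [← h]; ring
  have hG : AbsolutelyContinuousOnInterval (fun x => ∫ y in a..x, g y) a b :=
    (hgi a b).absolutelyContinuousOnInterval_intervalIntegral left_mem_uIcc
  have hAC : AbsolutelyContinuousOnInterval u a b := by
    rw [hu]
    exact hG.fun_add (ContDiffOn.absolutelyContinuousOnInterval contDiffOn_const)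
  have hd : ∀ᵐ x ∂volume, deriv u x = g x := by
    filter_upwards [LocallyIntegrable.ae_hasDerivAt_integral hg] with x hx
    rw [hu]
    exact ((hx a).add_const (u a)).deriv
  have key := AbsolutelyContinuousOnInterval.integral_mul_deriv_eq_deriv_mul hAC hAC
  have e1 : ∫ x in a..b, u x * deriv u x = ∫ x in a..b, u x * g x := by
    refine intervalIntegral.integral_congr_ae ?_
    filter_upwards [hd] with x hx _
    rw [hx]
  have e2 : ∫ x in a..b, deriv u x * u x = ∫ x in a..b, u x * g x := by
    refine intervalIntegral.integral_congr_ae ?_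
    filter_upwards [hd] with x hx _
    rw [hx, mul_comm]
  rw [e1, e2] at key
  rw [intervalIntegral.integral_const_mul]
  linarith

lemma H1.eval_sq_sub (ψ : H1) (a b : ℝ) :
    ‖H1.eval ψ b‖ ^ 2 - ‖H1.eval ψ a‖ ^ 2
      = ∫ s in a..b, 2 * (conj (H1.eval ψ s) * ψ.1.2 s).re := by
  have key : ∀ L : ℂ →L[ℝ] ℝ, L (H1.eval ψ b) ^ 2 - L (H1.eval ψ a) ^ 2
      = ∫ s in a..b, 2 * (L (H1.eval ψ s) * L (ψ.1.2 s)) := fun L =>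
    sq_sub_sq_le_of_primitive (u := fun x => L (H1.eval ψ x)) (L.locallyIntegrable_comp' (L2.locallyIntegrable ψ.1.2))
      (fun x y => by
        rw [← map_sub L, H1.eval_sub_eval, L.intervalIntegral_comp_comm
          ((H1.intervalIntegrable_deriv ψ) y x)]) a b
  have hint : ∀ L : ℂ →L[ℝ] ℝ, IntervalIntegrable
      (fun s => 2 * (L (H1.eval ψ s) * L (ψ.1.2 s))) volume a b := fun L => by
    refine IntervalIntegrable.const_mul ?_ 2
    have := (L.locallyIntegrable_comp' (L2.locallyIntegrable ψ.1.2)).integrableOn_isCompact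
      (isCompact_uIcc (a := a) (b := b))
    exact this.intervalIntegrable.continuousOn_mul
      ((L.continuous.comp (H1.continuous_eval ψ)).continuousOn)
  have h1 := key Complex.reCLM
  have h2 := key Complex.imCLM
  have hsum := intervalIntegral.integral_add (hint Complex.reCLM) (hint Complex.imCLM)
  rw [← h1, ← h2] at hsum
  simp only [Complex.sq_norm, Complex.normSq_apply]
  simp only [Complex.reCLM_apply, Complex.imCLM_apply] at hsum
  rw [show (∫ s in a..b, 2 * (conj (H1.eval ψ s) * ψ.1.2 s).re) = ∫ s in a..b,
    (2 * ((H1.eval ψ s).re * (ψ.1.2 s).re) + 2 * ((H1.eval ψ s).im * (ψ.1.2 s).im)) from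
      intervalIntegral.integral_congr fun s _ => by
        simp [Complex.mul_re]; ring, hsum]
  ring

/-- The sharp Sobolev inequality on the line. -/
lemma H1.norm_eval_sq_le {m : ℝ} (hm : 0 < m) (ψ : H1) (x : ℝ) :
    ‖H1.eval ψ x‖ ^ 2 ≤ (‖ψ.1.2‖ ^ 2 + m ^ 2 * ‖ψ.1.1‖ ^ 2) / (2 * m) := by
  set e : ℝ → ℝ := fun s => ‖ψ.1.2 s‖ ^ 2 + m ^ 2 * ‖ψ.1.1 s‖ ^ 2 with he
  have hei : Integrable e :=
    (L2.integrable_norm_sq ψ.1.2).add ((L2.integrable_norm_sq ψ.1.1).const_mul _)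
  have heI : ∫ s, e s = ‖ψ.1.2‖ ^ 2 + m ^ 2 * ‖ψ.1.1‖ ^ 2 := by
    rw [he, integral_add (L2.integrable_norm_sq ψ.1.2)
      ((L2.integrable_norm_sq ψ.1.1).const_mul _), integral_const_mul,
      L2.integral_norm_sq, L2.integral_norm_sq]
  have he0 : ∀ s, 0 ≤ e s := fun s => by positivity
  -- Young's inequality `2|ψ||ψ'| ≤ m⁻¹(|ψ'|² + m²|ψ|²)` under the integral.
  have hdiff : ∀ a b, a ≤ b → |‖H1.eval ψ b‖ ^ 2 - ‖H1.eval ψ a‖ ^ 2| ≤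
      m⁻¹ * ∫ s in a..b, e s := by
    intro a b hab
    rw [H1.eval_sq_sub, ← intervalIntegral.integral_const_mul, ← Real.norm_eq_abs]
    refine intervalIntegral.norm_integral_le_of_norm_le hab ?_
      (hei.intervalIntegrable.const_mul _)
    filter_upwards [(H1.ae_eq_eval ψ)] with s hs _
    rw [Real.norm_eq_abs, abs_mul, abs_two, ← hs]
    have h1 : |(conj (ψ.1.1 s) * ψ.1.2 s).re| ≤ ‖ψ.1.1 s‖ * ‖ψ.1.2 s‖ := by
      refine (Complex.abs_re_le_norm _).trans ?_
      rw [norm_mul, RCLike.norm_conj]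
    rw [← div_eq_inv_mul, le_div_iff₀ hm]
    simp only [he]
    nlinarith [sq_nonneg (‖ψ.1.2 s‖ - m * ‖ψ.1.1 s‖)]
  -- An integrable function cannot stay above `δ` on a set of infinite measure. This replaces decay
  -- at infinity.
  have hsmall : ∀ δ : ℝ, 0 < δ → ∀ S : Set ℝ, volume S = ⊤ → ∃ y ∈ S,
      ‖H1.eval ψ y‖ ^ 2 < δ := by
    intro δ hδ S hS
    by_contra! hcon
    have hint : Integrable fun s => ‖H1.eval ψ s‖ ^ 2 := by
      refine (L2.integrable_norm_sq ψ.1.1).congr ?_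
      filter_upwards [(H1.ae_eq_eval ψ)] with s hs
      rw [hs]
    have := hint.measure_ge_lt_top hδ
    rw [lt_top_iff_ne_top] at this
    exact this (measure_mono_top (fun y hy => hcon y hy) hS)
  -- `|ψ(x)|²` is bounded from the right half-line and from the left one; averaging the two bounds
  -- produces the `2` in the sharp constant.
  refine le_of_forall_pos_le_add fun δ hδ => ?_
  obtain ⟨b, hb, hb'⟩ := hsmall δ hδ (Ici x) Real.volume_Ici
  obtain ⟨a, ha, ha'⟩ := hsmall δ hδ (Iic x) Real.volume_Iic
  have h1 := (abs_le.1 (hdiff x b hb)).1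
  have h2 := (abs_le.1 (hdiff a x ha)).2
  have h3 := intervalIntegral.integral_add_adjacent_intervals
    (hei.intervalIntegrable (a := a) (b := x)) (hei.intervalIntegrable (a := x) (b := b))
  have h4 : ∫ s in a..b, e s ≤ ∫ s, e s := by
    rw [intervalIntegral.integral_of_le (le_trans ha hb)]
    exact setIntegral_le_integral hei (Eventually.of_forall he0)
  rw [heI] at h4
  have h5 : m⁻¹ * ∫ s in a..b, e s ≤ m⁻¹ * (‖ψ.1.2‖ ^ 2 + m ^ 2 * ‖ψ.1.1‖ ^ 2) :=
    mul_le_mul_of_nonneg_left h4 (inv_pos.2 hm).le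
  rw [← h3, mul_add] at h5
  have h6 : (‖ψ.1.2‖ ^ 2 + m ^ 2 * ‖ψ.1.1‖ ^ 2) / (2 * m)
      = m⁻¹ * (‖ψ.1.2‖ ^ 2 + m ^ 2 * ‖ψ.1.1‖ ^ 2) / 2 := by field_simp
  rw [h6]
  linarith

/-- At `m = 1` the sharp constant is `1/2`, which exactly compensates the sum of two squares against
the maximum norm of the pair. -/
lemma H1.norm_eval_le (ψ : H1) (x : ℝ) : ‖H1.eval ψ x‖ ≤ ‖ψ‖ := by
  have h := H1.norm_eval_sq_le one_pos ψ x
  have h1 : ‖ψ.1.1‖ ≤ ‖ψ‖ := le_max_left _ _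
  have h2 : ‖ψ.1.2‖ ≤ ‖ψ‖ := le_max_right _ _
  refine abs_le_of_sq_le_sq' (h.trans ?_) (norm_nonneg _) |>.2
  nlinarith [norm_nonneg ψ.1.1, norm_nonneg ψ.1.2]

/-- Evaluation at a point as a bounded functional on `H¹`. -/
def H1.evalL (x : ℝ) : H1 →L[ℂ] ℂ :=
  LinearMap.mkContinuous
    { toFun := fun ψ => H1.eval ψ x
      map_add' := fun ψ χ => H1.eval_add ψ χ x
      map_smul' := fun c ψ => H1.eval_smul c ψ x } 1
    (fun ψ => by rw [one_mul]; exact H1.norm_eval_le ψ x)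

end KGOsc

end

open scoped Convolution

noncomputable section

namespace KGOsc

local notation "⟪" u ", " v "⟫" => inner ℂ u v

/-! ### Test functions as elements of `L²` and `H¹` -/

lemma memLp_test {φ : ℝ → ℝ} (hφ : Continuous φ) (hc : HasCompactSupport φ) :
    MemLp (fun x => (φ x : ℂ)) 2 (volume : Measure ℝ) :=
  (Complex.continuous_ofReal.comp hφ).memLp_of_hasCompactSupport
    (hc.comp_left (g := fun r : ℝ => (r : ℂ)) Complex.ofReal_zero)

/-- A real test function as an element of `L²`. -/
def testL2 {φ : ℝ → ℝ} (hφ : Continuous φ) (hc : HasCompactSupport φ) : L2 :=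
  (memLp_test hφ hc).toLp _

lemma testL2_ae {φ : ℝ → ℝ} (hφ : Continuous φ) (hc : HasCompactSupport φ) :
    (testL2 hφ hc : ℝ → ℂ) =ᵐ[volume] fun x => (φ x : ℂ) :=
  (memLp_test hφ hc).coeFn_toLp

lemma inner_testL2 {φ : ℝ → ℝ} (hφ : Continuous φ) (hc : HasCompactSupport φ) (w : L2) :
    ⟪testL2 hφ hc, w⟫ = ∫ x, φ x • w x := by
  rw [L2.inner_def]
  refine integral_congr_ae ?_
  filter_upwards [testL2_ae hφ hc] with x hx
  simp [hx, mul_comm]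

lemma continuous_deriv_test {φ : ℝ → ℝ} (hφ : ContDiff ℝ ∞ φ) : Continuous (deriv φ) :=
  hφ.continuous_deriv (by simp)

lemma contDiff_deriv_test {φ : ℝ → ℝ} (hφ : ContDiff ℝ ∞ φ) : ContDiff ℝ ∞ (deriv φ) :=
  (contDiff_infty_iff_deriv.1 hφ).2

/-- A real test function as an element of `H¹`. -/
def H1.ofTest {φ : ℝ → ℝ} (hφ : ContDiff ℝ ∞ φ) (hc : HasCompactSupport φ) : H1 :=
  ⟨(testL2 hφ.continuous hc, testL2 (continuous_deriv_test hφ) hc.deriv), by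
    intro χ hχ hχc
    have h1 : ∫ x, deriv χ x • (testL2 hφ.continuous hc : ℝ → ℂ) x
        = ((∫ x, deriv χ x * φ x : ℝ) : ℂ) := by
      rw [← integral_complex_ofReal]
      refine integral_congr_ae ?_
      filter_upwards [testL2_ae hφ.continuous hc] with x hx
      rw [hx]; simp
    have h2 : ∫ x, χ x • (testL2 (continuous_deriv_test hφ) hc.deriv : ℝ → ℂ) x
        = ((∫ x, χ x * deriv φ x : ℝ) : ℂ) := by
      rw [← integral_complex_ofReal]
      refine integral_congr_ae ?_
      filter_upwards [testL2_ae (continuous_deriv_test hφ) hc.deriv] with x hx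
      rw [hx]; simp
    have hi : ∀ {a b : ℝ → ℝ}, Continuous a → Continuous b → HasCompactSupport b →
        Integrable (fun x => a x * b x) := fun ha hb hc =>
      (ha.mul hb).integrable_of_hasCompactSupport hc.mul_left
    have h3 := integral_mul_deriv_eq_deriv_mul_of_integrable
      (u := χ) (v := φ) (u' := deriv χ) (v' := deriv φ)
      (fun x _ => (hχ.differentiable (by simp) x).hasDerivAt)
      (fun x _ => (hφ.differentiable (by simp) x).hasDerivAt)
      (hi hχ.continuous (continuous_deriv_test hφ) hc.deriv)
      (hi (continuous_deriv_test hχ) hφ.continuous hc)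
      (hi hχ.continuous hφ.continuous hc)
    rw [h1, h2, h3]
    simp⟩

lemma H1.eval_ofTest {φ : ℝ → ℝ} (hφ : ContDiff ℝ ∞ φ) (hc : HasCompactSupport φ) (x : ℝ) :
    H1.eval (H1.ofTest hφ hc) x = φ x :=
  congrFun (H1.eval_eq (Complex.continuous_ofReal.comp hφ.continuous)
    (testL2_ae hφ.continuous hc)) x

/-- Expresses the weak derivative by inner products, so that it becomes a family of closed
conditions on the pair and can be differentiated in time. -/
lemma hasWeakDeriv_iff {u v : L2} : HasWeakDeriv u v ↔
    ∀ (φ : ℝ → ℝ) (hφ : ContDiff ℝ ∞ φ) (hc : HasCompactSupport φ),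
      ⟪(H1.ofTest hφ hc).1.2, u⟫ = -⟪(H1.ofTest hφ hc).1.1, v⟫ := by
  refine forall_congr' fun φ => forall_congr' fun hφ => forall_congr' fun hc => ?_
  simp only [H1.ofTest]
  rw [inner_testL2, inner_testL2]

lemma L2.ext_of_ofTest {u v : L2} (h : ∀ (φ : ℝ → ℝ) (hφ : ContDiff ℝ ∞ φ)
    (hc : HasCompactSupport φ), ⟪(H1.ofTest hφ hc).1.1, u⟫ = ⟪(H1.ofTest hφ hc).1.1, v⟫) :
    u = v := by
  refine L2.ext_of_test fun φ hφ hc => ?_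
  have := h φ hφ hc
  simp only [H1.ofTest] at this
  rwa [inner_testL2, inner_testL2] at this

/-- Needed for completeness: the contraction argument runs over continuous curves in `H¹ ⊕ L²`. -/
lemma H1.isClosed : IsClosed (H1 : Set (L2 × L2)) := by
  have : (H1 : Set (L2 × L2)) = ⋂ (φ : ℝ → ℝ) (hφ : ContDiff ℝ ∞ φ) (hc : HasCompactSupport φ),
      {p : L2 × L2 | ⟪(H1.ofTest hφ hc).1.2, p.1⟫ = -⟪(H1.ofTest hφ hc).1.1, p.2⟫} := by
    ext p
    simp only [mem_iInter, mem_ofPred_eq]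
    exact hasWeakDeriv_iff
  rw [this]
  refine isClosed_iInter fun φ => isClosed_iInter fun hφ => isClosed_iInter fun hc =>
    isClosed_eq ?_ ?_
  · exact continuous_const.inner continuous_fst
  · exact (continuous_const.inner continuous_snd).neg

instance : CompleteSpace H1 := H1.isClosed.completeSpace_coe

/-! ### Translations -/

/-- The translation `w ↦ w(· + c)` of `L²`. -/
def tau (c : ℝ) : L2 →ₗᵢ[ℂ] L2 :=
  Lp.compMeasurePreservingₗᵢ ℂ (fun x => x + c) (measurePreserving_add_right volume c)

lemma tau_ae (c : ℝ) (w : L2) : (tau c w : ℝ → ℂ) =ᵐ[volume] fun x => w (x + c) :=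
  Lp.coeFn_compMeasurePreserving w (measurePreserving_add_right volume c)

lemma ae_comp_add {p : ℝ → Prop} (h : ∀ᵐ x ∂(volume : Measure ℝ), p x) (c : ℝ) :
    ∀ᵐ x ∂(volume : Measure ℝ), p (x + c) :=
  (measurePreserving_add_right volume c).quasiMeasurePreserving.ae h

lemma tau_tau (a b : ℝ) (w : L2) : tau a (tau b w) = tau (a + b) w := by
  refine Lp.ext ?_
  filter_upwards [tau_ae a (tau b w), tau_ae (a + b) w, ae_comp_add (tau_ae b w) a]
    with x h1 h2 h3
  rw [h1, h2, h3, add_assoc]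

lemma tau_zero (w : L2) : tau 0 w = w := by
  refine Lp.ext ?_
  filter_upwards [tau_ae 0 w] with x h1
  rw [h1, add_zero]

/-- Strong continuity of translations, jointly in the shift and the function; continuity in operator
norm fails. -/
lemma continuous_tau {α : Type*} [TopologicalSpace α] {c : α → ℝ} {w : α → L2}
    (hc : Continuous c) (hw : Continuous w) : Continuous fun a => tau (c a) (w a) := by
  let T : ℝ → C(ℝ, ℝ) := fun c => ⟨fun x => x + c, by fun_prop⟩
  have hT : Continuous T :=
    ContinuousMap.continuous_of_continuous_uncurry _ (by
      change Continuous fun p : ℝ × ℝ => p.2 + p.1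
      fun_prop)
  have hm : ∀ a, MeasurePreserving (T (c a)) volume volume := fun a =>
    measurePreserving_add_right volume (c a)
  exact hw.compMeasurePreservingLp (hT.comp hc) hm (by norm_num)

lemma inner_tau_left (c : ℝ) (u v : L2) : ⟪tau c u, v⟫ = ⟪u, tau (-c) v⟫ := by
  conv_lhs => rw [← tau_zero v, ← add_neg_cancel c, ← tau_tau]
  exact (tau c).inner_map_map u _

lemma integral_smul_tau (c : ℝ) (φ : ℝ → ℝ) (w : L2) :
    ∫ x, φ x • tau c w x = ∫ x, φ (x - c) • w x := by
  rw [← integral_add_right_eq_self (fun x => φ (x - c) • w x) c]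
  refine integral_congr_ae ?_
  filter_upwards [tau_ae c w] with x h1
  simp [h1]

lemma contDiff_comp_sub {φ : ℝ → ℝ} (hφ : ContDiff ℝ ∞ φ) (c : ℝ) :
    ContDiff ℝ ∞ fun x => φ (x - c) :=
  hφ.comp (contDiff_id.sub contDiff_const)

lemma hasCompactSupport_comp_sub {φ : ℝ → ℝ} (hc : HasCompactSupport φ) (c : ℝ) :
    HasCompactSupport fun x => φ (x - c) :=
  hc.comp_homeomorph (Homeomorph.subRight c)

/-- Translation of Sobolev functions. -/
def H1.shift (c : ℝ) (ψ : H1) : H1 :=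
  ⟨(tau c ψ.1.1, tau c ψ.1.2), by
    intro φ hφ hc
    have h := (ψ.2 : HasWeakDeriv ψ.1.1 ψ.1.2) _ (contDiff_comp_sub hφ c)
      (hasCompactSupport_comp_sub hc c)
    rw [integral_smul_tau, integral_smul_tau, ← h]
    simp_rw [deriv_comp_sub_const]⟩

lemma H1.eval_shift (c : ℝ) (ψ : H1) (x : ℝ) : H1.eval (H1.shift c ψ) x = H1.eval ψ (x + c) := by
  refine congrFun (H1.eval_eq (k := fun x => H1.eval ψ (x + c)) ?_ ?_) x
  · exact (H1.continuous_eval ψ).comp (by fun_prop)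
  · filter_upwards [tau_ae c ψ.1.1, ae_comp_add (H1.ae_eq_eval ψ) c] with x h1 h2
    rw [← h2]
    exact h1

/-- The pairing is the convolution of `w` with the reflected test function, so the derivative falls
on the smooth factor. -/
lemma hasDerivAt_integral_comp_sub {φ : ℝ → ℝ} (hφ : ContDiff ℝ ∞ φ) (hc : HasCompactSupport φ)
    (w : L2) (c : ℝ) :
    HasDerivAt (fun c => ∫ x, φ (x - c) • w x) (-∫ x, deriv φ (x - c) • w x) c := by
  let L : ℂ →L[ℝ] ℝ →L[ℝ] ℂ := (ContinuousLinearMap.lsmul ℝ ℝ).flip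
  have hφ2 : ContDiff ℝ 1 fun y => φ (-y) := (hφ.comp contDiff_neg).of_le (by exact_mod_cast le_top)
  have hc2 : HasCompactSupport fun y => φ (-y) := hc.comp_homeomorph (Homeomorph.neg ℝ)
  have h := hc2.hasDerivAt_convolution_right (μ := volume) L (L2.locallyIntegrable w) hφ2 c
  have e1 : ((w : ℝ → ℂ) ⋆[L, volume] fun y => φ (-y)) = fun c => ∫ x, φ (x - c) • w x := by
    ext c
    simp [convolution, L]
  have e2 : ((w : ℝ → ℂ) ⋆[L, volume] deriv fun y => φ (-y)) c
      = -∫ x, deriv φ (x - c) • w x := by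
    rw [convolution, ← integral_neg]
    refine integral_congr_ae (Eventually.of_forall fun x => ?_)
    simp [deriv_comp_neg, L]
  rwa [e1, e2] at h

/-- Against a test function the shift can be moved onto that function and differentiated there; the
weak derivative of `ψ` then takes the derivative back. Continuity of `s ↦ tau s ψ'` makes the
integral a genuine one in `L²`. -/
lemma tau_sub_self (ψ : H1) (c : ℝ) : tau c ψ.1.1 - ψ.1.1 = ∫ s in (0 : ℝ)..c, tau s ψ.1.2 := by
  have hcont : Continuous fun s => tau s ψ.1.2 := continuous_tau continuous_id continuous_const
  refine L2.ext_of_ofTest fun φ hφ hc => ?_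
  set T := H1.ofTest hφ hc
  have hT : ∀ w, ⟪T.1.1, w⟫ = ∫ x, φ x • w x := fun w => inner_testL2 hφ.continuous hc w
  have h1 : ⟪T.1.1, ∫ s in (0 : ℝ)..c, tau s ψ.1.2⟫ = ∫ s in (0 : ℝ)..c, ⟪T.1.1, tau s ψ.1.2⟫ :=
    ((innerSL ℂ T.1.1).intervalIntegral_comp_comm (hcont.intervalIntegrable _ _)).symm
  have hd : ∀ s, HasDerivAt (fun s => ⟪T.1.1, tau s ψ.1.1⟫) ⟪T.1.1, tau s ψ.1.2⟫ s := fun s => by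
    simp_rw [hT, integral_smul_tau]
    convert hasDerivAt_integral_comp_sub hφ hc ψ.1.1 s using 1
    have h := (ψ.2 : HasWeakDeriv ψ.1.1 ψ.1.2) _ (contDiff_comp_sub hφ s)
      (hasCompactSupport_comp_sub hc s)
    simp_rw [deriv_comp_sub_const] at h
    rw [h, neg_neg]
  rw [h1, intervalIntegral.integral_eq_sub_of_hasDerivAt (fun s _ => hd s)
    ((continuous_const.inner hcont).intervalIntegrable _ _), tau_zero, inner_sub_right]

/-- Translations are differentiable in `L²` along Sobolev functions. -/
lemma hasDerivAt_tau (ψ : H1) (c : ℝ) :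
    HasDerivAt (fun c => tau c ψ.1.1) (tau c ψ.1.2) c := by
  have hcont : Continuous fun s => tau s ψ.1.2 := continuous_tau continuous_id continuous_const
  have h : (fun c => tau c ψ.1.1) = fun c => (∫ s in (0 : ℝ)..c, tau s ψ.1.2) + ψ.1.1 := by
    ext1 c
    rw [← tau_sub_self, sub_add_cancel]
  rw [h]
  exact (intervalIntegral.integral_hasDerivAt_right (hcont.intervalIntegrable _ _)
    (hcont.stronglyMeasurableAtFilter _ _) hcont.continuousAt).add_const _

end KGOsc

end

noncomputable section

namespace KGOsc

local notation "⟪" u ", " v "⟫" => inner ℂ u v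

/-! ### Functions cut off to a time window -/

/-- The function `f` on `(s, t]`, with a minus sign when `t < s`. -/
def winFun (f : C(ℝ, ℂ)) (s t : ℝ) (r : ℝ) : ℂ :=
  (Ioc s t).indicator f r - (Ioc t s).indicator f r

lemma memLp_indicator_Ioc (f : C(ℝ, ℂ)) (s t : ℝ) :
    MemLp ((Ioc s t).indicator f) 2 (volume : Measure ℝ) := by
  rw [memLp_indicator_iff_restrict measurableSet_Ioc]
  obtain ⟨C, hC⟩ := (isCompact_Icc (a := s) (b := t)).exists_bound_of_continuousOn
    f.continuous.continuousOn
  refine MemLp.of_bound f.continuous.aestronglyMeasurable C ?_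
  exact (ae_restrict_iff' measurableSet_Ioc).2
    (Eventually.of_forall fun r hr => hC r (Ioc_subset_Icc_self hr))

lemma memLp_winFun (f : C(ℝ, ℂ)) (s t : ℝ) : MemLp (winFun f s t) 2 (volume : Measure ℝ) :=
  (memLp_indicator_Ioc f s t).sub (memLp_indicator_Ioc f t s)

/-- `winFun` as an element of `L²`. -/
def win (f : C(ℝ, ℂ)) (s t : ℝ) : L2 := (memLp_winFun f s t).toLp _

lemma win_ae (f : C(ℝ, ℂ)) (s t : ℝ) : (win f s t : ℝ → ℂ) =ᵐ[volume] winFun f s t :=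
  (memLp_winFun f s t).coeFn_toLp

/-- The sign convention of `winFun` is made for this: windows add for times in any order, like
interval integrals, so both time directions are handled together. -/
lemma win_add_adjacent (f : C(ℝ, ℂ)) (s t u : ℝ) : win f s t + win f t u = win f s u := by
  rw [win, win, win, ← MemLp.toLp_add]
  congr 1
  ext r
  simp only [Pi.add_apply, winFun, indicator_apply, mem_Ioc]
  split_ifs <;> first | ring1 | (exfalso; grind)

lemma win_self (f : C(ℝ, ℂ)) (s : ℝ) : win f s s = 0 := by
  have := win_add_adjacent f s s s
  simpa using this

lemma win_sub (f g : C(ℝ, ℂ)) (s t : ℝ) : win (f - g) s t = win f s t - win g s t := by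
  rw [win, win, win, ← MemLp.toLp_sub]
  congr 1
  ext r
  simp only [Pi.sub_apply, winFun, indicator_apply, ContinuousMap.sub_apply]
  split_ifs <;> ring

lemma norm_winFun (f : C(ℝ, ℂ)) (s t r : ℝ) :
    ‖winFun f s t r‖ = (uIoc s t).indicator (fun r => ‖f r‖) r := by
  rcases le_total s t with h | h
  · simp [winFun, uIoc_of_le h, Ioc_eq_empty_of_le h, norm_indicator_eq_indicator_norm]
  · simp [winFun, uIoc_of_ge h, Ioc_eq_empty_of_le h, norm_indicator_eq_indicator_norm]

lemma norm_win_sq (f : C(ℝ, ℂ)) (s t : ℝ) :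
    ‖win f s t‖ ^ 2 = ∫ r in uIoc s t, ‖f r‖ ^ 2 := by
  rw [← L2.integral_norm_sq, ← integral_indicator measurableSet_uIoc]
  refine integral_congr_ae ?_
  filter_upwards [win_ae f s t] with r hr
  rw [hr, norm_winFun]
  by_cases h : r ∈ uIoc s t <;> simp [h]

lemma norm_win_sq' (f : C(ℝ, ℂ)) (s t : ℝ) :
    ‖win f s t‖ ^ 2 = |∫ r in s..t, ‖f r‖ ^ 2| := by
  rw [intervalIntegral.abs_integral_eq_abs_integral_uIoc, ← norm_win_sq, abs_of_nonneg (by positivity)]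

/-- By additivity the increment is the window from `t` to `u`, whose squared norm is the integral of
`|f|²` there. -/
lemma continuous_win (f : C(ℝ, ℂ)) (s : ℝ) : Continuous (win f s) := by
  rw [continuous_iff_continuousAt]
  intro t
  rw [ContinuousAt, tendsto_iff_norm_sub_tendsto_zero]
  have hc : Continuous fun u => |∫ r in t..u, ‖f r‖ ^ 2| :=
    (intervalIntegral.continuous_primitive
      (fun a b => (f.continuous.norm.pow 2).intervalIntegrable a b) t).abs
  have h0 : Tendsto (fun u => √|∫ r in t..u, ‖f r‖ ^ 2|) (𝓝 t) (𝓝 0) := by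
    have := (Real.continuous_sqrt.comp hc).tendsto t
    simpa [Function.comp_def] using this
  refine h0.congr fun u => ?_
  rw [← win_add_adjacent f s t u, add_sub_cancel_left, ← norm_win_sq', Real.sqrt_sq (norm_nonneg _)]

/-- The gain `1/μ` of time integration in the exponentially weighted norm. -/
lemma abs_integral_exp_le {μ : ℝ} (hμ : 0 < μ) (t : ℝ) :
    |∫ s in (0 : ℝ)..t, Real.exp (μ * |s|)| ≤ Real.exp (μ * |t|) / μ := by
  have hpos : ∀ t, 0 ≤ t → |∫ s in (0 : ℝ)..t, Real.exp (μ * |s|)| ≤ Real.exp (μ * |t|) / μ := by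
    intro t ht
    have h1 : ∫ s in (0 : ℝ)..t, Real.exp (μ * |s|) = ∫ s in (0 : ℝ)..t, Real.exp (μ * s) :=
      intervalIntegral.integral_congr fun s hs => by
        rw [uIcc_of_le ht] at hs
        simp only [abs_of_nonneg hs.1]
    have h2 : ∫ s in (0 : ℝ)..t, Real.exp (μ * s) = Real.exp (μ * t) / μ - Real.exp (μ * 0) / μ := by
      refine intervalIntegral.integral_eq_sub_of_hasDerivAt (f := fun s => Real.exp (μ * s) / μ) (fun s _ => ?_)
        ((by fun_prop : Continuous fun s => Real.exp (μ * s)).intervalIntegrable _ _)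
      have := (((hasDerivAt_id s).const_mul μ).exp).div_const μ
      convert! this using 1
      simp; field_simp
    rw [h1, h2, abs_of_nonneg ht, mul_zero, Real.exp_zero, abs_of_nonneg]
    · have : 0 < 1 / μ := by positivity
      linarith
    · rw [← sub_div]
      exact div_nonneg (sub_nonneg.2 (Real.one_le_exp (by positivity))) hμ.le
  rcases le_total 0 t with h | h
  · exact hpos t h
  · have h1 := hpos (-t) (by linarith)
    have h2 := intervalIntegral.integral_comp_neg (fun s => Real.exp (μ * |s|)) (a := 0) (b := t)
    simp only [abs_neg, neg_zero] at h2 h1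
    rw [h2, intervalIntegral.integral_symm, abs_neg]
    exact h1

/-- The weight is squared before it is integrated, so the gain is `1/√(2μ)`: weaker than for
distributed forces, yet still small for large `μ`. -/
lemma norm_win_le {f : C(ℝ, ℂ)} {D μ : ℝ} (hμ : 0 < μ)
    (hf : ∀ r, ‖f r‖ ≤ D * Real.exp (μ * |r|)) (t : ℝ) :
    ‖win f 0 t‖ ≤ D * Real.exp (μ * |t|) / √(2 * μ) := by
  have hD : 0 ≤ D := by
    have := (norm_nonneg _).trans (hf 0)
    simpa using this
  have h2 : 0 < 2 * μ := by linarith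
  refine abs_le_of_sq_le_sq' ?_ (by positivity) |>.2
  rw [norm_win_sq']
  have h1 : |∫ r in (0 : ℝ)..t, ‖f r‖ ^ 2| ≤ |∫ r in (0 : ℝ)..t, D ^ 2 * Real.exp (2 * μ * |r|)| := by
    rw [← Real.norm_eq_abs]
    refine intervalIntegral.norm_integral_le_abs_of_norm_le (Eventually.of_forall fun r => ?_)
      ((by fun_prop : Continuous fun r => D ^ 2 * Real.exp (2 * μ * |r|)).intervalIntegrable _ _)
    rw [norm_pow, norm_norm, show D ^ 2 * Real.exp (2 * μ * |r|) = (D * Real.exp (μ * |r|)) ^ 2 by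
      rw [mul_pow, ← Real.exp_nat_mul]; push_cast; ring_nf]
    exact pow_le_pow_left₀ (norm_nonneg _) (hf r) 2
  rw [intervalIntegral.integral_const_mul, abs_mul, abs_of_nonneg (sq_nonneg D)] at h1
  refine h1.trans ((mul_le_mul_of_nonneg_left (abs_integral_exp_le h2 t) (sq_nonneg D)).trans_eq ?_)
  rw [div_pow, mul_pow, Real.sq_sqrt h2.le, ← Real.exp_nat_mul, mul_div_assoc]
  congr 3
  push_cast; ring

/-! ### Point sources in characteristic coordinates -/

lemma measurePreserving_dir {ε : ℝ} (hε : ε = 1 ∨ ε = -1) (X : ℝ) :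
    MeasurePreserving (fun y : ℝ => ε * (y - X)) volume volume := by
  rcases hε with rfl | rfl
  · simpa using measurePreserving_sub_right (volume : Measure ℝ) X
  · simpa using (volume : Measure ℝ).measurePreserving_sub_left X

lemma integral_comp_dir {ε : ℝ} (hε : ε = 1 ∨ ε = -1) (X : ℝ) (G : ℝ → ℂ) :
    ∫ y, G (ε * (y - X)) = ∫ r, G r := by
  rcases hε with rfl | rfl
  · simpa using integral_sub_right_eq_self G X
  · simpa using integral_sub_left_eq_self G volume X

/-- The contribution, in characteristic coordinates, of a force `f` acting at the point `X`
during the time window from `s` to `t`. -/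
def src {ε : ℝ} (hε : ε = 1 ∨ ε = -1) (X : ℝ) (f : C(ℝ, ℂ)) (s t : ℝ) : L2 :=
  Lp.compMeasurePreservingₗᵢ ℂ (fun y : ℝ => ε * (y - X)) (measurePreserving_dir hε X) (win f s t)

section src

variable {ε : ℝ} (hε : ε = 1 ∨ ε = -1) (X : ℝ) (f g : C(ℝ, ℂ)) (s t u : ℝ)

lemma src_ae : (src hε X f s t : ℝ → ℂ) =ᵐ[volume] fun y => winFun f s t (ε * (y - X)) := by
  have h1 : (src hε X f s t : ℝ → ℂ) =ᵐ[volume] fun y => win f s t (ε * (y - X)) :=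
    Lp.coeFn_compMeasurePreserving _ (measurePreserving_dir hε X)
  filter_upwards [h1, (measurePreserving_dir hε X).quasiMeasurePreserving.ae (win_ae f s t)]
    with y h2 h3
  rw [h2, h3]

lemma norm_src : ‖src hε X f s t‖ = ‖win f s t‖ := LinearIsometry.norm_map _ _

lemma src_self : src hε X f s s = 0 := by rw [src, win_self, map_zero]

lemma src_sub : src hε X (f - g) s t = src hε X f s t - src hε X g s t := by
  rw [src, win_sub, map_sub]; rfl

lemma continuous_src : Continuous (src hε X f s) :=
  (LinearIsometry.continuous _).comp (continuous_win f s)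

lemma integral_winFun_mul {k : ℝ → ℂ} (hk : Continuous k) :
    ∫ r, winFun f s t r * k r = ∫ r in s..t, f r * k r := by
  have hi : ∀ a b, IntegrableOn (fun r => f r * k r) (Ioc a b) := fun a b =>
    ((f.continuous.mul hk).integrableOn_Icc).mono_set Ioc_subset_Icc_self
  have h1 : ∀ r, winFun f s t r * k r = (Ioc s t).indicator (fun r => f r * k r) r
      - (Ioc t s).indicator (fun r => f r * k r) r := fun r => by
    simp only [winFun, indicator_apply]
    split_ifs <;> ring
  simp_rw [h1]
  rw [integral_sub ((hi s t).integrable_indicator measurableSet_Ioc)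
    ((hi t s).integrable_indicator measurableSet_Ioc), integral_indicator measurableSet_Ioc,
    integral_indicator measurableSet_Ioc]
  rfl

/-- The substitution `y = X + εr`, where `ε² = 1`, identifies `src` with `∫ f(r) δ_{X+εr} dr`: a
point mass moving at unit speed is smoothed by time integration into a square integrable function.
-/
lemma inner_src (η : H1) :
    ⟪η.1.1, src hε X f s t⟫ = ∫ r in s..t, f r * conj (H1.eval η (X + ε * r)) := by
  have hεε : ε * ε = 1 := by rcases hε with rfl | rfl <;> norm_num
  have hk : Continuous fun r => conj (H1.eval η (X + ε * r)) :=
    Complex.continuous_conj.comp ((H1.continuous_eval η).comp (by fun_prop))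
  rw [← integral_winFun_mul f s t hk,
    ← integral_comp_dir hε X fun r => winFun f s t r * conj (H1.eval η (X + ε * r)), L2.inner_def]
  refine integral_congr_ae ?_
  filter_upwards [src_ae hε X f s t, H1.ae_eq_eval η] with y h1 h2
  have h3 : X + ε * (ε * (y - X)) = y := by rw [← mul_assoc, hεε]; ring
  simp [h1, h2, h3]

lemma norm_src_ae_le {M : ℝ} (hM : ∀ r ∈ uIoc s t, ‖f r‖ ≤ M) (hM0 : 0 ≤ M) :
    ∀ᵐ y ∂volume, ‖src hε X f s t y‖ ≤ M := by
  filter_upwards [src_ae hε X f s t] with y hy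
  rw [hy, norm_winFun]
  by_cases h : ε * (y - X) ∈ uIoc s t
  · simpa [h] using hM _ h
  · simpa [h] using hM0

end src

end KGOsc

end

noncomputable section

namespace KGOsc

local notation "⟪" u ", " v "⟫" => inner ℂ u v

/-! ### Evolution along characteristics -/

/-- Product rule for a norm differentiable and a weakly differentiable factor. -/
lemma hasDerivAt_inner_of_weak {Φ z : ℝ → L2} {Φ' : L2} {ℓ : ℂ} {t : ℝ}
    (hΦ : HasDerivAt Φ Φ' t) (hz : ContinuousAt z t)
    (hw : HasDerivAt (fun s => ⟪Φ t, z s⟫) ℓ t) :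
    HasDerivAt (fun s => ⟪Φ s, z s⟫) (⟪Φ', z t⟫ + ℓ) t := by
  have h1 : HasDerivAt (fun s => ⟪Φ s - Φ t, z s⟫) ⟪Φ', z t⟫ t := by
    rw [hasDerivAt_iff_tendsto_slope] at hΦ ⊢
    have h2 := hΦ.inner (𝕜 := ℂ) (hz.tendsto.mono_left nhdsWithin_le_nhds)
    -- Only `z` itself has to converge here, since the difference quotient of `Φ` converges in norm;
    -- the weak derivative of `z` enters solely at the frozen vector `Φ t`.
    refine h2.congr fun s => ?_
    rw [slope_def_module, slope_def_module, sub_self, inner_zero_left, sub_zero,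
      inner_smul_left_eq_smul]
  refine (h1.add hw).congr_of_eventuallyEq (Eventually.of_forall fun s => ?_)
  simp [inner_sub_left]

/-- The profile of a travelling component with initial value `a`, distributed force `g` and
point forces `f`. -/
def profile {N : ℕ} {ε : ℝ} (hε : ε = 1 ∨ ε = -1) (X : Fin N → ℝ) (g : ℝ → L2)
    (f : Fin N → C(ℝ, ℂ)) (a : L2) (t : ℝ) : L2 :=
  a + (∫ s in (0 : ℝ)..t, tau (-(ε * s)) (g s)) + ∑ J, src hε (X J) (f J) 0 t

/-- A travelling component in the original coordinates. -/
def travel {N : ℕ} {ε : ℝ} (hε : ε = 1 ∨ ε = -1) (X : Fin N → ℝ) (g : ℝ → L2)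
    (f : Fin N → C(ℝ, ℂ)) (a : L2) (t : ℝ) : L2 :=
  tau (ε * t) (profile hε X g f a t)

section travel

variable {N : ℕ} {ε : ℝ} (hε : ε = 1 ∨ ε = -1) (X : Fin N → ℝ) {g : ℝ → L2}
  (f : Fin N → C(ℝ, ℂ)) (a : L2)

lemma continuous_tau_force (ε : ℝ) (hg : Continuous g) :
    Continuous fun s => tau (-(ε * s)) (g s) :=
  continuous_tau (by fun_prop) hg

lemma continuous_profile (hg : Continuous g) : Continuous (profile hε X g f a) := by
  have h1 : Continuous fun t => ∫ s in (0 : ℝ)..t, tau (-(ε * s)) (g s) :=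
    intervalIntegral.continuous_primitive
      (fun a b => (continuous_tau_force ε hg).intervalIntegrable a b) 0
  exact (continuous_const.add h1).add
    (continuous_finsetSum _ fun J _ => continuous_src hε (X J) (f J) 0)

lemma continuous_travel (hg : Continuous g) : Continuous (travel hε X g f a) :=
  continuous_tau (by fun_prop) (continuous_profile hε X f a hg)

lemma profile_zero : profile hε X g f a 0 = a := by
  simp [profile, src_self]

lemma travel_zero : travel hε X g f a 0 = a := by
  rw [travel, mul_zero, tau_zero, profile_zero]

/-- The test vector has to be in `H¹`, because the point forces contribute its values at the moving
points `X J + ε * t`. -/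
lemma hasDerivAt_inner_profile (hg : Continuous g) (η : H1) (t : ℝ) :
    HasDerivAt (fun s => ⟪η.1.1, profile hε X g f a s⟫)
      (⟪η.1.1, tau (-(ε * t)) (g t)⟫
        + ∑ J, f J t * conj (H1.eval η (X J + ε * t))) t := by
  have hc := continuous_tau_force ε hg
  have h1 : ∀ s, ⟪η.1.1, profile hε X g f a s⟫ = ⟪η.1.1, a⟫
      + ⟪η.1.1, ∫ s in (0 : ℝ)..s, tau (-(ε * s)) (g s)⟫
      + ∑ J, ∫ r in (0 : ℝ)..s, f J r * conj (H1.eval η (X J + ε * r)) := fun s => by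
    rw [profile, inner_add_right, inner_add_right, inner_sum]
    simp_rw [inner_src]
  simp_rw [h1]
  have h2 : HasDerivAt (fun s => ∫ s in (0 : ℝ)..s, tau (-(ε * s)) (g s))
      (tau (-(ε * t)) (g t)) t :=
    intervalIntegral.integral_hasDerivAt_right (hc.intervalIntegrable _ _)
      (hc.stronglyMeasurableAtFilter _ _) hc.continuousAt
  have h3 : HasDerivAt (fun s => ⟪η.1.1, ∫ s in (0 : ℝ)..s, tau (-(ε * s)) (g s)⟫)
      ⟪η.1.1, tau (-(ε * t)) (g t)⟫ t :=
    ((innerSL ℂ η.1.1).restrictScalars ℝ).hasFDerivAt.comp_hasDerivAt t h2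
  refine (h3.const_add _).add (HasDerivAt.fun_sum fun J _ => ?_)
  have h4 : Continuous fun r => f J r * conj (H1.eval η (X J + ε * r)) :=
    (f J).continuous.mul
      (Complex.continuous_conj.comp ((H1.continuous_eval η).comp (by fun_prop)))
  exact intervalIntegral.integral_hasDerivAt_right (h4.intervalIntegrable _ _)
    (h4.stronglyMeasurableAtFilter _ _) h4.continuousAt

/-- The weak transport equation `(∂_t - ε∂_x) w = g + ∑ δ(x - X_J) f_J`. The translation is moved
onto `η`, where it is strongly differentiable, and the profile is differentiated only weakly. -/
lemma hasDerivAt_inner_travel (hg : Continuous g) (η : H1) (t : ℝ) :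
    HasDerivAt (fun s => ⟪η.1.1, travel hε X g f a s⟫)
      (-ε * ⟪η.1.2, travel hε X g f a t⟫ + (⟪η.1.1, g t⟫
        + ∑ J, f J t * conj (H1.eval η (X J)))) t := by
  have e : ∀ (u v : L2) s, ⟪u, tau (ε * s) v⟫ = ⟪tau (-(ε * s)) u, v⟫ := fun u v s => by
    rw [inner_tau_left, neg_neg]
  simp_rw [travel, e]
  have h1 : HasDerivAt (fun s => tau (-(ε * s)) η.1.1) (-ε • tau (-(ε * t)) η.1.2) t := by
    have h2 : HasDerivAt (fun s : ℝ => -(ε * s)) (-ε) t := by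
      simpa [Function.comp_def] using! ((hasDerivAt_id' t).const_mul ε).neg
    exact (hasDerivAt_tau η (-(ε * t))).scomp t h2
  have h3 := hasDerivAt_inner_profile hε X f a hg (H1.shift (-(ε * t)) η) t
  have h4 := hasDerivAt_inner_of_weak h1 (continuous_profile hε X f a hg).continuousAt h3
  convert h4 using 1
  congr 1
  · rw [inner_smul_left_eq_smul]
    simp
  · congr 1
    · exact ((tau (-(ε * t))).inner_map_map _ _).symm
    · simp only [H1.eval_shift, add_neg_cancel_right]

end travel

/-- The component of a state travelling in the direction `-ε`. -/
def Phase.char (ε : ℝ) (Ψ : Phase) : L2 := Ψ.mom + (ε : ℂ) • Ψ.dpsi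

lemma Phase.mom_eq (Ψ : Phase) :
    Ψ.mom = (1 / 2 : ℂ) • (Phase.char 1 Ψ + Phase.char (-1) Ψ) := by
  simp only [Phase.char]
  push_cast
  module

lemma Phase.dpsi_eq (Ψ : Phase) :
    Ψ.dpsi = (1 / 2 : ℂ) • (Phase.char 1 Ψ - Phase.char (-1) Ψ) := by
  simp only [Phase.char]
  push_cast
  module

/-- Mild solutions of `ψ̇ = π`, `π̇ = ψ'' + g + ∑_J δ(x - X_J) f_J`. -/
structure IsMild {N : ℕ} (X : Fin N → ℝ) (g : ℝ → L2) (f : Fin N → C(ℝ, ℂ))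
    (Ψ : ℝ → Phase) : Prop where
  continuous : Continuous Ψ
  force : Continuous g
  psi : ∀ t, (Ψ t).psi = (Ψ 0).psi + ∫ s in (0 : ℝ)..t, (Ψ s).mom
  char : ∀ (ε : ℝ) (hε : ε = 1 ∨ ε = -1) (t : ℝ),
    (Ψ t).char ε = travel hε X g f ((Ψ 0).char ε) t

lemma continuous_psi : Continuous Phase.psi := by unfold Phase.psi; fun_prop
lemma continuous_dpsi : Continuous Phase.dpsi := by unfold Phase.dpsi; fun_prop
lemma continuous_mom : Continuous Phase.mom := by unfold Phase.mom; fun_prop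

/-! ### The weak equations satisfied by a mild solution -/

namespace IsMild

variable {N : ℕ} {X : Fin N → ℝ} {g : ℝ → L2} {f : Fin N → C(ℝ, ℂ)} {Ψ : ℝ → Phase}

lemma hasDerivAt_psi (h : IsMild X g f Ψ) (t : ℝ) :
    HasDerivAt (fun t => (Ψ t).psi) (Ψ t).mom t := by
  have hc : Continuous fun t => (Ψ t).mom := continuous_mom.comp h.continuous
  have h1 : (fun t => (Ψ t).psi) = fun t => (Ψ 0).psi + ∫ s in (0 : ℝ)..t, (Ψ s).mom :=
    funext h.psi
  rw [h1]
  exact (intervalIntegral.integral_hasDerivAt_right (hc.intervalIntegrable _ _)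
    (hc.stronglyMeasurableAtFilter _ _) hc.continuousAt).const_add _

/-- The sum of the cases `ε = 1` and `ε = -1` is the momentum equation; in the difference the forces
cancel. -/
lemma hasDerivAt_inner_char (h : IsMild X g f Ψ) {ε : ℝ} (hε : ε = 1 ∨ ε = -1) (η : H1) (t : ℝ) :
    HasDerivAt (fun s => ⟪η.1.1, (Ψ s).char ε⟫)
      (-ε * ⟪η.1.2, (Ψ t).char ε⟫ + (⟪η.1.1, g t⟫
        + ∑ J, f J t * conj (H1.eval η (X J)))) t := by
  rw [h.char ε hε t, funext fun s => congrArg (inner ℂ η.1.1) (h.char ε hε s)]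
  exact hasDerivAt_inner_travel hε X f _ h.force η t

/-- The momentum equation tested against a Sobolev function. -/
lemma hasDerivAt_inner_mom (h : IsMild X g f Ψ) (η : H1) (t : ℝ) :
    HasDerivAt (fun s => ⟪η.1.1, (Ψ s).mom⟫)
      (-⟪η.1.2, (Ψ t).dpsi⟫ + (⟪η.1.1, g t⟫
        + ∑ J, f J t * conj (H1.eval η (X J)))) t := by
  have h1 := ((h.hasDerivAt_inner_char (Or.inl rfl) η t).add
    (h.hasDerivAt_inner_char (Or.inr rfl) η t)).const_mul (1 / 2 : ℂ)
  have e : (fun s => ⟪η.1.1, (Ψ s).mom⟫) = fun s => (1 / 2 : ℂ) * (⟪η.1.1, (Ψ s).char 1⟫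
      + ⟪η.1.1, (Ψ s).char (-1)⟫) := by
    ext s
    rw [Phase.mom_eq, inner_smul_right, inner_add_right]
  rw [e]
  convert! h1 using 1
  rw [Phase.dpsi_eq, inner_smul_right, inner_sub_right]
  push_cast
  ring

end IsMild

/-! ### Construction of the mild solution for prescribed forces -/

section evolve

variable {N : ℕ} (X : Fin N → ℝ) {g : ℝ → L2} (f : Fin N → C(ℝ, ℂ)) (Ψ₀ : Phase)

/-- The momentum of the mild solution with given data. -/
def evolveMom (g : ℝ → L2) (t : ℝ) : L2 :=
  (1 / 2 : ℂ) • (travel (Or.inl rfl) X g f (Ψ₀.char 1) t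
    + travel (Or.inr rfl) X g f (Ψ₀.char (-1)) t)

/-- The spatial derivative of the mild solution with given data. -/
def evolveDpsi (g : ℝ → L2) (t : ℝ) : L2 :=
  (1 / 2 : ℂ) • (travel (Or.inl rfl) X g f (Ψ₀.char 1) t
    - travel (Or.inr rfl) X g f (Ψ₀.char (-1)) t)

/-- The field of the mild solution with given data. -/
def evolvePsi (g : ℝ → L2) (t : ℝ) : L2 :=
  Ψ₀.psi + ∫ s in (0 : ℝ)..t, evolveMom X f Ψ₀ g s

lemma continuous_evolveMom (hg : Continuous g) : Continuous (evolveMom X f Ψ₀ g) :=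
  ((continuous_travel (Or.inl rfl) X f (Ψ₀.char 1) hg).add
    (continuous_travel (Or.inr rfl) X f (Ψ₀.char (-1)) hg)).const_smul (1 / 2 : ℂ)

lemma continuous_evolveDpsi (hg : Continuous g) : Continuous (evolveDpsi X f Ψ₀ g) :=
  ((continuous_travel (Or.inl rfl) X f (Ψ₀.char 1) hg).sub
    (continuous_travel (Or.inr rfl) X f (Ψ₀.char (-1)) hg)).const_smul (1 / 2 : ℂ)

lemma hasDerivAt_evolvePsi (hg : Continuous g) (t : ℝ) :
    HasDerivAt (evolvePsi X f Ψ₀ g) (evolveMom X f Ψ₀ g t) t := by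
  have hc := continuous_evolveMom X f Ψ₀ hg
  exact (intervalIntegral.integral_hasDerivAt_right (hc.intervalIntegrable _ _)
    (hc.stronglyMeasurableAtFilter _ _) hc.continuousAt).const_add _

/-- The field and its derivative are built independently, so their compatibility must be shown.
Tested against `φ`, the defect has zero time derivative, since equal forces enter both
characteristic components and cancel in their difference; and it vanishes at time zero. -/
lemma hasWeakDeriv_evolve (hg : Continuous g) (t : ℝ) :
    HasWeakDeriv (evolvePsi X f Ψ₀ g t) (evolveDpsi X f Ψ₀ g t) := by
  rw [hasWeakDeriv_iff]
  intro φ hφ hc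
  set T := H1.ofTest hφ hc with hT
  set D : ℝ → ℂ := fun t => ⟪T.1.2, evolvePsi X f Ψ₀ g t⟫ + ⟪T.1.1, evolveDpsi X f Ψ₀ g t⟫ with hD
  have hd : ∀ t, HasDerivAt D 0 t := fun t => by
    have h1 : HasDerivAt (fun t => ⟪T.1.2, evolvePsi X f Ψ₀ g t⟫) ⟪T.1.2, evolveMom X f Ψ₀ g t⟫ t :=
      ((innerSL ℂ T.1.2).restrictScalars ℝ).hasFDerivAt.comp_hasDerivAt t
        (hasDerivAt_evolvePsi X f Ψ₀ hg t)
    have h2 := ((hasDerivAt_inner_travel (Or.inl rfl) X f (Ψ₀.char 1) hg T t).sub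
      (hasDerivAt_inner_travel (Or.inr rfl) X f (Ψ₀.char (-1)) hg T t)).const_mul (1 / 2 : ℂ)
    have e : (fun t => ⟪T.1.1, evolveDpsi X f Ψ₀ g t⟫) = fun t => (1 / 2 : ℂ) *
        (⟪T.1.1, travel (Or.inl rfl) X g f (Ψ₀.char 1) t⟫
          - ⟪T.1.1, travel (Or.inr rfl) X g f (Ψ₀.char (-1)) t⟫) := by
      ext s
      rw [evolveDpsi, inner_smul_right, inner_sub_right]
    simp only [hD]
    rw [show (fun t => ⟪T.1.2, evolvePsi X f Ψ₀ g t⟫ + ⟪T.1.1, evolveDpsi X f Ψ₀ g t⟫) = fun t =>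
      ⟪T.1.2, evolvePsi X f Ψ₀ g t⟫ + (1 / 2 : ℂ) *
        (⟪T.1.1, travel (Or.inl rfl) X g f (Ψ₀.char 1) t⟫
          - ⟪T.1.1, travel (Or.inr rfl) X g f (Ψ₀.char (-1)) t⟫) from
        funext fun t => congrArg _ (congrFun e t)]
    convert! h1.add h2 using 1
    rw [evolveMom, inner_smul_right, inner_add_right]
    push_cast
    ring
  have h0 : D 0 = 0 := by
    have e1 : evolvePsi X f Ψ₀ g 0 = Ψ₀.psi := by simp [evolvePsi]
    have e2 : evolveDpsi X f Ψ₀ g 0 = Ψ₀.dpsi := by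
      rw [evolveDpsi, travel_zero, travel_zero, ← Phase.dpsi_eq]
    have h := hasWeakDeriv_iff.1 (Ψ₀.1.2 : HasWeakDeriv Ψ₀.psi Ψ₀.dpsi) φ hφ hc
    simp only [hD, e1, e2]
    rw [show ⟪T.1.2, Ψ₀.psi⟫ = -⟪T.1.1, Ψ₀.dpsi⟫ from h, neg_add_cancel]
  have h1 : D t = D 0 := is_const_of_deriv_eq_zero (fun t => (hd t).differentiableAt)
    (fun t => (hd t).deriv) t 0
  rw [h0] at h1
  exact eq_neg_of_add_eq_zero_left h1

/-- The mild solution with given data. -/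
def evolve (hg : Continuous g) (t : ℝ) : Phase :=
  (⟨(evolvePsi X f Ψ₀ g t, evolveDpsi X f Ψ₀ g t), hasWeakDeriv_evolve X f Ψ₀ hg t⟩,
    evolveMom X f Ψ₀ g t)

lemma evolve_zero (hg : Continuous g) : evolve X f Ψ₀ hg 0 = Ψ₀ := by
  refine Prod.ext (Subtype.ext (Prod.ext ?_ ?_)) ?_
  · change evolvePsi X f Ψ₀ g 0 = Ψ₀.psi
    simp [evolvePsi]
  · change evolveDpsi X f Ψ₀ g 0 = Ψ₀.dpsi
    rw [evolveDpsi, travel_zero, travel_zero, ← Phase.dpsi_eq]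
  · change evolveMom X f Ψ₀ g 0 = Ψ₀.mom
    rw [evolveMom, travel_zero, travel_zero, ← Phase.mom_eq]

lemma isMild_evolve (hg : Continuous g) : IsMild X g f (evolve X f Ψ₀ hg) where
  continuous := by
    have h1 : Continuous (evolvePsi X f Ψ₀ g) := continuous_iff_continuousAt.2 fun t =>
      (hasDerivAt_evolvePsi X f Ψ₀ hg t).continuousAt
    exact Continuous.prodMk (Continuous.subtype_mk
      (h1.prodMk (continuous_evolveDpsi X f Ψ₀ hg)) _) (continuous_evolveMom X f Ψ₀ hg)
  force := hg
  psi := fun t => by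
    rw [evolve_zero]; rfl
  char := fun ε hε t => by
    rw [evolve_zero]
    rcases hε with rfl | rfl
    · change evolveMom X f Ψ₀ g t + ((1 : ℝ) : ℂ) • evolveDpsi X f Ψ₀ g t = _
      rw [evolveMom, evolveDpsi]
      push_cast
      module
    · change evolveMom X f Ψ₀ g t + ((-1 : ℝ) : ℂ) • evolveDpsi X f Ψ₀ g t = _
      rw [evolveMom, evolveDpsi]
      push_cast
      module

end evolve

end KGOsc

end

noncomputable section

namespace KGOsc

local notation "⟪" u ", " v "⟫" => inner ℂ u v

/-! ### Test functions on the plane -/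

/-- A real valued test function on the plane of `(x, t)`. -/
structure IsTest (φ : ℝ × ℝ → ℝ) : Prop where
  smooth : ContDiff ℝ ∞ φ
  compact : HasCompactSupport φ

namespace IsTest

variable {φ : ℝ × ℝ → ℝ}

lemma hasDerivAt_fst (h : IsTest φ) (x t : ℝ) :
    HasDerivAt (fun x => φ (x, t)) (fderiv ℝ φ (x, t) (1, 0)) x := by
  have h1 : HasFDerivAt φ (fderiv ℝ φ (x, t)) (x, t) :=
    (h.smooth.differentiable (by simp) _).hasFDerivAt
  have h2 : HasDerivAt (fun x : ℝ => (x, t)) ((1 : ℝ), (0 : ℝ)) x :=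
    (hasDerivAt_id x).prodMk (hasDerivAt_const x t)
  exact h1.comp_hasDerivAt x h2

lemma hasDerivAt_snd (h : IsTest φ) (x t : ℝ) :
    HasDerivAt (fun t => φ (x, t)) (fderiv ℝ φ (x, t) (0, 1)) t := by
  have h1 : HasFDerivAt φ (fderiv ℝ φ (x, t)) (x, t) :=
    (h.smooth.differentiable (by simp) _).hasFDerivAt
  have h2 : HasDerivAt (fun t : ℝ => (x, t)) ((0 : ℝ), (1 : ℝ)) t :=
    (hasDerivAt_const t x).prodMk (hasDerivAt_id t)
  exact h1.comp_hasDerivAt t h2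

lemma fderiv_apply (h : IsTest φ) (v : ℝ × ℝ) : IsTest fun p => fderiv ℝ φ p v :=
  ⟨(h.smooth.fderiv_right (m := ∞) (by simp)).clm_apply contDiff_const,
    h.compact.fderiv_apply ℝ v⟩

lemma dx_eq (h : IsTest φ) : dx φ = fun p => fderiv ℝ φ p (1, 0) :=
  funext fun p => (h.hasDerivAt_fst p.1 p.2).deriv

lemma dt_eq (h : IsTest φ) : dt φ = fun p => fderiv ℝ φ p (0, 1) :=
  funext fun p => (h.hasDerivAt_snd p.1 p.2).deriv

lemma dx (h : IsTest φ) : IsTest (KGOsc.dx φ) := by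
  rw [h.dx_eq]; exact h.fderiv_apply _

lemma dt (h : IsTest φ) : IsTest (KGOsc.dt φ) := by
  rw [h.dt_eq]; exact h.fderiv_apply _

lemma hasDerivAt_dt (h : IsTest φ) (x t : ℝ) :
    HasDerivAt (fun t => φ (x, t)) (KGOsc.dt φ (x, t)) t := by
  rw [h.dt_eq]; exact h.hasDerivAt_snd x t

/-- A common bound for both variables on the support. -/
lemma exists_radius (h : IsTest φ) : ∃ R, 0 < R ∧ ∀ x t, (R < |x| ∨ R < |t|) → φ (x, t) = 0 := by
  obtain ⟨R, hR⟩ := (Metric.isBounded_iff_subset_closedBall (0 : ℝ × ℝ)).1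
    h.compact.isCompact.isBounded
  refine ⟨|R| + 1, by positivity, fun x t hxt => ?_⟩
  by_contra hne
  have := hR (subset_tsupport _ hne)
  rw [Metric.mem_closedBall, dist_zero_right, Prod.norm_def, max_le_iff, Real.norm_eq_abs,
    Real.norm_eq_abs] at this
  simp only at this
  rcases hxt with hx | hx <;> linarith [le_abs_self R, this.1, this.2]

lemma slice_smooth (h : IsTest φ) (t : ℝ) : ContDiff ℝ ∞ fun x => φ (x, t) :=
  h.smooth.comp (contDiff_id.prodMk contDiff_const)

lemma slice_compact (h : IsTest φ) (t : ℝ) : HasCompactSupport fun x => φ (x, t) := by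
  obtain ⟨R, -, hR⟩ := h.exists_radius
  refine HasCompactSupport.intro (isCompact_Icc (a := -R) (b := R)) fun x hx => hR x t (Or.inl ?_)
  by_contra hle
  exact hx (abs_le.1 (not_lt.1 hle))

/-- The slice of a test function at a time, as an element of `H¹`. -/
def slice (h : IsTest φ) (t : ℝ) : H1 := H1.ofTest (h.slice_smooth t) (h.slice_compact t)

lemma inner_slice (h : IsTest φ) (t : ℝ) (w : L2) :
    ⟪(h.slice t).1.1, w⟫ = ∫ x, φ (x, t) • w x :=
  inner_testL2 (h.slice_smooth t).continuous (h.slice_compact t) w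

lemma slice_ae (h : IsTest φ) (t : ℝ) :
    ((h.slice t).1.1 : ℝ → ℂ) =ᵐ[volume] fun x => (φ (x, t) : ℂ) :=
  testL2_ae (h.slice_smooth t).continuous (h.slice_compact t)

lemma slice_snd (h : IsTest φ) (t : ℝ) : (h.slice t).1.2 = (h.dx.slice t).1.1 := rfl

lemma slice_eq_zero (h : IsTest φ) {R : ℝ} (hR : ∀ x t, (R < |x| ∨ R < |t|) → φ (x, t) = 0)
    {t : ℝ} (ht : R < |t|) : (h.slice t).1.1 = 0 := by
  refine Lp.ext ?_
  filter_upwards [h.slice_ae t, Lp.coeFn_zero ℂ 2 (volume : Measure ℝ)] with x h1 h2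
  rw [h1, h2, hR x t (Or.inr ht)]
  simp

lemma _root_.KGOsc.L2.norm_le_of_bound {w : L2} {R K : ℝ} (hR : 0 < R) (hK : 0 ≤ K)
    (h : ∀ᵐ x ∂volume, ‖w x‖ ≤ (Icc (-R) R).indicator (fun _ => K) x) :
    ‖w‖ ≤ K * √(2 * R) := by
  refine abs_le_of_sq_le_sq' ?_ (by positivity) |>.2
  rw [← L2.integral_norm_sq, mul_pow, Real.sq_sqrt (by positivity)]
  have h1 : ∫ x, (Icc (-R) R).indicator (fun _ => K ^ 2) x = K ^ 2 * (2 * R) := by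
    rw [integral_indicator measurableSet_Icc, setIntegral_const, Real.volume_real_Icc,
      max_eq_left (by linarith), smul_eq_mul]
    ring
  rw [← h1]
  refine integral_mono_ae (L2.integrable_norm_sq w)
    ((integrable_indicator_iff measurableSet_Icc).2 (integrableOn_const (by simp))) ?_
  filter_upwards [h] with x hx
  by_cases hxR : x ∈ Icc (-R) R
  · rw [indicator_of_mem hxR] at hx ⊢
    exact pow_le_pow_left₀ (norm_nonneg _) hx 2
  · rw [indicator_of_notMem hxR] at hx ⊢
    have : ‖w x‖ = 0 := le_antisymm hx (norm_nonneg _)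
    rw [this]; norm_num

lemma uniform_time (h : IsTest φ) {c : ℝ} (hc : 0 < c) :
    ∃ δ > 0, ∀ x s t, |s - t| < δ → |φ (x, s) - φ (x, t)| ≤ c := by
  have hu := h.compact.uniformContinuous_of_continuous h.smooth.continuous
  obtain ⟨δ, hδ, hd⟩ := Metric.uniformContinuous_iff.1 hu c hc
  refine ⟨δ, hδ, fun x s t hst => ?_⟩
  have := hd (a := (x, s)) (b := (x, t)) (by
    rw [Prod.dist_eq, dist_self, max_eq_right dist_nonneg, Real.dist_eq]; exact hst)
  rw [Real.dist_eq] at this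
  exact this.le

lemma indicator_bound {R K : ℝ} {x : ℝ} {z : ℂ} (h1 : ‖z‖ ≤ K) (h2 : R < |x| → z = 0) :
    ‖z‖ ≤ (Icc (-R) R).indicator (fun _ => K) x := by
  by_cases hx : x ∈ Icc (-R) R
  · rwa [indicator_of_mem hx]
  · rw [indicator_of_notMem hx, h2, norm_zero]
    by_contra hle
    exact hx (abs_le.1 (not_lt.1 hle))

/-- Uniform continuity in time, on a support of bounded width, passes from the supremum norm to the
`L²` norm. -/
lemma continuous_slice (h : IsTest φ) : Continuous fun t => (h.slice t).1.1 := by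
  obtain ⟨R, hR0, hR⟩ := h.exists_radius
  rw [Metric.continuous_iff]
  intro t e he
  have hc : 0 < e / 2 / √(2 * R) := by positivity
  obtain ⟨δ, hδ, hd⟩ := h.uniform_time hc
  refine ⟨δ, hδ, fun s hs => ?_⟩
  rw [Real.dist_eq] at hs
  rw [dist_eq_norm]
  refine (L2.norm_le_of_bound hR0 hc.le ?_).trans_lt (?_ : _ < e)
  · filter_upwards [Lp.coeFn_sub (h.slice s).1.1 (h.slice t).1.1, h.slice_ae s, h.slice_ae t]
      with x h1 h2 h3
    rw [h1, Pi.sub_apply, h2, h3]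
    refine indicator_bound ?_ fun hx => ?_
    · rw [← Complex.ofReal_sub, Complex.norm_real]
      exact hd x s t hs
    · rw [hR x s (Or.inl hx), hR x t (Or.inl hx), sub_self]
  · rw [div_mul_cancel₀ _ (by positivity)]
    linarith

lemma hasDerivAt_slice (h : IsTest φ) (t : ℝ) :
    HasDerivAt (fun t => (h.slice t).1.1) (h.dt.slice t).1.1 t := by
  obtain ⟨R, hR0, hR⟩ := h.exists_radius
  obtain ⟨R', hR0', hR'⟩ := h.dt.exists_radius
  -- One interval carrying the slices of both `φ` and its time derivative.
  set M := max R R' with hM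
  have hM0 : 0 < M := lt_max_of_lt_left hR0
  rw [hasDerivAt_iff_isLittleO, Asymptotics.isLittleO_iff]
  intro e he
  have hc : 0 < e / √(2 * M) := by positivity
  obtain ⟨δ, hδ, hd⟩ := h.dt.uniform_time hc
  filter_upwards [Metric.ball_mem_nhds t hδ] with s hs
  have hnn : 0 ≤ e / √(2 * M) * |s - t| := by positivity
  refine (L2.norm_le_of_bound hM0 hnn ?_).trans_eq ?_
  · filter_upwards [Lp.coeFn_sub ((h.slice s).1.1 - (h.slice t).1.1)
      ((s - t) • (h.dt.slice t).1.1), Lp.coeFn_sub (h.slice s).1.1 (h.slice t).1.1,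
      Lp.coeFn_smul (s - t) (h.dt.slice t).1.1, h.slice_ae s, h.slice_ae t, h.dt.slice_ae t]
      with x h1 h2 h3 h4 h5 h6
    rw [h1, Pi.sub_apply, h2, Pi.sub_apply, h3, Pi.smul_apply, h4, h5, h6]
    refine indicator_bound ?_ fun hx => ?_
    · have hmv := Convex.norm_image_sub_le_of_norm_hasDerivWithin_le
        (f := fun r => φ (x, r) - r * KGOsc.dt φ (x, t))
        (f' := fun r => KGOsc.dt φ (x, r) - 1 * KGOsc.dt φ (x, t)) (s := Metric.ball t δ)
        (x := t) (y := s) (C := e / √(2 * M))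
        (fun r _ => ((h.hasDerivAt_dt x r).sub
          ((hasDerivAt_id' r).mul_const (KGOsc.dt φ (x, t)))).hasDerivWithinAt)
        (fun r hr => by
          rw [one_mul]
          exact hd x r t (by rwa [Metric.mem_ball, Real.dist_eq] at hr))
        (convex_ball t δ) (Metric.mem_ball_self hδ) hs
      rw [Complex.real_smul, ← Complex.ofReal_sub, ← Complex.ofReal_mul, ← Complex.ofReal_sub,
        Complex.norm_real]
      calc _ = ‖φ (x, s) - s * KGOsc.dt φ (x, t) - (φ (x, t) - t * KGOsc.dt φ (x, t))‖ := by
            congr 1; ring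
        _ ≤ _ := hmv
    · have hx1 : R < |x| := (le_max_left _ _).trans_lt hx
      have hx2 : R' < |x| := (le_max_right _ _).trans_lt hx
      rw [hR x s (Or.inl hx1), hR x t (Or.inl hx1), hR' x t (Or.inl hx2)]
      simp
  · rw [Real.norm_eq_abs]
    have : √(2 * M) ≠ 0 := by positivity
    field_simp

lemma integrable_inner_slice (h : IsTest φ) {w : ℝ → L2} (hw : Continuous w) :
    Integrable fun t => ⟪(h.slice t).1.1, w t⟫ := by
  obtain ⟨R, -, hR⟩ := h.exists_radius
  refine (h.continuous_slice.inner hw).integrable_of_hasCompactSupport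
    (HasCompactSupport.intro (isCompact_Icc (a := -R) (b := R)) fun t ht => ?_)
  rw [h.slice_eq_zero hR, inner_zero_left]
  by_contra hle
  exact ht (abs_le.1 (not_lt.1 hle))

lemma integrable_time (h : IsTest φ) (X : ℝ) {f : ℝ → ℂ} (hf : Continuous f) :
    Integrable fun t => φ (X, t) • f t := by
  obtain ⟨R, -, hR⟩ := h.exists_radius
  have hc : Continuous fun t => φ (X, t) := h.smooth.continuous.comp (by fun_prop)
  refine (hc.smul hf).integrable_of_hasCompactSupport
    (HasCompactSupport.intro (isCompact_Icc (a := -R) (b := R)) fun t ht => ?_)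
  change φ (X, t) • f t = 0
  rw [hR X t, zero_smul]
  by_contra! hle
  exact ht (abs_le.1 hle.2)

end IsTest

/-! ### Mild solutions solve the system in the sense of distributions -/

/-- The nonlinear problem in mild form. -/
def IsMildSol {N : ℕ} (m : ℝ) (X : Fin N → ℝ) (F : Fin N → ℂ → ℂ) (Ψ : ℝ → Phase) : Prop :=
  ∃ f : Fin N → C(ℝ, ℂ), (∀ J t, f J t = F J ((Ψ t).psiAt (X J))) ∧
    IsMild X (fun t => -((m : ℂ) ^ 2) • (Ψ t).psi) f Ψ

/-- Both identities say that the time derivative of a compactly supported pairing `⟪φ(·, t), ·⟫`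
integrates to zero. -/
lemma IsMildSol.solvesSystem {N : ℕ} {m : ℝ} {X : Fin N → ℝ} {F : Fin N → ℂ → ℂ}
    {Ψ : ℝ → Phase} (h : IsMildSol m X F Ψ) : SolvesSystem m X F Ψ := by
  obtain ⟨f, hf, hm⟩ := h
  intro φ hφ hc
  have hT : IsTest φ := ⟨hφ, hc⟩
  have hψ : Continuous fun t => (Ψ t).psi := continuous_psi.comp hm.continuous
  have hπ : Continuous fun t => (Ψ t).mom := continuous_mom.comp hm.continuous
  constructor
  · simp_rw [← hT.inner_slice, ← hT.dt.inner_slice]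
    have hd : ∀ t, HasDerivAt (fun t => ⟪(hT.slice t).1.1, (Ψ t).psi⟫)
        (⟪(hT.slice t).1.1, (Ψ t).mom⟫ + ⟪(hT.dt.slice t).1.1, (Ψ t).psi⟫) t := fun t =>
      (hT.hasDerivAt_slice t).inner ℂ (hm.hasDerivAt_psi t)
    have h0 := integral_eq_zero_of_hasDerivAt_of_integrable hd
      ((hT.integrable_inner_slice hπ).add (hT.dt.integrable_inner_slice hψ))
      (hT.integrable_inner_slice hψ)
    rw [integral_add (hT.integrable_inner_slice hπ) (hT.dt.integrable_inner_slice hψ)] at h0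
    exact (eq_neg_of_add_eq_zero_left h0).symm
  · simp_rw [← hT.dt.inner_slice]
    have hx : ∀ t, ∫ x, (dx (dx φ) (x, t) - m ^ 2 * φ (x, t)) • (Ψ t).psi x
        = ⟪(hT.dx.dx.slice t).1.1, (Ψ t).psi⟫ - (m : ℂ) ^ 2 * ⟪(hT.slice t).1.1, (Ψ t).psi⟫ := by
      intro t
      rw [hT.inner_slice, hT.dx.dx.inner_slice, ← integral_const_mul, ← integral_sub]
      · refine integral_congr_ae (Eventually.of_forall fun x => ?_)
        simp only [Complex.real_smul]
        push_cast
        ring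
      · exact integrable_test_smul (hT.dx.dx.slice_smooth t).continuous (hT.dx.dx.slice_compact t) _
      · exact (integrable_test_smul (hT.slice_smooth t).continuous (hT.slice_compact t) _).const_mul _
    simp_rw [hx, ← hf]
    have hd : ∀ t, HasDerivAt (fun t => ⟪(hT.slice t).1.1, (Ψ t).mom⟫)
        (⟪(hT.dt.slice t).1.1, (Ψ t).mom⟫ +
          ((⟪(hT.dx.dx.slice t).1.1, (Ψ t).psi⟫ - (m : ℂ) ^ 2 * ⟪(hT.slice t).1.1, (Ψ t).psi⟫)
            + ∑ J, φ (X J, t) • f J t)) t := by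
      intro t
      convert hasDerivAt_inner_of_weak (hT.hasDerivAt_slice t) hπ.continuousAt
        (hm.hasDerivAt_inner_mom (hT.slice t) t) using 2
      -- The momentum equation carries one derivative on the slice and one on `ψ`; the
      -- distributional form needs both on the slice.
      have hw := hasWeakDeriv_iff.1 ((Ψ t).1.2 : HasWeakDeriv (Ψ t).psi (Ψ t).dpsi) _
        (hT.dx.slice_smooth t) (hT.dx.slice_compact t)
      have hw' : ⟪(hT.dx.dx.slice t).1.1, (Ψ t).psi⟫ = -⟪(hT.dx.slice t).1.1, (Ψ t).dpsi⟫ := hw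
      rw [hw', hT.slice_snd, inner_smul_right, ← add_assoc]
      congr 1
      · ring
      · refine Finset.sum_congr rfl fun J _ => ?_
        rw [IsTest.slice, H1.eval_ofTest, Complex.conj_ofReal, Complex.real_smul, mul_comm]
    have i1 := hT.dt.integrable_inner_slice hπ
    have i2 := hT.dx.dx.integrable_inner_slice hψ
    have i3 := (hT.integrable_inner_slice hψ).const_mul ((m : ℂ) ^ 2)
    have i4 : ∀ J, Integrable fun t => φ (X J, t) • f J t := fun J =>
      hT.integrable_time (X J) (f J).continuous
    have i5 : Integrable fun t => ∑ J, φ (X J, t) • f J t := integrable_finsetSum _ fun J _ => i4 J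
    have i6 : Integrable fun t => ⟪(hT.dx.dx.slice t).1.1, (Ψ t).psi⟫
        - (m : ℂ) ^ 2 * ⟪(hT.slice t).1.1, (Ψ t).psi⟫ := i2.sub i3
    have i7 : Integrable fun t => ⟪(hT.dx.dx.slice t).1.1, (Ψ t).psi⟫
        - (m : ℂ) ^ 2 * ⟪(hT.slice t).1.1, (Ψ t).psi⟫ + ∑ J, φ (X J, t) • f J t := i6.add i5
    have h0 := integral_eq_zero_of_hasDerivAt_of_integrable hd (i1.add i7)
      (hT.integrable_inner_slice hπ)
    rw [integral_add i1 i7, integral_add i6 i5,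
      integral_finsetSum _ fun J _ => i4 J] at h0
    exact (eq_neg_of_add_eq_zero_right h0).symm

end KGOsc

end

noncomputable section

namespace KGOsc

local notation "⟪" u ", " v "⟫" => inner ℂ u v

/-! ### Solutions in the sense of distributions are mild -/

lemma continuous_psiAt (x : ℝ) : Continuous fun Ψ : Phase => Ψ.psiAt x :=
  (H1.evalL x).continuous.comp continuous_fst

/-! ### Test functions moving along characteristics -/

section travelling

variable {η θ : ℝ → ℝ} (ε : ℝ)

/-- Such products separate the moving coordinate from time, so a distributional identity on the
plane becomes a one-dimensional weak derivative in `t`. -/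
lemma isTest_travelling (hη : ContDiff ℝ ∞ η) (hηc : HasCompactSupport η)
    (hθ : ContDiff ℝ ∞ θ) (hθc : HasCompactSupport θ) :
    IsTest fun p : ℝ × ℝ => η (p.1 + ε * p.2) * θ p.2 := by
  refine ⟨(hη.comp (contDiff_fst.add (contDiff_const.mul contDiff_snd))).mul
    (hθ.comp contDiff_snd), ?_⟩
  obtain ⟨R, hR, hRη⟩ := exists_radius hηc
  obtain ⟨S, hS, hSθ⟩ := exists_radius hθc
  refine HasCompactSupport.intro
    ((isCompact_Icc (a := -(R + |ε| * S)) (b := R + |ε| * S)).prod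
      (isCompact_Icc (a := -S) (b := S))) fun p hp => ?_
  by_contra hne
  have h1 : |p.2| < S := by
    by_contra! hle
    exact hne (by simp only [image_eq_zero_of_notMem_tsupport (hSθ _ hle), mul_zero])
  have h2 : |p.1 + ε * p.2| < R := by
    by_contra! hle
    exact hne (by simp only [image_eq_zero_of_notMem_tsupport (hRη _ hle), zero_mul])
  refine hp ⟨abs_le.1 ?_, abs_le.1 h1.le⟩
  have h3 : |ε * p.2| ≤ |ε| * S := by
    rw [abs_mul]
    exact mul_le_mul_of_nonneg_left h1.le (abs_nonneg _)
  calc |p.1| = |(p.1 + ε * p.2) - ε * p.2| := by ring_nf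
    _ ≤ |p.1 + ε * p.2| + |ε * p.2| := abs_sub _ _
    _ ≤ R + |ε| * S := by linarith

lemma dx_travelling (hη : ContDiff ℝ ∞ η) :
    dx (fun p : ℝ × ℝ => η (p.1 + ε * p.2) * θ p.2)
      = fun p => deriv η (p.1 + ε * p.2) * θ p.2 := by
  ext p
  have h1 : HasDerivAt η (deriv η (p.1 + ε * p.2)) (p.1 + ε * p.2) :=
    (hη.differentiable (by simp) _).hasDerivAt
  exact ((h1.comp_add_const p.1 (ε * p.2)).mul_const (θ p.2)).deriv

lemma dt_travelling (hη : ContDiff ℝ ∞ η) (hθ : ContDiff ℝ ∞ θ) :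
    dt (fun p : ℝ × ℝ => η (p.1 + ε * p.2) * θ p.2)
      = fun p => deriv η (p.1 + ε * p.2) * (ε * θ p.2) + η (p.1 + ε * p.2) * deriv θ p.2 := by
  ext p
  have h1 : HasDerivAt η (deriv η (p.1 + ε * p.2)) (p.1 + ε * p.2) :=
    (hη.differentiable (by simp) _).hasDerivAt
  have h2 : HasDerivAt (fun t => p.1 + ε * t) ε p.2 := by
    simpa using ((hasDerivAt_id' p.2).const_mul ε).const_add p.1
  have h3 : HasDerivAt θ (deriv θ p.2) p.2 := (hθ.differentiable (by simp) _).hasDerivAt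
  have h4 := ((h1.comp p.2 h2).mul h3).deriv
  simp only [dt]
  refine (Eq.trans ?_ h4).trans ?_
  · rfl
  · simp only [Function.comp]; ring

/-- The pairing of a travelling test function with a curve of square integrable functions. -/
def pair (η : ℝ → ℝ) (w : ℝ → L2) (t : ℝ) : ℂ := ∫ x, η (x + ε * t) • w t x

lemma integrable_comp_smul (hη : Continuous η) (hηc : HasCompactSupport η) (c : ℝ) (w : L2) :
    Integrable fun x => η (x + c) • w x :=
  integrable_test_smul (hη.comp (by fun_prop)) (hηc.comp_homeomorph (Homeomorph.addRight c)) w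

/-- Pairing with a moving test function is pairing a fixed one with the curve seen in the moving
frame. -/
lemma pair_eq (hη : Continuous η) (hηc : HasCompactSupport η) (w : ℝ → L2) (t : ℝ) :
    pair ε η w t = ⟪testL2 hη hηc, tau (-(ε * t)) (w t)⟫ := by
  rw [inner_testL2, integral_smul_tau, pair]
  simp_rw [sub_neg_eq_add]

lemma continuous_pair (hη : Continuous η) (hηc : HasCompactSupport η) {w : ℝ → L2}
    (hw : Continuous w) : Continuous (pair ε η w) := by
  rw [funext (pair_eq ε hη hηc w)]
  exact continuous_const.inner (continuous_tau (by fun_prop) hw)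

lemma integral_travelling (a : ℝ) (t : ℝ) (w : ℝ → L2) :
    ∫ x, (η (x + ε * t) * a) • w t x = a • pair ε η w t := by
  rw [pair, ← integral_smul]
  refine integral_congr_ae (Eventually.of_forall fun x => ?_)
  simp only [mul_comm _ a, mul_smul]

lemma integrable_test_smul' (hθ : Continuous θ) (hθc : HasCompactSupport θ) {u : ℝ → ℂ}
    (hu : Continuous u) : Integrable fun t => θ t • u t :=
  (hθ.smul hu).integrable_of_hasCompactSupport hθc.smul_right

lemma integral_dt_travelling (hη : ContDiff ℝ ∞ η) (hηc : HasCompactSupport η)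
    (hθ : ContDiff ℝ ∞ θ) (hθc : HasCompactSupport θ) {w : ℝ → L2} (hw : Continuous w) :
    ∫ t, ∫ x, dt (fun p : ℝ × ℝ => η (p.1 + ε * p.2) * θ p.2) (x, t) • w t x
      = ε * (∫ t, θ t • pair ε (deriv η) w t) + ∫ t, deriv θ t • pair ε η w t := by
  have h1 : ∀ t, ∫ x, dt (fun p : ℝ × ℝ => η (p.1 + ε * p.2) * θ p.2) (x, t) • w t x
      = ε * (θ t • pair ε (deriv η) w t) + deriv θ t • pair ε η w t := by
    intro t
    rw [dt_travelling ε hη hθ]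
    simp only [add_smul]
    rw [integral_add, integral_travelling, integral_travelling, mul_smul, Complex.real_smul]
    · simp_rw [mul_comm (deriv η _), mul_smul]
      exact ((integrable_comp_smul (continuous_deriv_test hη) hηc.deriv _ _).smul (θ t)).smul ε
    · simp_rw [mul_comm (η _), mul_smul]
      exact (integrable_comp_smul hη.continuous hηc _ _).smul _
  simp_rw [h1]
  rw [integral_add, integral_const_mul]
  · exact (integrable_test_smul' hθ.continuous hθc
      (continuous_pair ε (continuous_deriv_test hη) hηc.deriv hw)).const_mul _
  · exact integrable_test_smul' (continuous_deriv_test hθ) hθc.deriv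
      (continuous_pair ε hη.continuous hηc hw)

end travelling

/-! ### From the distributional system to Duhamel's formula -/

section distribution

variable {N : ℕ} {m : ℝ} {X : Fin N → ℝ} {F : Fin N → ℂ → ℂ} {Ψ : ℝ → Phase}

lemma SolvesSystem.psi_travelling (h : SolvesSystem m X F Ψ) (hΨ : Continuous Ψ) (ε : ℝ)
    {η θ : ℝ → ℝ} (hη : ContDiff ℝ ∞ η) (hηc : HasCompactSupport η)
    (hθ : ContDiff ℝ ∞ θ) (hθc : HasCompactSupport θ) :
    -(ε * (∫ t, θ t • pair ε (deriv η) (fun t => (Ψ t).psi) t)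
        + ∫ t, deriv θ t • pair ε η (fun t => (Ψ t).psi) t)
      = ∫ t, θ t • pair ε η (fun t => (Ψ t).mom) t := by
  have hT := isTest_travelling ε hη hηc hθ hθc
  have h1 := (h _ hT.smooth hT.compact).1
  rw [integral_dt_travelling ε hη hηc hθ hθc (w := fun t => (Ψ t).psi)
    (continuous_psi.comp hΨ)] at h1
  rw [h1]
  exact integral_congr_ae (Eventually.of_forall fun t =>
    integral_travelling ε (θ t) t fun t => (Ψ t).mom)

lemma SolvesSystem.mom_travelling (h : SolvesSystem m X F Ψ) (hΨ : Continuous Ψ)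
    (ε : ℝ) {η θ : ℝ → ℝ} (hη : ContDiff ℝ ∞ η)
    (hηc : HasCompactSupport η) (hθ : ContDiff ℝ ∞ θ) (hθc : HasCompactSupport θ) :
    -(ε * (∫ t, θ t • pair ε (deriv η) (fun t => (Ψ t).mom) t)
        + ∫ t, deriv θ t • pair ε η (fun t => (Ψ t).mom) t)
      = (∫ t, θ t • pair ε (deriv (deriv η)) (fun t => (Ψ t).psi) t)
        - m ^ 2 * (∫ t, θ t • pair ε η (fun t => (Ψ t).psi) t)
        + ∑ J, ∫ t, θ t • (η (X J + ε * t) • F J ((Ψ t).psiAt (X J))) := by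
  have hT := isTest_travelling ε hη hηc hθ hθc
  have hψ : Continuous fun t => (Ψ t).psi := continuous_psi.comp hΨ
  have h1 := (h _ hT.smooth hT.compact).2
  rw [integral_dt_travelling ε hη hηc hθ hθc (w := fun t => (Ψ t).mom)
    (continuous_mom.comp hΨ)] at h1
  rw [h1, dx_travelling ε hη, dx_travelling ε (contDiff_deriv_test hη)]
  have hη2 := contDiff_deriv_test hη
  congr 1
  · have h2 : ∀ t, ∫ x, (deriv (deriv η) (x + ε * t) * θ t
        - m ^ 2 * (η (x + ε * t) * θ t)) • (Ψ t).psi x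
        = θ t • pair ε (deriv (deriv η)) (fun t => (Ψ t).psi) t
          - m ^ 2 * (θ t • pair ε η (fun t => (Ψ t).psi) t) := by
      intro t
      simp_rw [sub_smul]
      rw [integral_sub, integral_travelling ε (θ t) t fun t => (Ψ t).psi]
      · simp_rw [mul_smul (m ^ 2)]
        rw [integral_smul, integral_travelling ε (θ t) t fun t => (Ψ t).psi,
          Complex.real_smul (x := m ^ 2)]
        push_cast
        rfl
      · simp_rw [mul_comm _ (θ t), mul_smul]
        exact (integrable_comp_smul (continuous_deriv_test hη2) hηc.deriv.deriv _ _).smul _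
      · simp_rw [mul_comm _ (θ t), mul_smul]
        exact ((integrable_comp_smul hη.continuous hηc _ _).smul _).smul _
    simp_rw [h2]
    rw [integral_sub, integral_const_mul]
    · exact integrable_test_smul' hθ.continuous hθc
        (continuous_pair ε (continuous_deriv_test hη2) hηc.deriv.deriv hψ)
    · exact (integrable_test_smul' hθ.continuous hθc
        (continuous_pair ε hη.continuous hηc hψ)).const_mul _
  · refine Finset.sum_congr rfl fun J _ => integral_congr_ae (Eventually.of_forall fun t => ?_)
    simp only [mul_comm (η _), mul_smul]

lemma pair_deriv_psi {η : ℝ → ℝ} (hη : ContDiff ℝ ∞ η) (hηc : HasCompactSupport η) (ε t : ℝ) :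
    pair ε (deriv η) (fun t => (Ψ t).psi) t = -pair ε η (fun t => (Ψ t).dpsi) t := by
  have h := ((Ψ t).1.2 : HasWeakDeriv (Ψ t).psi (Ψ t).dpsi) (fun x => η (x + ε * t))
    (hη.comp (contDiff_id.add contDiff_const)) (hηc.comp_homeomorph (Homeomorph.addRight _))
  simp_rw [deriv_comp_add_const] at h
  exact h

/-- The case of speed `0`: with `η(x)θ(t)` as test function, `⟪η, π⟫` is the weak time derivative of
the continuous function `⟪η, ψ⟫`. -/
lemma SolvesSystem.psi_eq (h : SolvesSystem m X F Ψ) (hΨ : Continuous Ψ) (t : ℝ) :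
    (Ψ t).psi = (Ψ 0).psi + ∫ s in (0 : ℝ)..t, (Ψ s).mom := by
  have hψ : Continuous fun t => (Ψ t).psi := continuous_psi.comp hΨ
  have hπ : Continuous fun t => (Ψ t).mom := continuous_mom.comp hΨ
  refine L2.ext_of_ofTest fun η hη hηc => ?_
  set T := H1.ofTest hη hηc
  have hp : ∀ w : ℝ → L2, pair 0 η w = fun t => ⟪T.1.1, w t⟫ := fun w => by
    ext t
    rw [pair_eq 0 hη.continuous hηc, zero_mul, neg_zero, tau_zero]
    rfl
  have hw : HasWeakDeriv (fun t => ⟪T.1.1, (Ψ t).psi⟫) fun t => ⟪T.1.1, (Ψ t).mom⟫ := by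
    intro θ hθ hθc
    have h1 := h.psi_travelling hΨ 0 hη hηc hθ hθc
    rw [hp, hp, Complex.ofReal_zero, zero_mul, zero_add] at h1
    rw [← h1, neg_neg]
  have h2 := hw.sub_eq_intervalIntegral (continuous_const.inner hψ)
    (continuous_const.inner hπ).locallyIntegrable t 0
  have h3 : ∫ s in (0 : ℝ)..t, ⟪T.1.1, (Ψ s).mom⟫ = ⟪T.1.1, ∫ s in (0 : ℝ)..t, (Ψ s).mom⟫ :=
    (innerSL ℂ T.1.1).intervalIntegral_comp_comm (hπ.intervalIntegrable _ _)
  rw [inner_add_right, ← h3, ← h2]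
  ring

/-- In the moving frame, the characteristic variable and the profile have, against each `η`, the
same continuous weak time derivative `Q` and the same initial value. This is what gives uniqueness
among all distributional solutions that are continuous in the energy space. -/
lemma SolvesSystem.isMildSol (h : SolvesSystem m X F Ψ) (hF : ∀ J, Continuous (F J))
    (hΨ : Continuous Ψ) : IsMildSol m X F Ψ := by
  have hψ : Continuous fun t => (Ψ t).psi := continuous_psi.comp hΨ
  have hπ : Continuous fun t => (Ψ t).mom := continuous_mom.comp hΨ
  have hdψ : Continuous fun t => (Ψ t).dpsi := continuous_dpsi.comp hΨ
  let f : Fin N → C(ℝ, ℂ) := fun J =>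
    ⟨fun t => F J ((Ψ t).psiAt (X J)), (hF J).comp ((continuous_psiAt (X J)).comp hΨ)⟩
  have hg : Continuous fun t => -((m : ℂ) ^ 2) • (Ψ t).psi := hψ.const_smul (-((m : ℂ) ^ 2))
  refine ⟨f, fun J t => rfl, hΨ, hg, h.psi_eq hΨ, fun ε hε t => ?_⟩
  suffices hs : tau (-(ε * t)) ((Ψ t).char ε)
      = profile hε X (fun t => -((m : ℂ) ^ 2) • (Ψ t).psi) f ((Ψ 0).char ε) t by
    rw [travel, ← hs, tau_tau, add_neg_cancel, tau_zero]
  have hεε : (ε : ℂ) * ε = 1 := by rcases hε with rfl | rfl <;> norm_num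
  refine L2.ext_of_ofTest fun η hη hηc => ?_
  set T := H1.ofTest hη hηc
  have hp : ∀ w : ℝ → L2, pair ε η w = fun t => ⟪T.1.1, tau (-(ε * t)) (w t)⟫ := fun w =>
    funext (pair_eq ε hη.continuous hηc w)
  set Q : ℝ → ℂ := fun t => ⟪T.1.1, tau (-(ε * t)) (-((m : ℂ) ^ 2) • (Ψ t).psi)⟫
    + ∑ J, f J t * conj (H1.eval T (X J + ε * t)) with hQ
  have hQc : Continuous Q := by
    refine (continuous_const.inner (continuous_tau_force ε hg)).add
      (continuous_finsetSum _ fun J _ => (f J).continuous.mul ?_)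
    exact Complex.continuous_conj.comp ((H1.continuous_eval T).comp (by fun_prop))
  have hP : Continuous fun t => ⟪T.1.1, tau (-(ε * t)) ((Ψ t).char ε)⟫ :=
    continuous_const.inner (continuous_tau_force ε (hπ.add (hdψ.const_smul (ε : ℂ))))
  have hP' : ∀ t, ⟪T.1.1, tau (-(ε * t)) ((Ψ t).char ε)⟫
      = pair ε η (fun t => (Ψ t).mom) t + ε * pair ε η (fun t => (Ψ t).dpsi) t := by
    intro t
    rw [hp, hp, Phase.char, map_add, map_smul, inner_add_right, inner_smul_right]
  have hQ' : ∀ t, Q t = -(m ^ 2 * pair ε η (fun t => (Ψ t).psi) t)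
      + ∑ J, η (X J + ε * t) • F J ((Ψ t).psiAt (X J)) := by
    intro t
    simp only [hQ]
    rw [hp, map_smul, inner_smul_right, neg_mul]
    congr 1
    refine Finset.sum_congr rfl fun J _ => ?_
    rw [H1.eval_ofTest, Complex.conj_ofReal, Complex.real_smul, mul_comm]
    rfl
  have hw : HasWeakDeriv (fun t => ⟪T.1.1, tau (-(ε * t)) ((Ψ t).char ε)⟫) Q := by
    intro θ hθ hθc
    have c0 : ∀ {w : ℝ → L2}, Continuous w → Continuous (pair ε η w) := fun hw =>
      continuous_pair ε hη.continuous hηc hw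
    have it : ∀ {u : ℝ → ℂ}, Continuous u → Integrable fun t => θ t • u t := fun hu =>
      integrable_test_smul' hθ.continuous hθc hu
    have it' : ∀ {u : ℝ → ℂ}, Continuous u → Integrable fun t => deriv θ t • u t := fun hu =>
      integrable_test_smul' (continuous_deriv_test hθ) hθc.deriv hu
    -- The equation `ψ̇ = π` is tested with `η'`, the spatial derivative needed to produce `ψ'`; the
    -- momentum equation is tested with `η`.
    have e1 := h.psi_travelling hΨ ε (contDiff_deriv_test hη) hηc.deriv hθ hθc
    have e2 := h.mom_travelling hΨ ε hη hηc hθ hθc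
    simp_rw [pair_deriv_psi hη hηc ε] at e1
    simp only [smul_neg, integral_neg] at e1
    have l1 : ∫ t, deriv θ t • ⟪T.1.1, tau (-(ε * t)) ((Ψ t).char ε)⟫
        = (∫ t, deriv θ t • pair ε η (fun t => (Ψ t).mom) t)
          + ε * ∫ t, deriv θ t • pair ε η (fun t => (Ψ t).dpsi) t := by
      rw [← integral_const_mul, ← integral_add (it' (c0 hπ)) ((it' (c0 hdψ)).const_mul _)]
      refine integral_congr_ae (Eventually.of_forall fun t => ?_)
      simp only [hP', smul_add, mul_smul_comm]
    have hFc : ∀ J, Continuous fun t => η (X J + ε * t) • F J ((Ψ t).psiAt (X J)) := fun J =>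
      (hη.continuous.comp (by fun_prop)).smul (f J).continuous
    have l2 : ∫ t, θ t • Q t = -(m ^ 2 * ∫ t, θ t • pair ε η (fun t => (Ψ t).psi) t)
        + ∑ J, ∫ t, θ t • (η (X J + ε * t) • F J ((Ψ t).psiAt (X J))) := by
      have i1 : Integrable fun t => -((m : ℂ) ^ 2 * θ t • pair ε η (fun t => (Ψ t).psi) t) :=
        ((it (c0 hψ)).const_mul _).neg
      rw [← integral_const_mul, ← integral_neg, ← integral_finsetSum _ fun J _ => it (hFc J),
        ← integral_add i1 (integrable_finsetSum _ fun J _ => it (hFc J))]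
      refine integral_congr_ae (Eventually.of_forall fun t => ?_)
      simp only [hQ', smul_add, smul_neg, mul_smul_comm, Finset.smul_sum]
    rw [l1, l2]
    -- The terms with `η'π` cancel, and so do those with `η''ψ` because `ε² = 1`: the wave operator
    -- factors along the characteristic.
    linear_combination (-1 : ℂ) * e2 + (ε : ℂ) * e1
      + (∫ t, θ t • pair ε (deriv (deriv η)) (fun t => (Ψ t).psi) t) * hεε
  have h2 := hw.sub_eq_intervalIntegral hP hQc.locallyIntegrable t 0
  have h3 := intervalIntegral.integral_eq_sub_of_hasDerivAt
    (fun s _ => hasDerivAt_inner_profile hε X f ((Ψ 0).char ε) hg T s)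
    (hQc.intervalIntegrable 0 t)
  rw [h3] at h2
  simp only [mul_zero, neg_zero, tau_zero, profile_zero] at h2
  linear_combination h2

end distribution

end KGOsc

end

noncomputable section

namespace KGOsc

local notation "⟪" u ", " v "⟫" => inner ℂ u v

/-! ### Bounded variation of traces -/

/-- The indicator of the interval `(x, x + δ]`. -/
def box (x δ : ℝ) : L2 :=
  indicatorConstLp 2 (measurableSet_Ioc (a := x) (b := x + δ)) (by simp) (1 : ℂ)

lemma inner_box (x : ℝ) {δ : ℝ} (hδ : 0 ≤ δ) (w : L2) :
    ⟪box x δ, w⟫ = ∫ y in x..(x + δ), w y := by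
  rw [box, L2.inner_indicatorConstLp_one, intervalIntegral.integral_of_le (by linarith)]

lemma norm_inner_box_le_of_bound (x : ℝ) {δ M : ℝ} (hδ : 0 ≤ δ) {w : L2}
    (hw : ∀ᵐ y ∂volume, ‖w y‖ ≤ M) : ‖⟪box x δ, w⟫‖ ≤ δ * M := by
  rw [inner_box x hδ]
  refine (intervalIntegral.norm_integral_le_of_norm_le_const_ae (C := M) ?_).trans_eq ?_
  · filter_upwards [hw] with y hy _ using hy
  · rw [add_sub_cancel_left, abs_of_nonneg hδ, mul_comm]

lemma H1.norm_tau_ae_le (η : H1) (c : ℝ) : ∀ᵐ y ∂volume, ‖tau c η.1.1 y‖ ≤ ‖η‖ := by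
  filter_upwards [tau_ae c η.1.1, ae_comp_add (H1.ae_eq_eval η) c] with y h1 h2
  rw [h1, h2]
  exact H1.norm_eval_le η _

lemma locallyIntegrable_norm (w : L2) : LocallyIntegrable (fun y => ‖w y‖) volume :=
  fun x => by
    obtain ⟨s, hs, hi⟩ := L2.locallyIntegrable w x
    exact ⟨s, hs, hi.norm⟩

/-- The primitive of the modulus of a square integrable function. -/
def absPrim (w : L2) (z : ℝ) : ℝ := ∫ y in (0 : ℝ)..z, ‖w y‖

lemma intervalIntegrable_norm (w : L2) (a b : ℝ) :
    IntervalIntegrable (fun y => ‖w y‖) volume a b :=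
  ((locallyIntegrable_norm w).integrableOn_isCompact isCompact_uIcc).intervalIntegrable

lemma continuous_absPrim (w : L2) : Continuous (absPrim w) :=
  intervalIntegral.continuous_primitive (intervalIntegrable_norm w) 0

/-- The freely transported initial data need not be bounded pointwise, so their local means are kept
as increments of the primitive of the modulus. -/
lemma norm_inner_box_tau_le (x : ℝ) {δ : ℝ} (hδ : 0 ≤ δ) (c : ℝ) (w : L2) :
    ‖⟪box x δ, tau c w⟫‖ ≤ absPrim w (x + δ + c) - absPrim w (x + c) := by
  rw [inner_box x hδ, absPrim, absPrim, intervalIntegral.integral_interval_sub_left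
    (intervalIntegrable_norm w _ _) (intervalIntegrable_norm w _ _)]
  have h1 : ∫ y in x..(x + δ), tau c w y = ∫ y in x..(x + δ), w (y + c) := by
    refine intervalIntegral.integral_congr_ae ?_
    filter_upwards [tau_ae c w] with y hy _ using hy
  rw [h1, intervalIntegral.integral_comp_add_right (fun y => w y)]
  exact intervalIntegral.norm_integral_le_integral_norm (by linarith)

/-- Values in `H¹` are bounded functions, so this contribution has density at most `T * M`; a merely
square integrable force would not give that. -/
lemma norm_inner_box_integral_le {g : ℝ → L2} (hg : Continuous g) {G : ℝ → H1}
    (hgG : ∀ t, g t = (G t).1.1) {T M : ℝ} (hM : ∀ s ∈ Icc (-T) T, ‖G s‖ ≤ M)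
    (ε x : ℝ) {δ : ℝ} (hδ : 0 ≤ δ) {r : ℝ} (hr : r ∈ Icc (-T) T) (hM0 : 0 ≤ M) :
    ‖⟪box x δ, tau (ε * r) (∫ s in (0 : ℝ)..r, tau (-(ε * s)) (g s))⟫‖ ≤ δ * (T * M) := by
  have hc := continuous_tau_force ε hg
  have h1 : ⟪box x δ, tau (ε * r) (∫ s in (0 : ℝ)..r, tau (-(ε * s)) (g s))⟫
      = ∫ s in (0 : ℝ)..r, ⟪box x δ, tau (ε * r) (tau (-(ε * s)) (g s))⟫ :=
    (((innerSL ℂ (box x δ)).comp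
      (tau (ε * r)).toContinuousLinearMap).intervalIntegral_comp_comm
        (hc.intervalIntegrable 0 r)).symm
  rw [h1]
  have hrT : |r| ≤ T := abs_le.2 hr
  have hT : 0 ≤ T := (abs_nonneg r).trans hrT
  refine (intervalIntegral.norm_integral_le_of_norm_le_const (C := δ * M) fun s hs => ?_).trans ?_
  · have hs' : s ∈ Icc (-T) T := by
      have h0 : (0 : ℝ) ∈ Icc (-T) T := ⟨by linarith, hT⟩
      exact (Set.uIcc_subset_Icc h0 hr) (uIoc_subset_uIcc hs)
    rw [tau_tau, hgG]
    refine norm_inner_box_le_of_bound x hδ ?_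
    filter_upwards [H1.norm_tau_ae_le (G s) (ε * r + -(ε * s))] with y hy
    exact hy.trans (hM s hs')
  · rw [sub_zero]
    nlinarith [mul_nonneg hδ hM0]

lemma norm_inner_box_src_le {ε : ℝ} (hε : ε = 1 ∨ ε = -1) (X : ℝ) {f : C(ℝ, ℂ)} {T M : ℝ}
    (hM : ∀ s ∈ Icc (-T) T, ‖f s‖ ≤ M) (hM0 : 0 ≤ M) (x : ℝ) {δ : ℝ} (hδ : 0 ≤ δ) (c : ℝ)
    {r : ℝ} (hr : r ∈ Icc (-T) T) :
    ‖⟪box x δ, tau c (src hε X f 0 r)⟫‖ ≤ δ * M := by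
  refine norm_inner_box_le_of_bound x hδ ?_
  have h1 := norm_src_ae_le hε X f 0 r (M := M) (fun s hs => hM s ?_) hM0
  · filter_upwards [tau_ae c (src hε X f 0 r), ae_comp_add h1 c] with y h2 h3
    rw [h2]
    exact h3
  · have h0 : (0 : ℝ) ∈ Icc (-T) T := by
      have := abs_nonneg r
      have := abs_le.2 hr
      exact ⟨by linarith, by linarith⟩
    exact (Set.uIcc_subset_Icc h0 hr) (uIoc_subset_uIcc hs)

/-- Integrating in time along the line `z + εr` trades the space derivative of the primitive, which
may fail to exist at a given point, for a difference of its values. -/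
lemma hasDerivAt_integral_absPrim (w : L2) {ε : ℝ} (hε : ε = 1 ∨ ε = -1) (s t z : ℝ) :
    HasDerivAt (fun z => ∫ r in s..t, absPrim w (z + ε * r))
      (ε * (absPrim w (z + ε * t) - absPrim w (z + ε * s))) z := by
  have hc := continuous_absPrim w
  have hεε : ε * ε = 1 := by rcases hε with rfl | rfl <;> norm_num
  have hB : ∀ z, HasDerivAt (fun z => ∫ y in (0 : ℝ)..z, absPrim w y) (absPrim w z) z := fun z =>
    intervalIntegral.integral_hasDerivAt_right (hc.intervalIntegrable _ _)
      (hc.stronglyMeasurableAtFilter _ _) hc.continuousAt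
  set B : ℝ → ℝ := fun z => ∫ y in (0 : ℝ)..z, absPrim w y with hBdef
  have h1 : ∀ z, ∫ r in s..t, absPrim w (z + ε * r) = ε * B (z + ε * t) - ε * B (z + ε * s) := by
    intro z
    refine intervalIntegral.integral_eq_sub_of_hasDerivAt (f := fun r => ε * B (z + ε * r))
      (fun r _ => ?_) ((hc.comp (by fun_prop)).intervalIntegrable _ _)
    have h2 : HasDerivAt (fun r => z + ε * r) ε r := by
      simpa using ((hasDerivAt_id' r).const_mul ε).const_add z
    have h3 := ((hB (z + ε * r)).comp r h2).const_mul ε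
    convert! h3 using 1
    rw [mul_comm (absPrim w _), ← mul_assoc, hεε, one_mul]
  simp_rw [h1]
  have h4 : ∀ c, HasDerivAt (fun z => ε * B (z + c)) (ε * absPrim w (z + c)) z := fun c =>
    ((hB (z + c)).comp_add_const z c).const_mul ε
  convert! (h4 (ε * t)).sub (h4 (ε * s)) using 1
  ring

namespace IsMild

variable {N : ℕ} {X : Fin N → ℝ} {g : ℝ → L2} {f : Fin N → C(ℝ, ℂ)} {Ψ : ℝ → Phase}

/-- The momentum is half the sum of two travelling components. Each consists of free transport, kept
exactly, and of distributed and point forces, bounded pointwise on `[-T, T]` and collected in `C`.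
-/
lemma exists_norm_inner_box_mom_le (h : IsMild X g f Ψ) {G : ℝ → H1} (hG : Continuous G)
    (hgG : ∀ t, g t = (G t).1.1) (T : ℝ) :
    ∃ C, ∀ x δ : ℝ, 0 ≤ δ → ∀ r ∈ Icc (-T) T, ‖⟪box x δ, (Ψ r).mom⟫‖ ≤
      1 / 2 * ((absPrim ((Ψ 0).char 1) (x + δ + 1 * r)
          - absPrim ((Ψ 0).char 1) (x + 1 * r))
        + (absPrim ((Ψ 0).char (-1)) (x + δ + -1 * r)
          - absPrim ((Ψ 0).char (-1)) (x + -1 * r))) + δ * C := by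
  obtain ⟨MG, hMG⟩ := (isCompact_Icc (a := -T) (b := T)).exists_bound_of_continuousOn
    hG.continuousOn
  have hfb : ∀ J, ∃ M, 0 ≤ M ∧ ∀ s ∈ Icc (-T) T, ‖f J s‖ ≤ M := fun J => by
    obtain ⟨M, hM⟩ := (isCompact_Icc (a := -T) (b := T)).exists_bound_of_continuousOn
      (f J).continuous.continuousOn
    exact ⟨max M 0, le_max_right _ _, fun s hs => (hM s hs).trans (le_max_left _ _)⟩
  choose M hM0 hM using hfb
  refine ⟨T * max MG 0 + ∑ J, M J, fun x δ hδ r hr => ?_⟩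
  have key : ∀ (ε : ℝ) (hε : ε = 1 ∨ ε = -1), ‖⟪box x δ, (Ψ r).char ε⟫‖ ≤
      (absPrim ((Ψ 0).char ε) (x + δ + ε * r) - absPrim ((Ψ 0).char ε) (x + ε * r))
        + δ * (T * max MG 0 + ∑ J, M J) := by
    intro ε hε
    rw [h.char ε hε, travel, profile, map_add, map_add, map_sum, inner_add_right, inner_add_right,
      inner_sum, mul_add, Finset.mul_sum, ← add_assoc]
    refine (norm_add_le _ _).trans (add_le_add ((norm_add_le _ _).trans (add_le_add ?_ ?_)) ?_)
    · exact norm_inner_box_tau_le x hδ _ _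
    · exact norm_inner_box_integral_le h.force hgG
        (fun s hs => (hMG s hs).trans (le_max_left _ _)) ε x hδ hr (le_max_right _ _)
    · exact (norm_sum_le _ _).trans (Finset.sum_le_sum fun J _ =>
        norm_inner_box_src_le hε (X J) (hM J) (hM0 J) x hδ _ hr)
  rw [Phase.mom_eq, inner_smul_right, inner_add_right, norm_mul]
  have h1 := key 1 (Or.inl rfl)
  have h2 := key (-1) (Or.inr rfl)
  have h3 := norm_add_le ⟪box x δ, (Ψ r).char 1⟫ ⟪box x δ, (Ψ r).char (-1)⟫
  have h4 : ‖(1 / 2 : ℂ)‖ = 1 / 2 := by norm_num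
  rw [h4]
  linarith

/-- The trace of a mild solution at a point has locally bounded variation in time. -/
lemma exists_variation_bound (h : IsMild X g f Ψ) {G : ℝ → H1} (hG : Continuous G)
    (hgG : ∀ t, g t = (G t).1.1) (T x : ℝ) :
    ∃ K : ℝ → ℝ, Continuous K ∧ ∀ s t, -T ≤ s → s ≤ t → t ≤ T →
      ‖(Ψ t).psiAt x - (Ψ s).psiAt x‖ ≤ K t - K s := by
  obtain ⟨C, hC⟩ := h.exists_norm_inner_box_mom_le hG hgG T
  set A₁ := absPrim ((Ψ 0).char 1) with hA₁
  set A₂ := absPrim ((Ψ 0).char (-1)) with hA₂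
  have hA₁c : Continuous A₁ := continuous_absPrim _
  have hA₂c : Continuous A₂ := continuous_absPrim _
  -- Formally `K' = ½(|a₊(x + t)| + |a₋(x - t)|) + C`, with `a₊` and `a₋` the initial characteristic
  -- components: the bound that `|π(x, t)|` would satisfy if it had a meaning.
  refine ⟨fun t => 1 / 2 * (1 * A₁ (x + 1 * t) + -1 * A₂ (x + -1 * t)) + C * t,
    by fun_prop, fun s t hs hst ht => ?_⟩
  have hmom : Continuous fun t => (Ψ t).mom := continuous_mom.comp h.continuous
  set k : ℝ → ℂ := fun z => H1.eval (Ψ t).1 z - H1.eval (Ψ s).1 z with hk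
  have hkc : Continuous k := (H1.continuous_eval _).sub (H1.continuous_eval _)
  set E : ℝ → ℂ := fun z => ∫ y in x..z, k y with hE
  have hEd : HasDerivAt E (k x) x := intervalIntegral.integral_hasDerivAt_right
    (hkc.intervalIntegrable _ _) (hkc.stronglyMeasurableAtFilter _ _) hkc.continuousAt
  set D : ℝ → ℝ := fun z => 1 / 2 * ((∫ r in s..t, A₁ (z + 1 * r))
    + ∫ r in s..t, A₂ (z + -1 * r)) with hD
  have hDd : HasDerivAt D (1 / 2 * (1 * (A₁ (x + 1 * t) - A₁ (x + 1 * s))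
      + -1 * (A₂ (x + -1 * t) - A₂ (x + -1 * s)))) x :=
    ((hasDerivAt_integral_absPrim _ (Or.inl rfl) s t x).add
      (hasDerivAt_integral_absPrim _ (Or.inr rfl) s t x)).const_mul (1 / 2)
  have hbound : ∀ δ, 0 < δ → ‖E (x + δ) - E x‖ ≤ (D (x + δ) - D x) + δ * (C * (t - s)) := by
    intro δ hδ
    have hEx : E x = 0 := intervalIntegral.integral_same
    have e1 : E (x + δ) = ⟪box x δ, (Ψ t).psi - (Ψ s).psi⟫ := by
      rw [inner_box x hδ.le]
      refine intervalIntegral.integral_congr_ae ?_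
      filter_upwards [Lp.coeFn_sub (Ψ t).psi (Ψ s).psi, H1.ae_eq_eval (Ψ t).1,
        H1.ae_eq_eval (Ψ s).1] with y h1 h2 h3 _
      rw [h1, Pi.sub_apply]
      simp only [hk, ← h2, ← h3]
      rfl
    have e2 : (Ψ t).psi - (Ψ s).psi = ∫ r in s..t, (Ψ r).mom := by
      rw [h.psi t, h.psi s, add_sub_add_left_eq_sub, intervalIntegral.integral_interval_sub_left
        (hmom.intervalIntegrable _ _) (hmom.intervalIntegrable _ _)]
    have e3 : ⟪box x δ, ∫ r in s..t, (Ψ r).mom⟫ = ∫ r in s..t, ⟪box x δ, (Ψ r).mom⟫ :=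
      ((innerSL ℂ (box x δ)).intervalIntegral_comp_comm (hmom.intervalIntegrable _ _)).symm
    have i1 : ∀ z, IntervalIntegrable (fun r => A₁ (z + 1 * r)) volume s t := fun z =>
      (hA₁c.comp (by fun_prop)).intervalIntegrable _ _
    have i2 : ∀ z, IntervalIntegrable (fun r => A₂ (z + -1 * r)) volume s t := fun z =>
      (hA₂c.comp (by fun_prop)).intervalIntegrable _ _
    have i3 := (((i1 (x + δ)).sub (i1 x)).add ((i2 (x + δ)).sub (i2 x))).const_mul (1 / 2)
    have i4 := i3.add (intervalIntegrable_const (c := δ * C) (μ := volume) (a := s) (b := t))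
    rw [hEx, sub_zero, e1, e2, e3]
    refine (intervalIntegral.norm_integral_le_of_norm_le hst ?_ i4).trans_eq ?_
    · refine Eventually.of_forall fun r hr => hC x δ hδ.le r ⟨by linarith [hr.1], by linarith [hr.2]⟩
    · rw [intervalIntegral.integral_add i3 intervalIntegrable_const,
        intervalIntegral.integral_const_mul,
        intervalIntegral.integral_add ((i1 (x + δ)).sub (i1 x)) ((i2 (x + δ)).sub (i2 x)),
        intervalIntegral.integral_sub (i1 (x + δ)) (i1 x),
        intervalIntegral.integral_sub (i2 (x + δ)) (i2 x), intervalIntegral.integral_const,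
        smul_eq_mul]
      simp only [hD]
      ring
  -- Dividing `hbound` by `δ` and letting the box shrink to `x` turns the mean on the left into the
  -- increment of the trace.
  have l1 := hEd.tendsto_slope_zero_right.norm
  have l2 := hDd.tendsto_slope_zero_right.add_const (C * (t - s))
  have hle := le_of_tendsto_of_tendsto l1 l2 (by
    filter_upwards [self_mem_nhdsWithin] with δ hδ
    have hδ' : (0 : ℝ) < δ := hδ
    rw [norm_smul, norm_inv, Real.norm_eq_abs, abs_of_pos hδ', smul_eq_mul]
    calc δ⁻¹ * ‖E (x + δ) - E x‖ ≤ δ⁻¹ * ((D (x + δ) - D x) + δ * (C * (t - s))) :=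
          mul_le_mul_of_nonneg_left (hbound δ hδ') (inv_pos.2 hδ').le
      _ = δ⁻¹ * (D (x + δ) - D x) + C * (t - s) := by field_simp)
  have hkx : k x = (Ψ t).psiAt x - (Ψ s).psiAt x := rfl
  rw [← hkx]
  linarith

end IsMild

end KGOsc

end

noncomputable section

namespace KGOsc

local notation "⟪" u ", " v "⟫" => inner ℂ u v

/-! ### Steklov averages -/

section steklov

variable {E : Type*} [NormedAddCommGroup E] [NormedSpace ℝ E] [CompleteSpace E]

/-- The average of `w` over the interval from `t` to `t + h`. -/
def steklov (h : ℝ) (w : ℝ → E) (t : ℝ) : E := h⁻¹ • ∫ s in t..(t + h), w s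

lemma hasDerivAt_steklov (h : ℝ) {w : ℝ → E} (hw : Continuous w) (t : ℝ) :
    HasDerivAt (steklov h w) (h⁻¹ • (w (t + h) - w t)) t := by
  have hB : ∀ z, HasDerivAt (fun z => ∫ y in (0 : ℝ)..z, w y) (w z) z := fun z =>
    intervalIntegral.integral_hasDerivAt_right (hw.intervalIntegrable _ _)
      (hw.stronglyMeasurableAtFilter _ _) hw.continuousAt
  have e : steklov h w = fun t => h⁻¹ • ((∫ y in (0 : ℝ)..(t + h), w y) - ∫ y in (0 : ℝ)..t, w y) := by
    ext t
    rw [steklov, intervalIntegral.integral_interval_sub_left (hw.intervalIntegrable _ _)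
      (hw.intervalIntegrable _ _)]
  rw [e]
  exact (((hB (t + h)).comp_add_const t h).sub (hB t)).const_smul h⁻¹

/-- Convergence is stated jointly in the step and the time, so that compactness can make it uniform
on time intervals. -/
lemma tendsto_steklov {w : ℝ → E} (hw : Continuous w) (t₀ : ℝ) :
    Tendsto (fun p : ℝ × ℝ => steklov p.1 w p.2) (𝓝[>] 0 ×ˢ 𝓝 t₀) (𝓝 (w t₀)) := by
  rw [Metric.tendsto_nhds]
  intro ε hε
  obtain ⟨r, hr, hball⟩ := Metric.continuousAt_iff.1 (hw.continuousAt (x := t₀)) (ε / 2) (by positivity)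
  have h1 : ∀ᶠ h in 𝓝[>] (0 : ℝ), 0 < h ∧ h < r / 2 :=
    (eventually_mem_nhdsWithin.mono fun h hh => hh).and
      (mem_nhdsWithin_of_mem_nhds (Iio_mem_nhds (by positivity)))
  have h2 : ∀ᶠ t in 𝓝 t₀, dist t t₀ < r / 2 := Metric.ball_mem_nhds _ (by positivity)
  filter_upwards [h1.prod_mk h2] with ⟨h, t⟩ ⟨⟨hh0, hhr⟩, ht⟩
  simp only at hh0 hhr ht
  have e : steklov h w t - w t₀ = h⁻¹ • ∫ s in t..(t + h), (w s - w t₀) := by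
    rw [intervalIntegral.integral_sub (hw.intervalIntegrable _ _) intervalIntegrable_const,
      intervalIntegral.integral_const, add_sub_cancel_left, smul_sub, inv_smul_smul₀ hh0.ne', steklov]
  rw [dist_eq_norm, e, norm_smul, norm_inv, Real.norm_eq_abs, abs_of_pos hh0]
  have h3 : ‖∫ s in t..(t + h), (w s - w t₀)‖ ≤ ε / 2 * |t + h - t| :=
    intervalIntegral.norm_integral_le_of_norm_le_const fun s hs => by
      rw [uIoc_of_le (by linarith)] at hs
      rw [← dist_eq_norm]
      refine (hball ?_).le
      rw [Real.dist_eq, abs_lt] at ht ⊢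
      constructor <;> linarith [hs.1, hs.2]
  rw [add_sub_cancel_left, abs_of_pos hh0] at h3
  calc h⁻¹ * ‖∫ s in t..(t + h), (w s - w t₀)‖ ≤ h⁻¹ * (ε / 2 * h) :=
        mul_le_mul_of_nonneg_left h3 (inv_pos.2 hh0).le
    _ = ε / 2 := by field_simp
    _ < ε := by linarith

lemma tendsto_steklov_left {w : ℝ → E} (hw : Continuous w) (t : ℝ) :
    Tendsto (fun h => steklov h w t) (𝓝[>] 0) (𝓝 (w t)) :=
  (tendsto_steklov hw t).comp (tendsto_id.prodMk (tendsto_const_nhds (x := t)))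

lemma map_steklov {G : Type*} [NormedAddCommGroup G] [NormedSpace ℝ G] [CompleteSpace G]
    (L : E →L[ℝ] G) (h : ℝ) {w : ℝ → E} (hw : Continuous w) (t : ℝ) :
    L (steklov h w t) = steklov h (fun s => L (w s)) t := by
  rw [steklov, steklov, map_smul, L.intervalIntegral_comp_comm (hw.intervalIntegrable _ _)]

end steklov

lemma hasDerivAt_norm_sq_L2 {w : ℝ → L2} {w' : L2} {t : ℝ} (hw : HasDerivAt w w' t) :
    HasDerivAt (fun t => ‖w t‖ ^ 2) (2 * (⟪w t, w'⟫).re) t := by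
  have h1 := Complex.reCLM.hasFDerivAt.comp_hasDerivAt t (hw.inner ℂ hw)
  have e : (fun t => ‖w t‖ ^ 2) = fun t => Complex.reCLM ⟪w t, w t⟫ := by
    ext t
    rw [inner_self_eq_norm_sq_to_K]
    norm_cast
  rw [e]
  refine h1.congr_deriv ?_
  rw [map_add, two_mul]
  congr 1
  exact inner_re_symm (𝕜 := ℂ) _ _

/-! ### The energy as a functional on phase space -/

/-- Half of the squared energy norm. -/
def quadEnergy (m : ℝ) (Ψ : Phase) : ℝ :=
  1 / 2 * (‖Ψ.mom‖ ^ 2 + ‖Ψ.dpsi‖ ^ 2 + m ^ 2 * ‖Ψ.psi‖ ^ 2)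

lemma continuous_quadEnergy (m : ℝ) : Continuous (quadEnergy m) := by
  have := continuous_mom
  have := continuous_dpsi
  have := continuous_psi
  unfold quadEnergy
  fun_prop

lemma hamiltonian_eq {N : ℕ} (m : ℝ) (X : Fin N → ℝ) (U : Fin N → ℂ → ℝ) (Ψ : Phase) :
    hamiltonian m X U Ψ = quadEnergy m Ψ + ∑ J, U J (Ψ.psiAt (X J)) := by
  have i : Integrable fun x => ‖Ψ.mom x‖ ^ 2 + ‖Ψ.dpsi x‖ ^ 2 :=
    (L2.integrable_norm_sq _).add (L2.integrable_norm_sq _)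
  rw [hamiltonian, quadEnergy, integral_add i
    ((L2.integrable_norm_sq _).const_mul _), integral_add (L2.integrable_norm_sq _)
    (L2.integrable_norm_sq _), integral_const_mul, L2.integral_norm_sq, L2.integral_norm_sq,
    L2.integral_norm_sq]

/-- Evaluation at `x` as a real-linear functional on the phase space. -/
def psiAtL (x : ℝ) : Phase →L[ℝ] ℂ :=
  ((H1.evalL x).comp (ContinuousLinearMap.fst ℂ H1 L2)).restrictScalars ℝ

/-- The field as a real-linear map. -/
def psiL : Phase →L[ℝ] L2 :=
  (((ContinuousLinearMap.fst ℂ L2 L2).comp H1.subtypeL).comp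
    (ContinuousLinearMap.fst ℂ H1 L2)).restrictScalars ℝ

/-- The spatial derivative as a real-linear map. -/
def dpsiL : Phase →L[ℝ] L2 :=
  (((ContinuousLinearMap.snd ℂ L2 L2).comp H1.subtypeL).comp
    (ContinuousLinearMap.fst ℂ H1 L2)).restrictScalars ℝ

/-- The momentum as a real-linear map. -/
def momL : Phase →L[ℝ] L2 := (ContinuousLinearMap.snd ℂ H1 L2).restrictScalars ℝ

lemma psiL_apply (Ψ : Phase) : psiL Ψ = Ψ.psi := rfl
-- Energy balance of the time-averaged solution
namespace IsMild

variable {N : ℕ} {X : Fin N → ℝ} {g : ℝ → L2} {f : Fin N → C(ℝ, ℂ)} {Ψ : ℝ → Phase}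

/-- The momentum equation, averaged in time and tested against a Sobolev function. -/
lemma inner_steklov_mom (h : IsMild X g f Ψ) (η : H1) (δ t : ℝ) :
    ⟪η.1.1, δ⁻¹ • ((Ψ (t + δ)).mom - (Ψ t).mom)⟫ = -⟪η.1.2, steklov δ (fun s => (Ψ s).dpsi) t⟫
      + (⟪η.1.1, steklov δ g t⟫ + ∑ J, steklov δ (f J) t * conj (H1.eval η (X J))) := by
  have c1 : Continuous fun s => (Ψ s).dpsi := continuous_dpsi.comp h.continuous
  have cf : ∀ J, Continuous fun s => f J s * conj (H1.eval η (X J)) := fun J =>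
    (f J).continuous.mul continuous_const
  have i1 : IntervalIntegrable (fun s => ⟪η.1.2, (Ψ s).dpsi⟫) volume t (t + δ) :=
    (continuous_const.inner c1).intervalIntegrable _ _
  have i2 : IntervalIntegrable (fun s => ⟪η.1.1, g s⟫) volume t (t + δ) :=
    (continuous_const.inner h.force).intervalIntegrable _ _
  have i3 : IntervalIntegrable (fun s => ∑ J, f J s * conj (H1.eval η (X J))) volume t (t + δ) :=
    (continuous_finsetSum _ fun J _ => cf J).intervalIntegrable _ _
  have j1 : IntervalIntegrable (fun s => -⟪η.1.2, (Ψ s).dpsi⟫) volume t (t + δ) := i1.neg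
  have j2 : IntervalIntegrable (fun s => ⟪η.1.1, g s⟫ + ∑ J, f J s * conj (H1.eval η (X J)))
      volume t (t + δ) := i2.add i3
  have h1 := intervalIntegral.integral_eq_sub_of_hasDerivAt
    (fun s _ => h.hasDerivAt_inner_mom η s) (j1.add j2)
  have l1 : ∀ (v : L2) {w : ℝ → L2}, Continuous w → ⟪v, steklov δ w t⟫
      = δ⁻¹ • ∫ s in t..(t + δ), ⟪v, w s⟫ := fun v w hw =>
    map_steklov ((innerSL ℂ v).restrictScalars ℝ) δ hw t
  rw [l1 _ c1, l1 _ h.force, inner_smul_right_eq_smul, inner_sub_right, ← h1,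
    intervalIntegral.integral_add j1 j2, intervalIntegral.integral_add i2 i3,
    intervalIntegral.integral_neg, intervalIntegral.integral_finsetSum
      (fun J _ => (cf J).intervalIntegrable _ _), smul_add, smul_add, smul_neg, Finset.smul_sum]
  congr 2
  refine Finset.sum_congr rfl fun J _ => ?_
  rw [intervalIntegral.integral_mul_const, steklov, smul_mul_assoc]

/-- The balance of the energy of the averaged solution. -/
lemma hasDerivAt_quadEnergy_steklov {m : ℝ} (h : IsMild X (fun t => -((m : ℂ) ^ 2) • (Ψ t).psi) f Ψ)
    (δ t : ℝ) :
    HasDerivAt (fun t => quadEnergy m (steklov δ Ψ t))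
      (∑ J, steklov δ (f J) t
        * conj (δ⁻¹ • ((Ψ (t + δ)).psiAt (X J) - (Ψ t).psiAt (X J)))).re t := by
  have hS := hasDerivAt_steklov δ h.continuous t
  set D : Phase := δ⁻¹ • (Ψ (t + δ) - Ψ t) with hD
  set S : ℝ → Phase := steklov δ Ψ with hSd
  have d1 := hasDerivAt_norm_sq_L2 (momL.hasFDerivAt.comp_hasDerivAt t hS)
  have d2 := hasDerivAt_norm_sq_L2 (dpsiL.hasFDerivAt.comp_hasDerivAt t hS)
  have d3 := hasDerivAt_norm_sq_L2 (psiL.hasFDerivAt.comp_hasDerivAt t hS)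
  have d4 := ((d1.add d2).add (d3.const_mul (m ^ 2))).const_mul (1 / 2)
  refine d4.congr_deriv ?_
  have cm : Continuous fun s => (Ψ s).mom := continuous_mom.comp h.continuous
  -- Since `ψ̇ = π`, the averaged momentum is the difference quotient of `ψ`. It is therefore in
  -- `H¹` and is an admissible test function, which `π` itself is not.
  have em : momL (S t) = D.1.1.1 := by
    change _ = psiL D
    rw [hSd, map_steklov _ _ h.continuous, hD, map_smul, map_sub, psiL_apply, psiL_apply, steklov,
      ← intervalIntegral.integral_eq_sub_of_hasDerivAt (fun s _ => h.hasDerivAt_psi s)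
        (cm.intervalIntegrable _ _)]
    rfl
  have ed : steklov δ (fun s => (Ψ s).dpsi) t = dpsiL (S t) :=
    (map_steklov dpsiL δ h.continuous t).symm
  have ep : steklov δ (fun t => -((m : ℂ) ^ 2) • (Ψ t).psi) t = -((m : ℂ) ^ 2) • psiL (S t) := by
    rw [map_steklov psiL δ h.continuous t, steklov, intervalIntegral.integral_smul, smul_comm]
    rfl
  -- With this choice the elastic and mass terms cancel the derivatives of the corresponding parts
  -- of the energy; only the power of the point forces survives.
  have key := h.inner_steklov_mom D.1 δ t
  have emom : δ⁻¹ • ((Ψ (t + δ)).mom - (Ψ t).mom) = momL D := by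
    rw [hD, map_smul, map_sub]; rfl
  have eev : ∀ J, H1.eval D.1 (X J) = δ⁻¹ • ((Ψ (t + δ)).psiAt (X J) - (Ψ t).psiAt (X J)) :=
    fun J => by
      change psiAtL (X J) D = _
      rw [hD, map_smul, map_sub]; rfl
  rw [emom, ed, ep, inner_smul_right] at key
  simp_rw [eev] at key
  have key' := congrArg Complex.re key
  have r2 : (⟪dpsiL (S t), dpsiL D⟫).re = (⟪D.1.1.2, dpsiL (S t)⟫).re :=
    inner_re_symm (𝕜 := ℂ) _ _
  have r3 : (⟪psiL (S t), psiL D⟫).re = (⟪D.1.1.1, psiL (S t)⟫).re :=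
    inner_re_symm (𝕜 := ℂ) _ _
  simp only [Function.comp_apply]
  rw [em, r2, r3]
  rw [Complex.add_re, Complex.add_re, Complex.neg_re] at key'
  have e5 : (-((m : ℂ) ^ 2) * ⟪D.1.1.1, psiL (S t)⟫).re = -(m ^ 2) * (⟪D.1.1.1, psiL (S t)⟫).re := by
    rw [← Complex.re_ofReal_mul]; norm_cast
  rw [e5] at key'
  linarith

end IsMild

/-! ### Conservation laws for the nonlinear problem -/

namespace IsMildSol

variable {N : ℕ} {m : ℝ} {X : Fin N → ℝ} {F : Fin N → ℂ → ℂ} {Ψ : ℝ → Phase}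

/-- Conservation of energy. -/
lemma quadEnergy_add_eq (h : IsMildSol m X F Ψ) (hFc : ∀ J, Continuous (F J)) {U : Fin N → ℂ → ℝ}
    (hU : ∀ J z, HasGradientAt (U J) (-F J z) z) {a b : ℝ} (hab : a ≤ b) :
    quadEnergy m (Ψ b) + ∑ J, U J ((Ψ b).psiAt (X J))
      = quadEnergy m (Ψ a) + ∑ J, U J ((Ψ a).psiAt (X J)) := by
  obtain ⟨f, hf, hm⟩ := h
  have hΨ := hm.continuous
  have hUc : ∀ J, Continuous (U J) := fun J =>
    continuous_iff_continuousAt.2 fun z => (hU J z).hasFDerivAt.continuousAt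
  have hyc : ∀ J, Continuous fun s => (Ψ s).psiAt (X J) := fun J =>
    (continuous_psiAt (X J)).comp hΨ
  -- The extra unit leaves room for averages that look ahead by `δ < 1`.
  set T := max |a| |b| + 1 with hT
  have hvar : ∀ J, ∃ K : ℝ → ℝ, Continuous K ∧ ∀ s t, -T ≤ s → s ≤ t → t ≤ T →
      ‖(Ψ t).psiAt (X J) - (Ψ s).psiAt (X J)‖ ≤ K t - K s := fun J =>
    hm.exists_variation_bound (G := fun t => -((m : ℂ) ^ 2) • (Ψ t).1)
      (Continuous.const_smul (continuous_fst.comp hΨ) (-((m : ℂ) ^ 2))) (fun t => rfl) T (X J)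
  choose K hKc hK using hvar
  set V : Phase → ℝ := fun Φ => quadEnergy m Φ + ∑ J, U J (Φ.psiAt (X J)) with hV
  have hVc : Continuous V := (continuous_quadEnergy m).add
    (continuous_finsetSum _ fun J _ => (hUc J).comp (continuous_psiAt (X J)))
  set Kt : ℝ → ℝ := fun t => ∑ J, K J t with hKt
  have hKtc : Continuous Kt := continuous_finsetSum _ fun J _ => hKc J
  have hsmall : ∀ ε > 0, ∀ᶠ δ in 𝓝[>] (0 : ℝ), ∀ t ∈ Icc a b, ∀ J,
      ‖steklov δ (f J) t - F J (steklov δ (fun s => (Ψ s).psiAt (X J)) t)‖ ≤ ε := by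
    intro ε hε
    -- At each time both terms of the commutator tend to `F J` of the trace; compactness of `[a, b]`
    -- makes the smallness uniform.
    have h1 := (isCompact_Icc (a := a) (b := b)).mem_prod_nhdsSet_of_forall (l := 𝓝[>] (0 : ℝ))
      (s := {p | ∀ J, ‖steklov p.1 (f J) p.2
        - F J (steklov p.1 (fun s => (Ψ s).psiAt (X J)) p.2)‖ ≤ ε}) fun t₀ _ => by
      refine eventually_all.2 fun J => ?_
      have l1 := tendsto_steklov (f J).continuous t₀
      have l2 := ((hFc J).tendsto _).comp (tendsto_steklov (hyc J) t₀)
      have l3 := (l1.sub l2).norm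
      rw [hf, sub_self, norm_zero] at l3
      exact (l3.eventually (gt_mem_nhds hε)).mono fun p hp => le_of_lt hp
    obtain ⟨s, hs, u, hu, hsu⟩ := Filter.mem_prod_iff.1 h1
    filter_upwards [hs] with δ hδ t ht
    exact hsu (mk_mem_prod hδ (subset_of_mem_nhdsSet hu ht))
  -- Smallness of the commutator times the variation of the traces. The second factor does not
  -- depend on `ε`, so letting `ε` tend to zero finishes the proof.
  have hbound : ∀ ε > 0, |V (Ψ b) - V (Ψ a)| ≤ ε * (Kt b - Kt a) := by
    intro ε hε
    have lV : ∀ t, Tendsto (fun δ => V (steklov δ Ψ t)) (𝓝[>] 0) (𝓝 (V (Ψ t))) := fun t =>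
      (hVc.tendsto _).comp (tendsto_steklov_left hΨ t)
    have lK : ∀ t, Tendsto (fun δ => steklov δ Kt t) (𝓝[>] 0) (𝓝 (Kt t)) := fun t =>
      tendsto_steklov_left hKtc t
    refine le_of_tendsto_of_tendsto ((lV b).sub (lV a)).abs (((lK b).sub (lK a)).const_mul ε) ?_
    have hδ1 : ∀ᶠ δ in 𝓝[>] (0 : ℝ), δ < 1 := mem_nhdsWithin_of_mem_nhds (Iio_mem_nhds one_pos)
    filter_upwards [hsmall ε hε, hδ1, self_mem_nhdsWithin] with δ hδ hδ1 hδ0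
    have hδ0' : (0 : ℝ) < δ := hδ0
    set η : Fin N → ℝ → ℂ := fun J t => δ⁻¹ • ((Ψ (t + δ)).psiAt (X J) - (Ψ t).psiAt (X J)) with hη
    set y : Fin N → ℝ → ℂ := fun J => steklov δ (fun s => (Ψ s).psiAt (X J)) with hy
    -- The power of the averaged force and the derivative of the potential along the averaged trace
    -- both contain `η J`, so their difference is the commutator times `conj (η J t)`.
    have dV : ∀ t, HasDerivAt (fun t => V (steklov δ Ψ t))
        (∑ J, ((steklov δ (f J) t - F J (y J t)) * conj (η J t)).re) t := fun t => by
      have e1 : ∀ J t, (steklov δ Ψ t).psiAt (X J) = y J t := fun J t =>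
        map_steklov (psiAtL (X J)) δ hΨ t
      have d1 : ∀ J, HasDerivAt (fun t => U J ((steklov δ Ψ t).psiAt (X J)))
          (-(F J (y J t) * conj (η J t)).re) t := fun J => by
        simp_rw [e1]
        have d2 := (hU J (y J t)).hasFDerivAt.comp_hasDerivAt t (hasDerivAt_steklov δ (hyc J) t)
        refine d2.congr_deriv ?_
        rw [InnerProductSpace.toDual_apply_apply, Complex.inner]
        simp [hη]
        ring
      refine ((hm.hasDerivAt_quadEnergy_steklov δ t).add
        (HasDerivAt.fun_sum fun J _ => d1 J)).congr_deriv ?_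
      rw [Complex.re_sum, ← Finset.sum_add_distrib]
      refine Finset.sum_congr rfl fun J _ => ?_
      rw [sub_mul, Complex.sub_re]
      rfl
    have dK : ∀ t, HasDerivAt (fun t => ε * steklov δ Kt t) (ε * (δ⁻¹ • (Kt (t + δ) - Kt t))) t :=
      fun t => (hasDerivAt_steklov δ hKtc t).const_mul ε
    have hle : ∀ t ∈ Icc a b, |∑ J, ((steklov δ (f J) t - F J (y J t)) * conj (η J t)).re|
        ≤ ε * (δ⁻¹ • (Kt (t + δ) - Kt t)) := by
      intro t ht
      refine (Finset.abs_sum_le_sum_abs _ _).trans ?_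
      rw [hKt, ← Finset.sum_sub_distrib, Finset.smul_sum, Finset.mul_sum]
      refine Finset.sum_le_sum fun J _ => (Complex.abs_re_le_norm _).trans ?_
      rw [norm_mul, RCLike.norm_conj]
      refine mul_le_mul (hδ t ht J) ?_ (norm_nonneg _) hε.le
      rw [hη, norm_smul, norm_inv, Real.norm_eq_abs, abs_of_pos hδ0', smul_eq_mul]
      refine mul_le_mul_of_nonneg_left (hK J _ _ ?_ (by linarith) ?_) (inv_pos.2 hδ0').le
      · linarith [ht.1, neg_abs_le a, le_max_left |a| |b|]
      · linarith [ht.2, le_abs_self b, le_max_right |a| |b|]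
    -- The comparison function is the average of `ε * Kt`, whose derivative is exactly the bound in
    -- `hle`.
    have h2 := image_norm_le_of_norm_deriv_right_le_deriv_boundary
      (f := fun t => V (steklov δ Ψ t) - V (steklov δ Ψ a)) (a := a) (b := b)
      (B := fun t => ε * steklov δ Kt t - ε * steklov δ Kt a)
      (fun t _ => ((dV t).sub_const _).continuousAt.continuousWithinAt)
      (fun t _ => ((dV t).sub_const _).hasDerivWithinAt) (by simp)
      (fun t => (dK t).sub_const _)
      (fun t ht => hle t ⟨ht.1, ht.2.le⟩)
    have h3 := h2 (right_mem_Icc.2 hab)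
    rw [Real.norm_eq_abs] at h3
    linarith
  have hzero : |V (Ψ b) - V (Ψ a)| ≤ 0 := by
    have l : Tendsto (fun ε : ℝ => ε * (Kt b - Kt a)) (𝓝[>] 0) (𝓝 (0 * (Kt b - Kt a))) :=
      (tendsto_id.mul_const _).mono_left nhdsWithin_le_nhds
    rw [zero_mul] at l
    exact ge_of_tendsto l (eventually_mem_nhdsWithin.mono fun ε hε => hbound ε hε)
  exact sub_eq_zero.1 (abs_eq_zero.1 (le_antisymm hzero (abs_nonneg _)))

/-- Conservation of energy. -/
lemma hamiltonian_eq (h : IsMildSol m X F Ψ) (hFc : ∀ J, Continuous (F J)) {U : Fin N → ℂ → ℝ}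
    (hU : ∀ J z, HasGradientAt (U J) (-F J z) z) (t : ℝ) :
    hamiltonian m X U (Ψ t) = hamiltonian m X U (Ψ 0) := by
  rw [KGOsc.hamiltonian_eq, KGOsc.hamiltonian_eq]
  rcases le_total 0 t with ht | ht
  · exact h.quadEnergy_add_eq hFc hU ht
  · exact (h.quadEnergy_add_eq hFc hU ht).symm

/-- Conservation of charge. -/
lemma charge_eq (h : IsMildSol m X F Ψ) (hF : ∀ J z, (conj z * F J z).im = 0) (t : ℝ) :
    charge (Ψ t) = charge (Ψ 0) := by
  obtain ⟨f, hf, hm⟩ := h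
  -- The integrand is `z - conj z` pointwise, and `(i/2) · 2i = -1`.
  have hch : ∀ Φ : Phase, charge Φ = -((⟪Φ.psi, Φ.mom⟫).im : ℂ) := by
    intro Φ
    have e1 : (∫ x, conj (Φ.psi x) * Φ.mom x) = ⟪Φ.psi, Φ.mom⟫ := by
      rw [L2.inner_def]
      exact integral_congr_ae (Eventually.of_forall fun x => mul_comm _ _)
    have e2 : (∫ x, conj (Φ.mom x) * Φ.psi x) = ⟪Φ.mom, Φ.psi⟫ := by
      rw [L2.inner_def]
      exact integral_congr_ae (Eventually.of_forall fun x => mul_comm _ _)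
    have i1 : Integrable fun x => conj (Φ.psi x) * Φ.mom x :=
      (L2.integrable_inner (𝕜 := ℂ) Φ.psi Φ.mom).congr
        (Eventually.of_forall fun x => mul_comm _ _)
    have i2 : Integrable fun x => conj (Φ.mom x) * Φ.psi x :=
      (L2.integrable_inner (𝕜 := ℂ) Φ.mom Φ.psi).congr
        (Eventually.of_forall fun x => mul_comm _ _)
    rw [charge, integral_sub i1 i2, e1, e2, ← inner_conj_symm Φ.mom Φ.psi, Complex.sub_conj]
    push_cast
    linear_combination (⟪Φ.psi, Φ.mom⟫.im : ℂ) * Complex.I_sq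
  have hd : ∀ t, HasDerivAt (fun t => (⟪(Ψ t).psi, (Ψ t).mom⟫).im) 0 t := by
    intro t
    -- No averaging is needed: `π` is differentiated only against `ψ(t)`, which is in `H¹`. Every
    -- resulting term is real, the point forces by rotation invariance.
    have h1 := hasDerivAt_inner_of_weak (hm.hasDerivAt_psi t)
      (continuous_mom.comp hm.continuous).continuousAt (hm.hasDerivAt_inner_mom (Ψ t).1 t)
    refine (Complex.imCLM.hasFDerivAt.comp_hasDerivAt t h1).congr_deriv ?_
    have im0 : ∀ v : L2, (⟪v, v⟫).im = 0 := fun v => inner_self_im (𝕜 := ℂ) v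
    have hs : (∑ J, f J t * conj (H1.eval (Ψ t).1 (X J))).im = 0 := by
      rw [Complex.im_sum]
      refine Finset.sum_eq_zero fun J _ => ?_
      rw [hf, mul_comm]
      exact hF J _
    have e3 : (⟪(Ψ t).1.1.1, -((m : ℂ) ^ 2) • (Ψ t).psi⟫).im = 0 := by
      rw [inner_smul_right]
      have : (-((m : ℂ) ^ 2)) = ((-(m ^ 2) : ℝ) : ℂ) := by push_cast; ring
      rw [this, Complex.im_ofReal_mul]
      exact mul_eq_zero_of_right _ (im0 _)
    rw [Complex.imCLM_apply, Complex.add_im, Complex.add_im, Complex.add_im, Complex.neg_im, hs, e3]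
    have e4 : (⟪(Ψ t).1.1.2, (Ψ t).dpsi⟫).im = 0 := im0 _
    have e5 : (⟪(Ψ t).mom, ((Ψ t).mom : L2)⟫).im = 0 := im0 _
    rw [e4]
    simpa using e5
  rw [hch, hch, is_const_of_deriv_eq_zero (fun t => (hd t).differentiableAt)
    (fun t => (hd t).deriv) t 0]

end IsMildSol

end KGOsc

end

noncomputable section

namespace KGOsc

local notation "⟪" u ", " v "⟫" => inner ℂ u v

/-! ### Rotation invariant forces -/

/-- The force `-2 v(|z|²) z`. -/
def radial (v : ℝ → ℝ) (z : ℂ) : ℂ := -((2 * v (‖z‖ ^ 2)) • z)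

lemma radial_zero (v : ℝ → ℝ) : radial v 0 = 0 := by simp [radial]

lemma continuous_radial {v : ℝ → ℝ} (hv : Continuous v) : Continuous (radial v) := by
  unfold radial
  fun_prop

lemma conj_mul_radial_im (v : ℝ → ℝ) (z : ℂ) : (conj z * radial v z).im = 0 := by
  simp [radial]
  ring

lemma hasGradientAt_radial {u v : ℝ → ℝ} {z : ℂ} (h : HasDerivAt u (v (‖z‖ ^ 2)) (‖z‖ ^ 2)) :
    HasGradientAt (fun z : ℂ => u (‖z‖ ^ 2)) (-radial v z) z := by
  rw [hasGradientAt_iff_hasFDerivAt]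
  have h1 : HasFDerivAt (fun z : ℂ => ‖z‖ ^ 2) (2 • innerSL ℝ z) z :=
    (hasStrictFDerivAt_norm_sq z).hasFDerivAt
  refine (h.comp_hasFDerivAt z h1).congr_fderiv ?_
  ext w
  simp [radial]
  ring

/-- The function `v`, continued by a constant beyond `R²`. -/
def cutoff (R : ℝ) (v : ℝ → ℝ) (s : ℝ) : ℝ := v (min s (R ^ 2))

lemma continuous_cutoff (R : ℝ) {v : ℝ → ℝ} (hv : Continuous v) : Continuous (cutoff R v) := by
  unfold cutoff
  fun_prop

lemma cutoff_of_le {R s : ℝ} (v : ℝ → ℝ) (h : s ≤ R ^ 2) : cutoff R v s = v s := by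
  rw [cutoff, min_eq_left h]

lemma radial_cutoff_of_le {R : ℝ} (v : ℝ → ℝ) {z : ℂ} (h : ‖z‖ ≤ R) :
    radial (cutoff R v) z = radial v z := by
  rw [radial, radial, cutoff_of_le v (pow_le_pow_left₀ (norm_nonneg z) h 2)]

/-- The potential of the force cut off at `R`. -/
def cutoffPotential (R : ℝ) (u : ℝ → ℝ) (s : ℝ) : ℝ :=
  u 0 + ∫ r in (0 : ℝ)..s, cutoff R (deriv u) r

lemma hasDerivAt_cutoffPotential (R : ℝ) {u : ℝ → ℝ} (hu : Continuous (deriv u)) (s : ℝ) :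
    HasDerivAt (cutoffPotential R u) (cutoff R (deriv u) s) s := by
  have hc := continuous_cutoff R hu
  exact (intervalIntegral.integral_hasDerivAt_right (hc.intervalIntegrable _ _)
    (hc.stronglyMeasurableAtFilter _ _) hc.continuousAt).const_add _

lemma cutoffPotential_of_le {R : ℝ} {u : ℝ → ℝ} (hu : Continuous (deriv u))
    (hd : Differentiable ℝ u) {s : ℝ} (hs : 0 ≤ s) (h : s ≤ R ^ 2) :
    cutoffPotential R u s = u s := by
  have h1 : ∫ r in (0 : ℝ)..s, cutoff R (deriv u) r = ∫ r in (0 : ℝ)..s, deriv u r :=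
    intervalIntegral.integral_congr fun r hr => by
      rw [uIcc_of_le hs] at hr
      exact cutoff_of_le _ (hr.2.trans h)
  rw [cutoffPotential, h1, intervalIntegral.integral_deriv_eq_sub (fun r _ => hd r)
    (hu.intervalIntegrable _ _)]
  ring

/-- Beyond the radius `R` the coefficient is constant and the force linear. Inside, `v` is Lipschitz
on the compact interval `[0, R²]`, and the factors of size at most `R` turn this into a bound in
`z`. -/
lemma exists_lipschitz_radial_cutoff {R : ℝ} (hR : 0 ≤ R) {v : ℝ → ℝ} (hv : ContDiff ℝ 1 v) :
    ∃ L, 0 ≤ L ∧ ∀ z w, ‖radial (cutoff R v) z - radial (cutoff R v) w‖ ≤ L * ‖z - w‖ := by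
  obtain ⟨K, hK⟩ := LocallyLipschitzOn.exists_lipschitzOnWith_of_compact
    (isCompact_Icc (a := (0 : ℝ)) (b := R ^ 2)) (hv.locallyLipschitz.locallyLipschitzOn (s := _))
  obtain ⟨M, hM⟩ := (isCompact_Icc (a := (0 : ℝ)) (b := R ^ 2)).exists_bound_of_continuousOn
    hv.continuous.continuousOn
  have hM0 : 0 ≤ M := (norm_nonneg _).trans (hM 0 ⟨le_rfl, by positivity⟩)
  have hmem : ∀ z : ℂ, min (‖z‖ ^ 2) (R ^ 2) ∈ Icc (0 : ℝ) (R ^ 2) := fun z =>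
    ⟨by positivity, min_le_right _ _⟩
  have key : ∀ z w : ℂ, ‖w‖ ≤ ‖z‖ →
      ‖radial (cutoff R v) z - radial (cutoff R v) w‖ ≤ (2 * (M + 2 * K * R ^ 2)) * ‖z - w‖ := by
    intro z w hwz
    -- The difference of coefficients is paired with the shorter vector `w`: it vanishes when `R ≤
    -- ‖w‖`, and otherwise `‖w‖ ≤ R`.
    have e : radial (cutoff R v) z - radial (cutoff R v) w
        = -((2 * cutoff R v (‖z‖ ^ 2)) • (z - w)
          + (2 * (cutoff R v (‖z‖ ^ 2) - cutoff R v (‖w‖ ^ 2))) • w) := by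
      simp only [radial]
      module
    have h1 : |cutoff R v (‖z‖ ^ 2)| ≤ M := hM _ (hmem z)
    have h2 : |cutoff R v (‖z‖ ^ 2) - cutoff R v (‖w‖ ^ 2)| * ‖w‖ ≤ 2 * K * R ^ 2 * ‖z - w‖ := by
      have h3 : |cutoff R v (‖z‖ ^ 2) - cutoff R v (‖w‖ ^ 2)|
          ≤ K * |min (‖z‖ ^ 2) (R ^ 2) - min (‖w‖ ^ 2) (R ^ 2)| := by
        have := hK.dist_le_mul _ (hmem z) _ (hmem w)
        rwa [Real.dist_eq, Real.dist_eq] at this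
      have hzw : ‖z‖ - ‖w‖ ≤ ‖z - w‖ := norm_sub_norm_le z w
      have hw0 := norm_nonneg w
      have hK0 : (0 : ℝ) ≤ K := K.2
      rcases le_total R ‖w‖ with hw | hw
      · have e1 : min (‖z‖ ^ 2) (R ^ 2) = R ^ 2 := min_eq_right (by nlinarith)
        have e2 : min (‖w‖ ^ 2) (R ^ 2) = R ^ 2 := min_eq_right (by nlinarith)
        rw [e1, e2, sub_self, abs_zero, mul_zero] at h3
        rw [le_antisymm h3 (abs_nonneg _), zero_mul]
        positivity
      · have e2 : min (‖w‖ ^ 2) (R ^ 2) = ‖w‖ ^ 2 := min_eq_left (by nlinarith)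
        have h4 : |min (‖z‖ ^ 2) (R ^ 2) - ‖w‖ ^ 2| ≤ 2 * R * ‖z - w‖ := by
          rw [abs_of_nonneg (sub_nonneg.2 (le_min (by nlinarith) (by nlinarith)))]
          rcases le_total R ‖z‖ with hz | hz
          · rw [min_eq_right (by nlinarith)]
            nlinarith
          · rw [min_eq_left (by nlinarith)]
            nlinarith
        rw [e2] at h3
        calc _ ≤ (K * (2 * R * ‖z - w‖)) * R := by
              refine mul_le_mul (h3.trans (mul_le_mul_of_nonneg_left h4 hK0)) hw hw0 (by positivity)
          _ = _ := by ring
    rw [e, norm_neg]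
    refine (norm_add_le _ _).trans ?_
    rw [norm_smul, norm_smul, Real.norm_eq_abs, Real.norm_eq_abs, abs_mul, abs_mul, abs_two]
    nlinarith [mul_le_mul_of_nonneg_right h1 (norm_nonneg (z - w))]
  refine ⟨2 * (M + 2 * K * R ^ 2), by positivity, fun z w => ?_⟩
  rcases le_total ‖w‖ ‖z‖ with h | h
  · exact key z w h
  · rw [norm_sub_rev, norm_sub_rev z w]
    exact key w z h

/-! ### Coercivity of the energy -/

lemma norm_psiAt_sq_le {m : ℝ} (hm : 0 < m) (Φ : Phase) (x : ℝ) :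
    ‖Φ.psiAt x‖ ^ 2 ≤ quadEnergy m Φ / m := by
  refine (H1.norm_eval_sq_le hm Φ.1 x).trans ?_
  rw [div_le_div_iff₀ (by positivity) hm]
  have h1 : ‖Φ.1.1.2‖ ^ 2 + m ^ 2 * ‖Φ.1.1.1‖ ^ 2 ≤ 2 * quadEnergy m Φ := by
    have : quadEnergy m Φ = 1 / 2 * (‖Φ.mom‖ ^ 2 + ‖Φ.1.1.2‖ ^ 2 + m ^ 2 * ‖Φ.1.1.1‖ ^ 2) := rfl
    nlinarith [sq_nonneg ‖Φ.mom‖]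
  nlinarith

/-- By the sharp Sobolev inequality the potentials can lower the energy by at most the fraction `(∑
B_J)/m < 1` of its quadratic part, up to the constants `A_J`. -/
lemma quadEnergy_le_of_hamiltonian {N : ℕ} {m : ℝ} (hm : 0 < m) (X : Fin N → ℝ)
    {U : Fin N → ℂ → ℝ} {A B : Fin N → ℝ} (hB : ∀ J, 0 ≤ B J)
    (hbelow : ∀ J ψ, A J - B J * ‖ψ‖ ^ 2 ≤ U J ψ) (hsum : ∑ J, B J < m) (Φ : Phase) :
    quadEnergy m Φ ≤ (hamiltonian m X U Φ - ∑ J, A J) / (1 - (∑ J, B J) / m) := by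
  have hpos : 0 < 1 - (∑ J, B J) / m := by
    rw [sub_pos, div_lt_one hm]
    exact hsum
  rw [le_div_iff₀ hpos, hamiltonian_eq]
  have h1 : ∑ J, (A J - B J * (quadEnergy m Φ / m)) ≤ ∑ J, U J (Φ.psiAt (X J)) :=
    Finset.sum_le_sum fun J _ => le_trans (by
      have := mul_le_mul_of_nonneg_left (norm_psiAt_sq_le hm Φ (X J)) (hB J)
      linarith) (hbelow J _)
  rw [Finset.sum_sub_distrib, ← Finset.sum_mul] at h1
  have e : quadEnergy m Φ * (1 - (∑ J, B J) / m)
      = quadEnergy m Φ - (∑ J, B J) * (quadEnergy m Φ / m) := by ring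
  rw [e]
  linarith

lemma energyNorm_eq (m : ℝ) (Φ : Phase) : energyNorm m Φ = √(2 * quadEnergy m Φ) := by
  rw [energyNorm, quadEnergy]
  congr 1
  ring

/-- The phase space norm of states of bounded energy is bounded. -/
lemma exists_norm_le_of_quadEnergy {m : ℝ} (hm : 0 < m) (E : ℝ) :
    ∃ C, ∀ Φ : Phase, quadEnergy m Φ ≤ E → ‖Φ‖ ≤ C := by
  refine ⟨max (max (√(2 * E) / m) (√(2 * E))) (√(2 * E)), fun Φ hΦ => ?_⟩
  have e : quadEnergy m Φ = 1 / 2 * (‖Φ.mom‖ ^ 2 + ‖Φ.dpsi‖ ^ 2 + m ^ 2 * ‖Φ.psi‖ ^ 2) := rfl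
  have hn : ‖Φ‖ = max (max ‖Φ.psi‖ ‖Φ.dpsi‖) ‖Φ.mom‖ := rfl
  rw [hn]
  refine max_le_max (max_le_max ?_ ?_) ?_
  · rw [le_div_iff₀ hm]
    exact Real.le_sqrt_of_sq_le (by nlinarith [sq_nonneg ‖Φ.mom‖, sq_nonneg ‖Φ.dpsi‖])
  · exact Real.le_sqrt_of_sq_le (by nlinarith [sq_nonneg ‖Φ.mom‖, sq_nonneg (m * ‖Φ.psi‖)])
  · exact Real.le_sqrt_of_sq_le (by nlinarith [sq_nonneg ‖Φ.dpsi‖, sq_nonneg (m * ‖Φ.psi‖)])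

/-! ### Weighted estimates for mild solutions -/

lemma norm_psi_le (Φ : Phase) : ‖Φ.psi‖ ≤ ‖Φ‖ := (le_max_left _ _).trans (le_max_left _ _)

lemma norm_psiAt_le (Φ : Phase) (x : ℝ) : ‖Φ.psiAt x‖ ≤ ‖Φ‖ :=
  (H1.norm_eval_le Φ.1 x).trans (le_max_left _ _)

lemma norm_char_le {ε : ℝ} (hε : ε = 1 ∨ ε = -1) (Φ : Phase) : ‖Φ.char ε‖ ≤ 2 * ‖Φ‖ := by
  have h1 : ‖Φ.dpsi‖ ≤ ‖Φ‖ := (le_max_right _ _).trans (le_max_left _ _)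
  have h2 : ‖Φ.mom‖ ≤ ‖Φ‖ := le_max_right _ _
  have h3 : ‖(ε : ℂ)‖ = 1 := by rcases hε with rfl | rfl <;> norm_num
  refine (norm_add_le _ _).trans ?_
  rw [norm_smul, h3]
  linarith

lemma norm_integral_le_of_exp {w : ℝ → L2} {G μ : ℝ} (hμ : 0 < μ)
    (hG : ∀ s, ‖w s‖ ≤ G * Real.exp (μ * |s|)) (t : ℝ) :
    ‖∫ s in (0 : ℝ)..t, w s‖ ≤ G * Real.exp (μ * |t|) / μ := by
  have hG0 : 0 ≤ G := by simpa using (norm_nonneg _).trans (hG 0)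
  have hc : Continuous fun s : ℝ => G * Real.exp (μ * |s|) := by fun_prop
  refine (intervalIntegral.norm_integral_le_abs_of_norm_le
    (Eventually.of_forall hG) (hc.intervalIntegrable 0 t)).trans ?_
  rw [intervalIntegral.integral_const_mul, abs_mul, abs_of_nonneg hG0, mul_div_assoc]
  exact mul_le_mul_of_nonneg_left (abs_integral_exp_le hμ t) hG0

/-! ### Differences and growth of mild solutions -/

namespace IsMild

variable {N : ℕ} {X : Fin N → ℝ} {g g₁ g₂ : ℝ → L2} {f f₁ f₂ : Fin N → C(ℝ, ℂ)}
  {Ψ Ψ₁ Ψ₂ : ℝ → Phase}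

lemma sub (h₁ : IsMild X g₁ f₁ Ψ₁) (h₂ : IsMild X g₂ f₂ Ψ₂) :
    IsMild X (fun t => g₁ t - g₂ t) (fun J => f₁ J - f₂ J) (fun t => Ψ₁ t - Ψ₂ t) where
  continuous := h₁.continuous.sub h₂.continuous
  force := h₁.force.sub h₂.force
  psi := fun t => by
    have c1 : Continuous fun s => (Ψ₁ s).mom := continuous_mom.comp h₁.continuous
    have c2 : Continuous fun s => (Ψ₂ s).mom := continuous_mom.comp h₂.continuous
    have e : ∫ s in (0 : ℝ)..t, (Ψ₁ s - Ψ₂ s).mom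
        = (∫ s in (0 : ℝ)..t, (Ψ₁ s).mom) - ∫ s in (0 : ℝ)..t, (Ψ₂ s).mom :=
      intervalIntegral.integral_sub (c1.intervalIntegrable _ _) (c2.intervalIntegrable _ _)
    rw [e]
    change (Ψ₁ t).psi - (Ψ₂ t).psi = (Ψ₁ 0).psi - (Ψ₂ 0).psi + _
    rw [h₁.psi t, h₂.psi t]
    abel
  char := fun ε hε t => by
    have e : ∀ Φ₁ Φ₂ : Phase, (Φ₁ - Φ₂).char ε = Φ₁.char ε - Φ₂.char ε := fun Φ₁ Φ₂ => by
      change Φ₁.mom - Φ₂.mom + (ε : ℂ) • (Φ₁.dpsi - Φ₂.dpsi) = _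
      simp only [Phase.char]
      module
    rw [e, e, h₁.char ε hε, h₂.char ε hε, travel, travel, travel, ← map_sub]
    congr 1
    have e2 : ∫ s in (0 : ℝ)..t, tau (-(ε * s)) (g₁ s - g₂ s)
        = (∫ s in (0 : ℝ)..t, tau (-(ε * s)) (g₁ s)) - ∫ s in (0 : ℝ)..t, tau (-(ε * s)) (g₂ s) := by
      rw [← intervalIntegral.integral_sub ((continuous_tau_force ε h₁.force).intervalIntegrable _ _)
        ((continuous_tau_force ε h₂.force).intervalIntegrable _ _)]
      simp_rw [map_sub]
    simp only [profile]
    rw [e2]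
    simp_rw [src_sub]
    rw [Finset.sum_sub_distrib]
    abel

/-- Growth of a mild solution in terms of the growth of the forces. -/
lemma norm_le (h : IsMild X g f Ψ) {μ G P : ℝ} (hμ : 1 ≤ μ)
    (hG : ∀ s, ‖g s‖ ≤ G * Real.exp (μ * |s|))
    (hP0 : 0 ≤ P) (hP : ∀ J s, ‖f J s‖ ≤ P * Real.exp (μ * |s|)) (t : ℝ) :
    ‖Ψ t‖ ≤ (3 * ‖Ψ 0‖ + (G / μ + N * (P / √(2 * μ)))) * Real.exp (μ * |t|) := by
  have hμ0 : 0 < μ := by linarith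
  have hG0 : 0 ≤ G := by simpa using (norm_nonneg _).trans (hG 0)
  set Q := G / μ + N * (P / √(2 * μ)) with hQ
  have hQ0 : 0 ≤ Q := by positivity
  have hexp : ∀ t, 1 ≤ Real.exp (μ * |t|) := fun t => Real.one_le_exp (by positivity)
  have hchar : ∀ (ε : ℝ) (hε : ε = 1 ∨ ε = -1) t,
      ‖(Ψ t).char ε‖ ≤ (2 * ‖Ψ 0‖ + Q) * Real.exp (μ * |t|) := by
    intro ε hε t
    rw [h.char ε hε t, travel, LinearIsometry.norm_map, profile]
    have b1 := norm_char_le hε (Ψ 0)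
    have b2 : ‖∫ s in (0 : ℝ)..t, tau (-(ε * s)) (g s)‖ ≤ G * Real.exp (μ * |t|) / μ :=
      norm_integral_le_of_exp hμ0 (fun s => by rw [LinearIsometry.norm_map]; exact hG s) t
    have b3 : ‖∑ J, src hε (X J) (f J) 0 t‖ ≤ N * (P * Real.exp (μ * |t|) / √(2 * μ)) := by
      refine (norm_sum_le _ _).trans ((Finset.sum_le_card_nsmul _ _
        (P * Real.exp (μ * |t|) / √(2 * μ)) fun J _ => ?_).trans_eq ?_)
      · rw [norm_src]
        exact norm_win_le hμ0 (hP J) t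
      · rw [Finset.card_univ, Fintype.card_fin, nsmul_eq_mul]
    have b4 : 2 * ‖Ψ 0‖ ≤ 2 * ‖Ψ 0‖ * Real.exp (μ * |t|) :=
      le_mul_of_one_le_right (by positivity) (hexp t)
    have e : (2 * ‖Ψ 0‖ + Q) * Real.exp (μ * |t|) = 2 * ‖Ψ 0‖ * Real.exp (μ * |t|)
        + G * Real.exp (μ * |t|) / μ + N * (P * Real.exp (μ * |t|) / √(2 * μ)) := by
      rw [hQ]; ring
    rw [e]
    exact (norm_add_le _ _).trans (add_le_add ((norm_add_le _ _).trans (by linarith)) b3)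
  have hhalf : ‖(1 / 2 : ℂ)‖ = 1 / 2 := by norm_num
  have hmom : ∀ t, ‖(Ψ t).mom‖ ≤ (2 * ‖Ψ 0‖ + Q) * Real.exp (μ * |t|) := fun t => by
    rw [Phase.mom_eq, norm_smul, hhalf]
    linarith [norm_add_le ((Ψ t).char 1) ((Ψ t).char (-1)), hchar 1 (Or.inl rfl) t,
      hchar (-1) (Or.inr rfl) t]
  have hdpsi : ‖(Ψ t).dpsi‖ ≤ (2 * ‖Ψ 0‖ + Q) * Real.exp (μ * |t|) := by
    rw [Phase.dpsi_eq, norm_smul, hhalf]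
    linarith [norm_sub_le ((Ψ t).char 1) ((Ψ t).char (-1)), hchar 1 (Or.inl rfl) t,
      hchar (-1) (Or.inr rfl) t]
  have hpsi : ‖(Ψ t).psi‖ ≤ ‖Ψ 0‖ + (2 * ‖Ψ 0‖ + Q) * Real.exp (μ * |t|) := by
    rw [h.psi t]
    refine (norm_add_le _ _).trans (add_le_add (norm_psi_le _) ?_)
    -- `μ ≥ 1` lets the time integral of the momentum be bounded without loss by the bound for the
    -- momentum itself.
    exact (norm_integral_le_of_exp hμ0 hmom t).trans (div_le_self (by positivity) hμ)
  have hn0 : ‖Ψ 0‖ ≤ ‖Ψ 0‖ * Real.exp (μ * |t|) :=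
    le_mul_of_one_le_right (norm_nonneg _) (hexp t)
  have hn1 := norm_nonneg (Ψ 0)
  have hn : ‖Ψ t‖ = max (max ‖(Ψ t).psi‖ ‖(Ψ t).dpsi‖) ‖(Ψ t).mom‖ := rfl
  have hm := hmom t
  have e : (3 * ‖Ψ 0‖ + Q) * Real.exp (μ * |t|)
      = ‖Ψ 0‖ * Real.exp (μ * |t|) + (2 * ‖Ψ 0‖ + Q) * Real.exp (μ * |t|) := by ring
  rw [hn, e]
  exact max_le (max_le (by linarith) (by linarith)) (by linarith)

end IsMild

/-- Chooses the weight so that the mass term and the point forces together contract by `1/2`. -/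
lemma exists_rate (a b : ℝ) : ∃ μ : ℝ, 1 ≤ μ ∧ a / μ + b / √(2 * μ) ≤ 1 / 2 := by
  have h1 : Tendsto (fun μ : ℝ => a / μ + b / √(2 * μ)) atTop (𝓝 (0 + 0)) :=
    (tendsto_const_nhds.div_atTop tendsto_id).add (tendsto_const_nhds.div_atTop
      (Real.tendsto_sqrt_atTop.comp (tendsto_id.const_mul_atTop two_pos)))
  rw [add_zero] at h1
  have h2 := h1.eventually (gt_mem_nhds (show (0 : ℝ) < 1 / 2 by norm_num))
  obtain ⟨μ, h3, h4⟩ := (h2.and (eventually_ge_atTop 1)).exists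
  exact ⟨μ, h4, h3.le⟩

/-! ### Globally Lipschitz forces -/

section lipschitz

variable {N : ℕ} (m : ℝ) (X : Fin N → ℝ) {F : Fin N → ℂ → ℂ} {L : ℝ}

/-- Stability of mild solutions with respect to the initial state. -/
lemma exists_stability (hL : 0 ≤ L) (hF : ∀ J z w, ‖F J z - F J w‖ ≤ L * ‖z - w‖) :
    ∃ μ : ℝ, ∀ Ψ₁ Ψ₂ : ℝ → Phase, IsMildSol m X F Ψ₁ → IsMildSol m X F Ψ₂ →
      (∃ C, ∀ t, ‖Ψ₁ t - Ψ₂ t‖ ≤ C) →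
      ∀ t, ‖Ψ₁ t - Ψ₂ t‖ ≤ 6 * ‖Ψ₁ 0 - Ψ₂ 0‖ * Real.exp (μ * |t|) := by
  obtain ⟨μ, hμ, hκ⟩ := exists_rate (m ^ 2) (N * L)
  refine ⟨μ, fun Ψ₁ Ψ₂ h₁ h₂ hC t => ?_⟩
  obtain ⟨C, hC⟩ := hC
  obtain ⟨f₁, hf₁, hm₁⟩ := h₁
  obtain ⟨f₂, hf₂, hm₂⟩ := h₂
  have hexp : ∀ t, 1 ≤ Real.exp (μ * |t|) := fun t => Real.one_le_exp (by positivity)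
  -- The assumed bound on the difference serves only to make the weighted supremum finite, so that
  -- it can be absorbed below; it does not enter the estimate.
  have hbdd : BddAbove (range fun t => ‖Ψ₁ t - Ψ₂ t‖ / Real.exp (μ * |t|)) := by
    refine ⟨C, ?_⟩
    rintro _ ⟨t, rfl⟩
    exact (div_le_self (norm_nonneg _) (hexp t)).trans (hC t)
  set D := ⨆ t, ‖Ψ₁ t - Ψ₂ t‖ / Real.exp (μ * |t|) with hD
  have hDle : ∀ t, ‖Ψ₁ t - Ψ₂ t‖ ≤ D * Real.exp (μ * |t|) := fun t => by
    rw [← div_le_iff₀ (Real.exp_pos _)]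
    exact le_ciSup hbdd t
  have hD0 : 0 ≤ D := by simpa using (norm_nonneg _).trans (hDle 0)
  have key := (hm₁.sub hm₂).norm_le (G := m ^ 2 * D) (P := L * D) hμ (fun s => by
    rw [← smul_sub, norm_smul, norm_neg, norm_pow, Complex.norm_real, Real.norm_eq_abs, sq_abs,
      mul_assoc]
    exact mul_le_mul_of_nonneg_left ((norm_psi_le (Ψ₁ s - Ψ₂ s)).trans (hDle s)) (sq_nonneg m))
    (by positivity) (fun J s => by
      rw [ContinuousMap.sub_apply, hf₁, hf₂, mul_assoc]
      refine (hF J _ _).trans (mul_le_mul_of_nonneg_left (le_trans ?_ (hDle s)) hL)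
      have e : (Ψ₁ s).psiAt (X J) - (Ψ₂ s).psiAt (X J) = (Ψ₁ s - Ψ₂ s).psiAt (X J) :=
        (map_sub (psiAtL (X J)) _ _).symm
      rw [e]
      exact norm_psiAt_le _ _)
  have e : m ^ 2 * D / μ + N * (L * D / √(2 * μ)) = (m ^ 2 / μ + N * L / √(2 * μ)) * D := by ring
  -- Absorbing half of `D` gives the constant `6`.
  have hle : D ≤ 3 * ‖Ψ₁ 0 - Ψ₂ 0‖ + 1 / 2 * D := ciSup_le fun t => by
    rw [div_le_iff₀ (Real.exp_pos _)]
    refine (key t).trans (mul_le_mul_of_nonneg_right ?_ (Real.exp_pos _).le)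
    rw [e]
    linarith [mul_le_mul_of_nonneg_right hκ hD0]
  exact (hDle t).trans (mul_le_mul_of_nonneg_right (by linarith) (Real.exp_pos _).le)

/-- The contraction principle in a space of functions with exponential weight. -/
lemma exists_fixedPoint_of_weight {E : Type*} [NormedAddCommGroup E] [NormedSpace ℝ E]
    [CompleteSpace E] {μ : ℝ} (S : C(ℝ, E) → C(ℝ, E))
    (h1 : ∀ (w : C(ℝ, E)) (D : ℝ), (∀ s, ‖w s‖ ≤ D * Real.exp (μ * |s|)) →
      ∃ C, ∀ t, ‖S w t‖ ≤ C * Real.exp (μ * |t|))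
    (h2 : ∀ (w₁ w₂ : C(ℝ, E)) (D : ℝ), (∀ s, ‖w₁ s - w₂ s‖ ≤ D * Real.exp (μ * |s|)) →
      ∀ t, ‖S w₁ t - S w₂ t‖ ≤ 1 / 2 * D * Real.exp (μ * |t|)) : ∃ w, S w = w := by
  -- Multiplication by the weight transports the problem to bounded continuous functions, where the
  -- contraction principle applies.
  obtain ⟨V, hV⟩ : ∃ V : BoundedContinuousFunction ℝ E → C(ℝ, E),
      ∀ Φ t, V Φ t = Real.exp (μ * |t|) • Φ t :=
    ⟨fun Φ => ⟨fun t => Real.exp (μ * |t|) • Φ t, by fun_prop⟩, fun _ _ => rfl⟩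
  have hn : ∀ (x : E) t, ‖Real.exp (μ * |t|) • x‖ = ‖x‖ * Real.exp (μ * |t|) := fun x t => by
    rw [norm_smul, Real.norm_eq_abs, Real.abs_exp, mul_comm]
  have hb : ∀ Φ, ∃ C, ∀ t, ‖S (V Φ) t‖ ≤ C * Real.exp (μ * |t|) := fun Φ =>
    h1 _ ‖Φ‖ fun s => by
      rw [hV, hn]
      exact mul_le_mul_of_nonneg_right (Φ.norm_coe_le_norm s) (Real.exp_pos _).le
  choose C hC using hb
  have hunw : ∀ (x : E) (C t : ℝ), ‖x‖ ≤ C * Real.exp (μ * |t|) →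
      ‖Real.exp (-(μ * |t|)) • x‖ ≤ C := fun x C t h => by
    rw [norm_smul, Real.norm_eq_abs, Real.abs_exp, Real.exp_neg, inv_mul_le_iff₀ (Real.exp_pos _),
      mul_comm]
    exact h
  obtain ⟨T, hT⟩ : ∃ T : BoundedContinuousFunction ℝ E → BoundedContinuousFunction ℝ E,
      ∀ Φ t, T Φ t = Real.exp (-(μ * |t|)) • S (V Φ) t :=
    ⟨fun Φ => BoundedContinuousFunction.ofNormedAddCommGroup
      (fun t => Real.exp (-(μ * |t|)) • S (V Φ) t)
      (Continuous.smul (by fun_prop) (S (V Φ)).continuous) (C Φ) (fun t => hunw _ _ t (hC Φ t)),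
      fun _ _ => rfl⟩
  have hK : ContractingWith (1 / 2) T := by
    refine ⟨by rw [← NNReal.coe_lt_coe]; norm_num, LipschitzWith.of_dist_le_mul fun Φ₁ Φ₂ => ?_⟩
    have hc : (0 : ℝ) ≤ ((1 / 2 : NNReal) : ℝ) * dist Φ₁ Φ₂ := by positivity
    refine (BoundedContinuousFunction.dist_le hc).2 fun t => ?_
    rw [dist_eq_norm, hT, hT, ← smul_sub]
    refine hunw _ _ t ((h2 _ _ (dist Φ₁ Φ₂) (fun s => ?_) t).trans_eq (by norm_num))
    rw [hV, hV, ← smul_sub, hn, ← dist_eq_norm]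
    exact mul_le_mul_of_nonneg_right (BoundedContinuousFunction.dist_coe_le_dist s)
      (Real.exp_pos _).le
  obtain ⟨Φ, hΦ⟩ : ∃ Φ, T Φ = Φ := ⟨hK.fixedPoint, hK.fixedPoint_isFixedPt⟩
  refine ⟨V Φ, ContinuousMap.ext fun t => ?_⟩
  rw [hV]
  nth_rewrite 2 [← hΦ]
  rw [hT, smul_smul, ← Real.exp_add, add_neg_cancel, Real.exp_zero, one_smul]

/-- Global existence for globally Lipschitz forces. -/
lemma exists_isMildSol_of_lipschitz (hL : 0 ≤ L) (hF : ∀ J z w, ‖F J z - F J w‖ ≤ L * ‖z - w‖)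
    (hF0 : ∀ J, F J 0 = 0) (Ψ₀ : Phase) : ∃ Ψ, IsMildSol m X F Ψ ∧ Ψ 0 = Ψ₀ := by
  obtain ⟨μ, hμ, hκ⟩ := exists_rate (m ^ 2) (N * L)
  have hFc : ∀ J, Continuous (F J) := fun J =>
    (LipschitzWith.of_dist_le_mul (K := ⟨L, hL⟩) fun z w => by
      rw [dist_eq_norm, dist_eq_norm]; exact hF J z w).continuous
  let f : C(ℝ, Phase) → Fin N → C(ℝ, ℂ) := fun w J =>
    ⟨fun t => F J ((w t).psiAt (X J)), (hFc J).comp ((continuous_psiAt (X J)).comp w.continuous)⟩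
  have hg : ∀ w : C(ℝ, Phase), Continuous fun t => -((m : ℂ) ^ 2) • (w t).psi := fun w =>
    Continuous.const_smul (continuous_psi.comp w.continuous) (-((m : ℂ) ^ 2))
  -- The iteration solves the wave equation with the mass term and the point forces frozen along
  -- `w`; its fixed points are the mild solutions.
  have hS : ∀ w : C(ℝ, Phase), ∃ S : C(ℝ, Phase), S 0 = Ψ₀ ∧
      IsMild X (fun t => -((m : ℂ) ^ 2) • (w t).psi) (f w) S := fun w =>
    ⟨⟨_, (isMild_evolve X (f w) Ψ₀ (hg w)).continuous⟩, evolve_zero X (f w) Ψ₀ (hg w),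
      isMild_evolve X (f w) Ψ₀ (hg w)⟩
  choose S hS0 hS using hS
  have hnm : ∀ v : L2, ‖-((m : ℂ) ^ 2) • v‖ = m ^ 2 * ‖v‖ := fun v => by
    rw [norm_smul, norm_neg, norm_pow, Complex.norm_real, Real.norm_eq_abs, sq_abs]
  obtain ⟨w, hw⟩ := exists_fixedPoint_of_weight (μ := μ) S (fun w D hD => by
    have hD0 : 0 ≤ D := by simpa using (norm_nonneg _).trans (hD 0)
    refine ⟨_, (hS w).norm_le (G := m ^ 2 * D) (P := L * D) hμ (fun s => ?_) (by positivity)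
      fun J s => ?_⟩
    · rw [hnm, mul_assoc]
      exact mul_le_mul_of_nonneg_left ((norm_psi_le _).trans (hD s)) (sq_nonneg m)
    · have h2 := hF J ((w s).psiAt (X J)) 0
      rw [hF0, sub_zero, sub_zero] at h2
      rw [mul_assoc]
      exact h2.trans (mul_le_mul_of_nonneg_left ((norm_psiAt_le _ _).trans (hD s)) hL))
    (fun w₁ w₂ D hD t => by
    have hD0 : 0 ≤ D := by simpa using (norm_nonneg _).trans (hD 0)
    have h1 := ((hS w₁).sub (hS w₂)).norm_le (G := m ^ 2 * D) (P := L * D) hμ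
      (fun s => by
        rw [← smul_sub, hnm, mul_assoc]
        exact mul_le_mul_of_nonneg_left ((norm_psi_le (w₁ s - w₂ s)).trans (hD s)) (sq_nonneg m))
      (by positivity) (fun J s => by
        rw [mul_assoc]
        refine (hF J _ _).trans (mul_le_mul_of_nonneg_left (le_trans ?_ (hD s)) hL)
        refine le_trans (le_of_eq (congrArg norm ?_)) (norm_psiAt_le (w₁ s - w₂ s) (X J))
        exact (map_sub (psiAtL (X J)) _ _).symm) t
    -- Both images start from `Ψ₀`, so only the difference of the forces remains, with factor at
    -- most `1/2`.
    rw [hS0, hS0, sub_self, norm_zero, mul_zero, zero_add] at h1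
    refine h1.trans (mul_le_mul_of_nonneg_right ?_ (Real.exp_pos _).le)
    have e : m ^ 2 * D / μ + N * (L * D / √(2 * μ))
        = (m ^ 2 / μ + N * L / √(2 * μ)) * D := by ring
    rw [e]
    exact mul_le_mul_of_nonneg_right hκ hD0)
  refine ⟨w, ⟨f w, fun J t => rfl, ?_⟩, ?_⟩
  · have h1 := hS w
    rwa [hw] at h1
  · have h1 := hS0 w
    rwa [hw] at h1

end lipschitz

end KGOsc

end

noncomputable section

namespace KGOsc

/-! ### The Cauchy problem -/

section cauchy

variable {N : ℕ} {m : ℝ} {X : Fin N → ℝ} {u : Fin N → ℝ → ℝ} {A B : Fin N → ℝ}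

lemma continuous_hamiltonian (m : ℝ) (X : Fin N → ℝ) {U : Fin N → ℂ → ℝ}
    (hU : ∀ J, Continuous (U J)) : Continuous (hamiltonian m X U) := by
  rw [funext (hamiltonian_eq m X U)]
  exact (continuous_quadEnergy m).add
    (continuous_finsetSum _ fun J _ => (hU J).comp (continuous_psiAt (X J)))

/-- Conservation of energy for rotation invariant forces. -/
lemma hamiltonian_radial_eq {Ψ : ℝ → Phase} {w v : Fin N → ℝ → ℝ}
    (hv : ∀ J, Continuous (v J)) (hw : ∀ J s, HasDerivAt (w J) (v J s) s)
    (h : IsMildSol m X (fun J => radial (v J)) Ψ) (t : ℝ) :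
    hamiltonian m X (fun J z => w J (‖z‖ ^ 2)) (Ψ t)
      = hamiltonian m X (fun J z => w J (‖z‖ ^ 2)) (Ψ 0) :=
  h.hamiltonian_eq (fun J => continuous_radial (hv J))
    (fun J _ => hasGradientAt_radial (hw J _)) t

/-- A bound for the traces of states of energy at most `E`. -/
lemma exists_norm_psiAt_lt (hm : 0 < m) (hB : ∀ J, 0 ≤ B J)
    (hbelow : ∀ J (ψ : ℂ), A J - B J * ‖ψ‖ ^ 2 ≤ u J (‖ψ‖ ^ 2)) (hsum : ∑ J, B J < m) (E : ℝ) :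
    ∃ R, 0 ≤ R ∧ ∀ Φ : Phase, hamiltonian m X (fun J z => u J (‖z‖ ^ 2)) Φ ≤ E →
      ∀ x, ‖Φ.psiAt x‖ < R := by
  have hpos : 0 < 1 - (∑ J, B J) / m := by
    rw [sub_pos, div_lt_one hm]
    exact hsum
  set q := (E - ∑ J, A J) / (1 - (∑ J, B J) / m) with hq
  -- The added unit makes the inequality strict, as the continuation argument requires.
  refine ⟨√(q / m) + 1, by positivity, fun Φ hΦ x => ?_⟩
  have h1 : quadEnergy m Φ ≤ q :=
    (quadEnergy_le_of_hamiltonian hm X hB hbelow hsum Φ).trans (by rw [hq]; gcongr)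
  have h2 : ‖Φ.psiAt x‖ ≤ √(q / m) :=
    Real.le_sqrt_of_sq_le ((norm_psiAt_sq_le hm Φ x).trans (by gcongr))
  linarith

/-- The traces of a solution of the problem with the force cut off at `R` stay below `R`. -/
lemma norm_psiAt_lt_of_cutoff (hu : ∀ J, ContDiff ℝ 2 (u J)) {E R : ℝ}
    (hR : ∀ Φ : Phase, hamiltonian m X (fun J z => u J (‖z‖ ^ 2)) Φ ≤ E → ∀ x, ‖Φ.psiAt x‖ < R)
    {Ψ : ℝ → Phase} (h : IsMildSol m X (fun J => radial (cutoff R (deriv (u J)))) Ψ)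
    (hE : hamiltonian m X (fun J z => u J (‖z‖ ^ 2)) (Ψ 0) ≤ E) (J : Fin N) (t : ℝ) :
    ‖(Ψ t).psiAt (X J)‖ < R := by
  have hd : ∀ J, Differentiable ℝ (u J) := fun J => (hu J).differentiable (by norm_num)
  have hu' : ∀ J, Continuous (deriv (u J)) := fun J => (hu J).continuous_deriv (by norm_num)
  have hΨ : Continuous Ψ := by
    obtain ⟨f, -, hm⟩ := h
    exact hm.continuous
  have hcons := hamiltonian_radial_eq (fun J => continuous_cutoff R (hu' J))
    (fun J s => hasDerivAt_cutoffPotential R (hu' J) s) h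
  -- The cut-off energy, which is conserved, need not be coercive. It agrees with the original one
  -- as long as the traces stay in the closed ball.
  have heq : ∀ Φ : Phase, (∀ J, ‖Φ.psiAt (X J)‖ ≤ R) →
      hamiltonian m X (fun J z => cutoffPotential R (u J) (‖z‖ ^ 2)) Φ
        = hamiltonian m X (fun J z => u J (‖z‖ ^ 2)) Φ := fun Φ hΦ => by
    rw [hamiltonian_eq, hamiltonian_eq]
    congr 1
    refine Finset.sum_congr rfl fun J _ => ?_
    exact cutoffPotential_of_le (hu' J) (hd J) (by positivity)
      (pow_le_pow_left₀ (norm_nonneg _) (hΦ J) 2)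
  have h0 : ∀ J, ‖(Ψ 0).psiAt (X J)‖ < R := fun J => hR _ hE _
  set G : Set ℝ := {t | ∀ J, ‖(Ψ t).psiAt (X J)‖ < R} with hG
  have hyc : ∀ J, Continuous fun t => ‖(Ψ t).psiAt (X J)‖ := fun J =>
    ((continuous_psiAt (X J)).comp hΨ).norm
  have hopen : IsOpen G := by
    have e : G = ⋂ J, {t | ‖(Ψ t).psiAt (X J)‖ < R} := by ext; simp [hG]
    rw [e]
    exact isOpen_iInter_of_finite fun J => isOpen_lt (hyc J) continuous_const
  -- Traces at most `R` make the original energy equal to its initial value, and this forces them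
  -- strictly below `R`. So the strict and the weak inequality define the same set of times.
  have hclosed : IsClosed G := by
    have e : G = ⋂ J, {t | ‖(Ψ t).psiAt (X J)‖ ≤ R} := by
      ext t
      rw [mem_iInter]
      refine ⟨fun ht J => (ht J).le, fun ht J => hR _ ?_ _⟩
      rw [← heq _ ht, hcons t, heq _ fun J => (h0 J).le]
      exact hE
    rw [e]
    exact isClosed_iInter fun J => isClosed_le (hyc J) continuous_const
  have huniv : G = univ := IsClopen.eq_univ ⟨hclosed, hopen⟩ ⟨0, h0⟩
  have ht : t ∈ G := huniv ▸ mem_univ t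
  exact ht J

lemma IsMildSol.congr {F F' : Fin N → ℂ → ℂ} {Ψ : ℝ → Phase} (h : IsMildSol m X F Ψ)
    (hF : ∀ J t, F J ((Ψ t).psiAt (X J)) = F' J ((Ψ t).psiAt (X J))) : IsMildSol m X F' Ψ := by
  obtain ⟨f, hf, hm⟩ := h
  exact ⟨f, fun J t => (hf J t).trans (hF J t), hm⟩

lemma exists_lipschitz_radial_cutoff_family (hu : ∀ J, ContDiff ℝ 2 (u J)) {R : ℝ} (hR : 0 ≤ R) :
    ∃ L, 0 ≤ L ∧ ∀ J z w, ‖radial (cutoff R (deriv (u J))) z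
      - radial (cutoff R (deriv (u J))) w‖ ≤ L * ‖z - w‖ := by
  have h1 : ∀ J, ContDiff ℝ 1 (deriv (u J)) := fun J =>
    ((contDiff_succ_iff_deriv (n := 1)).1 (by simpa [one_add_one_eq_two] using hu J)).2.2
  choose L hL0 hL using fun J => exists_lipschitz_radial_cutoff hR (h1 J)
  refine ⟨∑ J, L J, Finset.sum_nonneg fun J _ => hL0 J, fun J z w => (hL J z w).trans ?_⟩
  exact mul_le_mul_of_nonneg_right
    (Finset.single_le_sum (fun J _ => hL0 J) (Finset.mem_univ J)) (norm_nonneg _)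

/-- Global existence. -/
lemma exists_isMildSol (hm : 0 < m) (hu : ∀ J, ContDiff ℝ 2 (u J)) (hB : ∀ J, 0 ≤ B J)
    (hbelow : ∀ J (ψ : ℂ), A J - B J * ‖ψ‖ ^ 2 ≤ u J (‖ψ‖ ^ 2)) (hsum : ∑ J, B J < m)
    (Ψ₀ : Phase) : ∃ Ψ, IsMildSol m X (fun J => radial (deriv (u J))) Ψ ∧ Ψ 0 = Ψ₀ := by
  obtain ⟨R, hR0, hR⟩ := exists_norm_psiAt_lt (X := X) hm hB hbelow hsum
    (hamiltonian m X (fun J z => u J (‖z‖ ^ 2)) Ψ₀)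
  obtain ⟨L, hL0, hL⟩ := exists_lipschitz_radial_cutoff_family hu hR0
  obtain ⟨Ψ, hΨ, h0⟩ := exists_isMildSol_of_lipschitz m X hL0 hL (fun J => radial_zero _) Ψ₀
  have hlt := norm_psiAt_lt_of_cutoff hu hR hΨ (by rw [h0])
  exact ⟨Ψ, hΨ.congr fun J t => radial_cutoff_of_le _ (hlt J t).le, h0⟩

/-- Continuous dependence on the initial state, uniformly on sets of bounded energy. -/
lemma exists_norm_sub_le (hm : 0 < m) (hu : ∀ J, ContDiff ℝ 2 (u J)) (hB : ∀ J, 0 ≤ B J)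
    (hbelow : ∀ J (ψ : ℂ), A J - B J * ‖ψ‖ ^ 2 ≤ u J (‖ψ‖ ^ 2)) (hsum : ∑ J, B J < m) (E : ℝ) :
    ∃ μ : ℝ, ∀ Ψ₁ Ψ₂ : ℝ → Phase, IsMildSol m X (fun J => radial (deriv (u J))) Ψ₁ →
      IsMildSol m X (fun J => radial (deriv (u J))) Ψ₂ →
      hamiltonian m X (fun J z => u J (‖z‖ ^ 2)) (Ψ₁ 0) ≤ E →
      hamiltonian m X (fun J z => u J (‖z‖ ^ 2)) (Ψ₂ 0) ≤ E →
      ∀ t, ‖Ψ₁ t - Ψ₂ t‖ ≤ 6 * ‖Ψ₁ 0 - Ψ₂ 0‖ * Real.exp (μ * |t|) := by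
  obtain ⟨R, hR0, hR⟩ := exists_norm_psiAt_lt (X := X) hm hB hbelow hsum E
  obtain ⟨L, hL0, hL⟩ := exists_lipschitz_radial_cutoff_family hu hR0
  obtain ⟨μ, hμ⟩ := exists_stability m X hL0 hL
  have hpos : 0 < 1 - (∑ J, B J) / m := by
    rw [sub_pos, div_lt_one hm]
    exact hsum
  obtain ⟨C, hC⟩ := exists_norm_le_of_quadEnergy hm ((E - ∑ J, A J) / (1 - (∑ J, B J) / m))
  -- Below the energy level `E`, one radius `R` serves all solutions, hence so does one Lipschitz
  -- constant. The norm bound supplies the finiteness that `exists_stability` asks for.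
  have key : ∀ Ψ : ℝ → Phase, IsMildSol m X (fun J => radial (deriv (u J))) Ψ →
      hamiltonian m X (fun J z => u J (‖z‖ ^ 2)) (Ψ 0) ≤ E →
      IsMildSol m X (fun J => radial (cutoff R (deriv (u J)))) Ψ ∧ ∀ t, ‖Ψ t‖ ≤ C := by
    intro Ψ h hE
    have hcons : ∀ t, hamiltonian m X (fun J z => u J (‖z‖ ^ 2)) (Ψ t) ≤ E := fun t => by
      rw [hamiltonian_radial_eq (fun J => (hu J).continuous_deriv (by norm_num))
        (fun J s => ((hu J).differentiable (by norm_num) s).hasDerivAt) h t]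
      exact hE
    refine ⟨h.congr fun J t => (radial_cutoff_of_le _ (hR _ (hcons t) _).le).symm, fun t => hC _ ?_⟩
    refine (quadEnergy_le_of_hamiltonian hm X hB hbelow hsum (Ψ t)).trans ?_
    have := hcons t
    gcongr
  refine ⟨μ, fun Ψ₁ Ψ₂ h₁ h₂ hE₁ hE₂ => ?_⟩
  obtain ⟨h₁, hC₁⟩ := key Ψ₁ h₁ hE₁
  obtain ⟨h₂, hC₂⟩ := key Ψ₂ h₂ hE₂
  exact hμ Ψ₁ Ψ₂ h₁ h₂ ⟨C + C, fun t => (norm_sub_le _ _).trans (add_le_add (hC₁ t) (hC₂ t))⟩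

end cauchy

end KGOsc

end

/-! ### Well-posedness, conservation laws and the a priori bound -/

theorem theorem2p2 {N : ℕ} (m : ℝ) (hm : 0 < m) (X : Fin N → ℝ) (hX : StrictMono X)
    (F : Fin N → ℂ → ℂ) (U : Fin N → ℂ → ℝ) (u : Fin N → ℝ → ℝ) (A B : Fin N → ℝ)
    (hF : ∀ J ψ, F J ψ = -∇ (U J) ψ)
    (hU : ∀ J ψ, U J ψ = u J (‖ψ‖ ^ 2))
    (hu : ∀ J, ContDiff ℝ 2 (u J))
    (hB : ∀ J, 0 ≤ B J)
    (hbelow : ∀ J ψ, A J - B J * ‖ψ‖ ^ 2 ≤ U J ψ)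
    (hsum : ∑ J, B J < m) :
    -- global existence and uniqueness in the energy space
    (∀ Ψ₀ : KGOsc.Phase, ∃! Ψ : ℝ → KGOsc.Phase, KGOsc.IsSolution m X F Ψ₀ Ψ) ∧
    -- continuity of the solution map for each time
    (∃ W : ℝ → KGOsc.Phase → KGOsc.Phase,
      (∀ Ψ₀, KGOsc.IsSolution m X F Ψ₀ (fun t => W t Ψ₀)) ∧ ∀ t, Continuous (W t)) ∧
    -- conservation of energy and charge
    (∀ (Ψ₀ : KGOsc.Phase) (Ψ : ℝ → KGOsc.Phase), KGOsc.IsSolution m X F Ψ₀ Ψ → ∀ t,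
      KGOsc.hamiltonian m X U (Ψ t) = KGOsc.hamiltonian m X U Ψ₀ ∧
        KGOsc.charge (Ψ t) = KGOsc.charge Ψ₀) ∧
    -- a priori bound on the energy norm, uniform in time
    (∃ C : KGOsc.Phase → ℝ, ∀ (Ψ₀ : KGOsc.Phase) (Ψ : ℝ → KGOsc.Phase),
      KGOsc.IsSolution m X F Ψ₀ Ψ → ∀ t, KGOsc.energyNorm m (Ψ t) ≤ C Ψ₀) := by
  have hUe : U = fun J z => u J (‖z‖ ^ 2) := funext fun J => funext fun z => hU J z
  have hd : ∀ J s, HasDerivAt (u J) (deriv (u J) s) s := fun J s =>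
    ((hu J).differentiable (by norm_num) s).hasDerivAt
  have hu' : ∀ J, Continuous (deriv (u J)) := fun J => (hu J).continuous_deriv (by norm_num)
  have hFe : F = fun J => KGOsc.radial (deriv (u J)) := by
    funext J z
    rw [hF, hUe, (KGOsc.hasGradientAt_radial (v := deriv (u J)) (hd J _)).gradient, neg_neg]
  subst hUe
  subst hFe
  have hFc : ∀ J, Continuous (KGOsc.radial (deriv (u J))) := fun J =>
    KGOsc.continuous_radial (hu' J)
  -- From here on distributional solutions may be replaced by mild ones.
  have hsol : ∀ (Ψ₀ : KGOsc.Phase) (Ψ : ℝ → KGOsc.Phase),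
      KGOsc.IsSolution m X (fun J => KGOsc.radial (deriv (u J))) Ψ₀ Ψ ↔
      KGOsc.IsMildSol m X (fun J => KGOsc.radial (deriv (u J))) Ψ ∧ Ψ 0 = Ψ₀ := by
    refine fun Ψ₀ Ψ => ⟨fun h => ⟨h.solves.isMildSol hFc h.continuous, h.initial⟩, fun h => ?_⟩
    have hc : Continuous Ψ := by
      obtain ⟨⟨f, -, hm⟩, -⟩ := h
      exact hm.continuous
    exact ⟨hc, h.1.solvesSystem, h.2⟩
  have hcons : ∀ (Ψ₀ : KGOsc.Phase) (Ψ : ℝ → KGOsc.Phase),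
      KGOsc.IsSolution m X (fun J => KGOsc.radial (deriv (u J))) Ψ₀ Ψ → ∀ t,
      KGOsc.hamiltonian m X (fun J z => u J (‖z‖ ^ 2)) (Ψ t)
        = KGOsc.hamiltonian m X (fun J z => u J (‖z‖ ^ 2)) Ψ₀ := fun Ψ₀ Ψ h t => by
    rw [KGOsc.hamiltonian_radial_eq hu' hd ((hsol _ _).1 h).1 t, h.initial]
  have hex := KGOsc.exists_isMildSol (X := X) hm hu hB hbelow hsum
  refine ⟨fun Ψ₀ => ?_, ?_, fun Ψ₀ Ψ h t => ⟨hcons Ψ₀ Ψ h t, ?_⟩, ?_⟩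
  · obtain ⟨Ψ, hΨ⟩ := hex Ψ₀
    refine ⟨Ψ, (hsol _ _).2 hΨ, fun Φ hΦ => ?_⟩
    -- Uniqueness is stability for equal initial states, at the energy level of `Ψ₀` itself.
    obtain ⟨μ, hμ⟩ := KGOsc.exists_norm_sub_le (X := X) hm hu hB hbelow hsum
      (KGOsc.hamiltonian m X (fun J z => u J (‖z‖ ^ 2)) Ψ₀)
    have hΦ' := (hsol _ _).1 hΦ
    funext t
    have h1 := hμ Φ Ψ hΦ'.1 hΨ.1 (by rw [hΦ'.2]) (by rw [hΨ.2]) t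
    rw [hΦ'.2, hΨ.2, sub_self, norm_zero, mul_zero, zero_mul] at h1
    exact sub_eq_zero.1 (norm_eq_zero.1 (le_antisymm h1 (norm_nonneg _)))
  · choose V hV hV0 using hex
    refine ⟨fun t Ψ₀ => V Ψ₀ t, fun Ψ₀ => (hsol _ _).2 ⟨hV Ψ₀, hV0 Ψ₀⟩, fun t => ?_⟩
    refine continuous_iff_continuousAt.2 fun Ψ₀ => ?_
    set H := KGOsc.hamiltonian m X (fun J z => u J (‖z‖ ^ 2)) with hH
    have hHc : Continuous H := KGOsc.continuous_hamiltonian m X fun J =>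
      (hu J).continuous.comp (by fun_prop)
    -- The margin `1` makes the stability estimate available on a whole neighbourhood of `Ψ₀`, by
    -- continuity of the energy.
    obtain ⟨μ, hμ⟩ := KGOsc.exists_norm_sub_le (X := X) hm hu hB hbelow hsum (H Ψ₀ + 1)
    have hnear : ∀ᶠ Φ in 𝓝 Ψ₀, H Φ < H Ψ₀ + 1 :=
      hHc.continuousAt.eventually (gt_mem_nhds (by linarith))
    have hlim : Tendsto (fun Φ => 6 * ‖Φ - Ψ₀‖ * Real.exp (μ * |t|)) (𝓝 Ψ₀) (𝓝 0) := by
      have hc : Continuous fun Φ : KGOsc.Phase => 6 * ‖Φ - Ψ₀‖ * Real.exp (μ * |t|) := by fun_prop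
      simpa using hc.tendsto Ψ₀
    refine tendsto_iff_norm_sub_tendsto_zero.2 (squeeze_zero_norm' ?_ hlim)
    filter_upwards [hnear] with Φ hΦ
    have h1 := hμ (V Φ) (V Ψ₀) (hV Φ) (hV Ψ₀) (by rw [hV0]; exact hΦ.le)
      (by rw [hV0]; exact (lt_add_one _).le) t
    rw [hV0, hV0] at h1
    rwa [norm_norm]
  · have h1 := (hsol _ _).1 h
    rw [h1.1.charge_eq (fun J z => KGOsc.conj_mul_radial_im _ z) t, h1.2]
  · refine ⟨fun Ψ₀ => √(2 * ((KGOsc.hamiltonian m X (fun J z => u J (‖z‖ ^ 2)) Ψ₀ - ∑ J, A J)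
      / (1 - (∑ J, B J) / m))), fun Ψ₀ Ψ h t => ?_⟩
    beta_reduce
    rw [KGOsc.energyNorm_eq, ← hcons Ψ₀ Ψ h t]
    exact Real.sqrt_le_sqrt (mul_le_mul_of_nonneg_left
      (KGOsc.quadEnergy_le_of_hamiltonian hm X hB hbelow hsum (Ψ t)) zero_le_two)
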